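/- Let $p$ be a prime, $q=p^a$, and let $f\in\mathbf F_q[x_1,\dots,x_n]$ have degree $\delta\ge 1$. **The weight spectral sequence.** Let $\Omega^k$ be the module of differential $k$-forms of $\mathbf F_q[x_1,\dots,x_n]$ over $\mathbf F_q$, and make $\Omega^{\cdot}$ a complex with differential $\omega\mapsto df\wedge\omega$. Let $F_l\Omega^k$ be the $\mathbf F_q$-span of the forms $x^u\,dx_{i_1}\wedge\cdots\wedge dx_{i_k}$ with $|u|+(n-k)(\delta-1)\le l$. This increasing filtration is respected by the differential; let $$E_1^{r,s}=H^{r+s}(F_r/F_{r-1})\Rightarrow H^{r+s}(\Omega^{\cdot},df\wedge)$$ be its spectral sequence, so that $E_t^{r,s}=(Z_t^{r,s}+F_{r-1}\Omega^{r+s})/(df\wedge Z_{t-1}^{r+t-1,s-t}+F_{r-1}\Omega^{r+s})$ with $Z_t^{r,s}=\{\omega\in F_r\Omega^{r+s}: df\wedge\omega\in F_{r-t}\Omega^{r+s+1}\}$. **Dwork's complex.** Let $\mathbf C_p$ be the completion of an algebraic closure of $\mathbf Q_p$, with $\operatorname{ord}p=1$; let $K\subset\mathbf C_p$ be the unramified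 extension of $\mathbf Q_p$ of degree $a$, with an identification of its residue field with $\mathbf F_q$, and let $\zeta_p$ be a primitive $p$-th root of unity. Let $\gamma\in\mathbf Q_p(\zeta_p)$ satisfy $\sum_{i\ge0}\gamma^{p^i}/p^i=0$ and $\operatorname{ord}\gamma=1/(p-1)$, and put $\gamma_l=\sum_{i=0}^l\gamma^{p^i}/p^i$. For a rational number $b$ with $0<b<p/(p-1)$ choose a positive integer $M$ such that $Mb/p$ and $M\delta/(p(p-1))$ are integers, and $\pi\in\mathbf C_p$ with $\pi^{M\delta}=p$; put $\tilde\Omega_0=K(\zeta_p,\pi)$ and $$C(b)=\Big\{\sum_{u\in\mathbf N^n}A_u\pi^{Mb|u|}x^u : A_u\in\tilde\Omega_0,\ A_u\to0\Big\}.$$ Let $\hat f\in K[x_1,\dots,x_n]$ be the Teichmüller lifting of $f$ (its coefficients satisfy $\hat a^q=\hat a$ and it reduces to $f$), let $\hat f_i=\partial\hat f/\partial x_i$, let $\tau$ be the Frobenius automorphism of $K$ acting on coefficients, and put $$H_i=\sum_{l\ge0}\gamma_l\,p^l\,x_i^{p^l-1}\hat f_i^{\tau^l}(x^{p^l}),\qquad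 D_i=\pi^{\epsilon}\Big(\frac{\partial}{\partial x_i}+H_i\Big),\qquad \epsilon=Mb(\delta-1)-\frac{M\delta}{p-1}.$$ Let $\Omega^k_{C(b)}=\bigoplus_{i_1<\cdots<i_k}C(b)\,dx_{i_1}\wedge\cdots\wedge dx_{i_k}$ and $D(\xi\,dx_{i_1}\wedge\cdots\wedge dx_{i_k})=\big(\sum_iD_i(\xi)\,dx_i\big)\wedge dx_{i_1}\wedge\cdots\wedge dx_{i_k}$. **Theorem.** Let $e$ be an integer with $1\le e\le\delta$ and let $b$ be a rational number with $$\frac{\delta}{(p-1)(\delta-e+1)}<b<\frac{p\delta}{(p-1)\delta+e-1}.$$ 1. If $m$ is such that $E_e^{r,s}=0$ for all $r,s$ with $r+s=m$, then $H^m(\Omega^{\cdot}_{C(b)},D)=0$. 2. If $E_e^{r,s}=0$ for all $r,s$ with $r+s\ne n$, then $f$ has only finitely many critical points over $\overline{\mathbf F}_q$, each has a finite Milnor number $\dim_{\overline{\mathbf F}_q}\mathcal O_P/(\partial f/\partial x_1,\dots,\partial f/\partial x_n)$, where $\mathcal O_P$ is the local ring of affine $n$-space over $\overline{\mathbf F}_q$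 at $P$, and $H^n(\Omega^{\cdot}_{C(b)},D)$ is finite-dimensional over $\tilde\Omega_0$, with $$\dim_{\tilde\Omega_0}H^n(\Omega^{\cdot}_{C(b)},D)=M_f,$$ the sum of the Milnor numbers of the critical points of $f$. -/

import Mathlib

open scoped Topology

noncomputable section

namespace ExpSum

/-! ### Differential forms in `n` variables -/

/-- Differential forms `∑_S ω(S) dx_S` with coefficients in `C`, where for a subset
`S = {i₁ < ⋯ < i_k}` of the variables `dx_S = dx_{i₁} ∧ ⋯ ∧ dx_{i_k}`; a form is recorded by
its coefficients `ω(S)`. All degrees are taken together. -/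
abbrev Forms (n : ℕ) (C : Type*) : Type _ := Finset (Fin n) → C

section Complexes

variable {n : ℕ} {R C V : Type*} [CommRing R] [AddCommGroup C] [Module R C]
  [AddCommGroup V] [Module R V]

/-- The `k`-forms (`k ∈ ℤ`) whose coefficients lie in the submodule `W` of `C`. There are no
non-zero ones unless `0 ≤ k ≤ n`. -/
def formsOfDegree (n : ℕ) (W : Submodule R C) (k : ℤ) : Submodule R (Forms n C) where
  carrier := {ω | ∀ S : Finset (Fin n), ω S ∈ W ∧ ((S.card : ℤ) ≠ k → ω S = 0)}
  zero_mem' := fun S => ⟨W.zero_mem, fun _ => rfl⟩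
  add_mem' := fun {a b} ha hb S => ⟨W.add_mem (ha S).1 (hb S).1, fun h => by
    rw [Pi.add_apply, (ha S).2 h, (hb S).2 h, add_zero]⟩
  smul_mem' := fun c a ha S => ⟨W.smul_mem c (ha S).1, fun h => by
    rw [Pi.smul_apply, (ha S).2 h, smul_zero]⟩

/-- The operator `ξ dx_T ↦ (∑ᵢ Dᵢ(ξ) dxᵢ) ∧ dx_T` attached to operators `D₁, …, D_n` on the
coefficients. Since `dxᵢ ∧ dx_T` is `0` for `i ∈ T` and otherwise is
`(-1)^{#{j ∈ T : j < i}} dx_{T ∪ {i}}`, the coefficient of the image at `S` is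
`∑_{i ∈ S} (-1)^{#{j ∈ S : j < i}} Dᵢ(ω(S ∖ {i}))`. -/
def formsDiff (D : Fin n → C →ₗ[R] C) : Forms n C →ₗ[R] Forms n C where
  toFun ω S := ∑ i ∈ S, (-1 : ℤ) ^ (S.filter (· < i)).card • D i (ω (S.erase i))
  map_add' a b := by
    funext S
    simp [Finset.sum_add_distrib]
  map_smul' c a := by
    funext S
    simp [Finset.smul_sum, smul_comm c]

/-- The cohomology `ker(d : Ω^k → Ω^{k+1}) / d(Ω^{k-1})` of a complex given by a differential
`d` on an ambient module and the submodules `Ω^k` of homogeneous elements. -/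
abbrev Cohomology (d : V →ₗ[R] V) (Ω : ℤ → Submodule R V) (k : ℤ) : Type _ :=
  ↥(Ω k ⊓ LinearMap.ker d) ⧸
    ((Ω (k - 1)).map d).submoduleOf (Ω k ⊓ LinearMap.ker d)

/-- For a complex with an increasing filtration `F`, the elements `ω ∈ F_r Ω^k` with
`d ω ∈ F_{r-t}`. -/
def ssCycles (d : V →ₗ[R] V) (Ω F : ℤ → Submodule R V) (t r k : ℤ) : Submodule R V :=
  Ω k ⊓ F r ⊓ (F (r - t)).comap d

/-- `Z_t^{r,s} + F_{r-1} Ω^{r+s}`, where `Z_t^{r,s}` consists of the `ω ∈ F_r Ω^{r+s}` with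
`d ω ∈ F_{r-t}`. -/
def ssNum (d : V →ₗ[R] V) (Ω F : ℤ → Submodule R V) (t r s : ℤ) : Submodule R V :=
  ssCycles d Ω F t r (r + s) ⊔ (Ω (r + s) ⊓ F (r - 1))

/-- `d(Z_{t-1}^{r+t-1,s-t}) + F_{r-1} Ω^{r+s}`. -/
def ssDen (d : V →ₗ[R] V) (Ω F : ℤ → Submodule R V) (t r s : ℤ) : Submodule R V :=
  (ssCycles d Ω F (t - 1) (r + t - 1) (r + s - 1)).map d ⊔ (Ω (r + s) ⊓ F (r - 1))

/-- The term `E_t^{r,s}` of the spectral sequence of a complex with an increasing filtration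
`F`, which starts with `E_1^{r,s} = H^{r+s}(F_r / F_{r-1})`:
`E_t^{r,s} = (Z_t^{r,s} + F_{r-1}Ω^{r+s}) / (d(Z_{t-1}^{r+t-1,s-t}) + F_{r-1}Ω^{r+s})`. -/
abbrev SpectralTerm (d : V →ₗ[R] V) (Ω F : ℤ → Submodule R V) (t r s : ℤ) : Type _ :=
  ↥(ssNum d Ω F t r s) ⧸ (ssDen d Ω F t r s).submoduleOf (ssNum d Ω F t r s)

end Complexes

/-! ### The complex of polynomial forms with the differential `df ∧` -/

section Polynomial

variable {n : ℕ} {k : Type*} [Field k]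

/-- `ω ↦ df ∧ ω` on polynomial differential forms. -/
def wedgeDf (f : MvPolynomial (Fin n) k) :
    Forms n (MvPolynomial (Fin n) k) →ₗ[k] Forms n (MvPolynomial (Fin n) k) :=
  formsDiff fun i => LinearMap.mulLeft k (MvPolynomial.pderiv i f)

/-- The weight filtration `F_l`: the span of the homogeneous forms of degree at most `l`, where
`x^u dx_S` has degree `|u| + (n - #S)(δ - 1)`. -/
def weightFiltration (n : ℕ) (k : Type*) [Field k] (δ : ℕ) (l : ℤ) :
    Submodule k (Forms n (MvPolynomial (Fin n) k)) where
  carrier := {ω | ∀ (S : Finset (Fin n)) (u : Fin n →₀ ℕ), (ω S).coeff u ≠ 0 →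
    (u.degree : ℤ) + ((n : ℤ) - S.card) * ((δ : ℤ) - 1) ≤ l}
  zero_mem' := fun S u h => absurd (by simp) h
  add_mem' := fun {a b} ha hb S u h => by
    by_cases h1 : (a S).coeff u = 0
    · refine hb S u fun h2 => h ?_
      rw [Pi.add_apply, MvPolynomial.coeff_add, h1, h2, add_zero]
    · exact ha S u h1
  smul_mem' := fun c a ha S u h => by
    refine ha S u fun h1 => h ?_
    rw [Pi.smul_apply, MvPolynomial.coeff_smul, h1, smul_zero]

/-- The term `E_t^{r,s}` of the spectral sequence of the complex of polynomial forms with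
differential `df ∧`, filtered by weight, where `δ = deg f`. -/
abbrev WeightE (f : MvPolynomial (Fin n) k) (t r s : ℤ) : Type _ :=
  SpectralTerm (wedgeDf f) (formsOfDegree n ⊤) (weightFiltration n k f.totalDegree) t r s

end Polynomial

/-! ### Milnor numbers -/

section Milnor

variable {n : ℕ} {k : Type*} [Field k]

/-- The critical points of `g` with coordinates in `k`. -/
def criticalPoints (g : MvPolynomial (Fin n) k) : Set (Fin n → k) :=
  {P | ∀ i, MvPolynomial.eval P (MvPolynomial.pderiv i g) = 0}

/-- The maximal ideal of the polynomials vanishing at `P`. -/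
def pointIdeal (P : Fin n → k) : Ideal (MvPolynomial (Fin n) k) :=
  RingHom.ker (MvPolynomial.eval P)

instance pointIdeal_isPrime (P : Fin n → k) : (pointIdeal P).IsPrime :=
  RingHom.ker_isPrime _

/-- The local algebra `O_P / (∂g/∂x₁, …, ∂g/∂x_n)`, where `O_P` is the local ring of affine
space at `P`. -/
abbrev MilnorAlgebra (g : MvPolynomial (Fin n) k) (P : Fin n → k) : Type _ :=
  Localization.AtPrime (pointIdeal P) ⧸
    (Ideal.span (Set.range fun i => MvPolynomial.pderiv i g)).map
      (algebraMap (MvPolynomial (Fin n) k) (Localization.AtPrime (pointIdeal P)))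

/-- The Milnor number of `g` at `P`. -/
def milnorNumber (g : MvPolynomial (Fin n) k) (P : Fin n → k) : ℕ :=
  Module.finrank k (MilnorAlgebra g P)

/-- `f` over an algebraic closure of its field of coefficients. -/
def geom (f : MvPolynomial (Fin n) k) : MvPolynomial (Fin n) (AlgebraicClosure k) :=
  f.map (algebraMap k (AlgebraicClosure k))

/-- The sum of the Milnor numbers of the (geometric) critical points of `f`; meaningful if there
are finitely many critical points and all the Milnor algebras are finite-dimensional. -/
def sumMilnorNumbers (f : MvPolynomial (Fin n) k) : ℕ :=
  ∑ᶠ P ∈ criticalPoints (geom f), milnorNumber (geom f) P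

end Milnor

/-! ### Dwork's complex -/

section Dwork

variable (p : ℕ) [Fact p.Prime]

/-- The field `Ω₁ = ℚ_p(ζ_p)`, inside `ℂ_p`. -/
def Omega1 : IntermediateField ℚ_[p] ℂ_[p] :=
  IntermediateField.adjoin ℚ_[p] {z : ℂ_[p] | z ^ p = 1}

/-- For `q` a power of `p`, the unramified extension `K` of `ℚ_p` with residue field `𝔽_q`: it
is generated by the roots of `z ^ q = z`. -/
def unramified (q : ℕ) : IntermediateField ℚ_[p] ℂ_[p] :=
  IntermediateField.adjoin ℚ_[p] {z : ℂ_[p] | z ^ q = z}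

/-- The field `K(ζ_p, π)`. -/
def OmegaTilde0 (q : ℕ) (π : ℂ_[p]) : IntermediateField ℚ_[p] ℂ_[p] :=
  (unramified p q ⊔ Omega1 p) ⊔ IntermediateField.adjoin ℚ_[p] {π}

variable {p} {n : ℕ}

/-- `fhat` is the Teichmüller lifting of `f`, a polynomial over a finite field `F` which is
embedded by `ι` into the residue field of `ℂ_p`: each coefficient satisfies `a ^ #F = a`, and
`fhat` reduces to `f`. -/
def IsTeichmullerLift {F : Type*} [Field F] (ι : F →+* IsLocalRing.ResidueField 𝓞_ℂ_[p])
    (f : MvPolynomial (Fin n) F) (fhat : MvPolynomial (Fin n) 𝓞_ℂ_[p]) : Prop :=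
  (∀ u, fhat.coeff u ^ Nat.card F = fhat.coeff u) ∧
    fhat.map (IsLocalRing.residue 𝓞_ℂ_[p]) = f.map ι

/-- `γ ∈ ℚ_p(ζ_p)` is a zero of `∑ t^{p^i} / p^i` with `ord γ = 1 / (p - 1)`. -/
def IsDworkGamma (γ : ℂ_[p]) : Prop :=
  γ ∈ Omega1 p ∧ HasSum (fun i : ℕ => γ ^ p ^ i / (p : ℂ_[p]) ^ i) 0 ∧
    ‖γ‖ = (p : ℝ) ^ (-(1 / ((p : ℝ) - 1)))

/-- `γ_l = ∑_{i=0}^l γ^{p^i} / p^i`. -/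
def gammaSum (γ : ℂ_[p]) (l : ℕ) : ℂ_[p] :=
  ∑ i ∈ Finset.range (l + 1), γ ^ p ^ i / (p : ℂ_[p]) ^ i

/-- `g^{τ^l}` for a polynomial `g` whose coefficients are Teichmüller representatives: the
Frobenius automorphism `τ` of `K` sends each Teichmüller representative to its `p`-th power. -/
def frobTwist (l : ℕ) (g : MvPolynomial (Fin n) ℂ_[p]) : MvPolynomial (Fin n) ℂ_[p] :=
  ∑ u ∈ g.support, MvPolynomial.monomial u (g.coeff u ^ p ^ l)

/-- The power series `H_i = ∑_l γ_l p^l x_i^{p^l - 1} (∂g/∂x_i)^{τ^l}(x^{p^l})`, where the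
coefficients of `g` are Teichmüller representatives. Only finitely many `l` contribute to a
given coefficient, since the `l`-th term is divisible by `x_i^{p^l - 1}`. -/
def dworkH (γ : ℂ_[p]) (g : MvPolynomial (Fin n) ℂ_[p]) (i : Fin n) :
    MvPowerSeries (Fin n) ℂ_[p] :=
  fun v => ∑ᶠ l : ℕ, gammaSum γ l * (p : ℂ_[p]) ^ l *
    (MvPolynomial.X i ^ (p ^ l - 1) *
      MvPolynomial.expand (p ^ l) (MvPolynomial.pderiv i (frobTwist l g))).coeff v

/-- `D_i = π^ε (∂/∂x_i + H_i)` on formal power series. -/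
def dworkD (γ π : ℂ_[p]) (ε : ℤ) (g : MvPolynomial (Fin n) ℂ_[p]) (i : Fin n) :
    MvPowerSeries (Fin n) ℂ_[p] →ₗ[ℂ_[p]] MvPowerSeries (Fin n) ℂ_[p] :=
  π ^ ε • ((MvPowerSeries.pderiv ℂ_[p] i).toLinearMap +
    LinearMap.mulLeft ℂ_[p] (dworkH γ g i))

/-- The space `C(b)` of the series `∑_u A_u π^{N|u|} x^u` with `A_u` in the field `L` and
`A_u → 0`; here `N = Mb`. -/
def dworkC (n : ℕ) (L : IntermediateField ℚ_[p] ℂ_[p]) (π : ℂ_[p]) (N : ℕ) :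
    Submodule L (MvPowerSeries (Fin n) ℂ_[p]) where
  carrier := {ξ | ∃ A : (Fin n →₀ ℕ) → L,
    Filter.Tendsto (fun u => (A u : ℂ_[p])) Filter.cofinite (𝓝 0) ∧
      ∀ u, MvPowerSeries.coeff u ξ = (A u : ℂ_[p]) * π ^ (N * u.degree)}
  zero_mem' := ⟨0, by simpa using tendsto_const_nhds, by simp⟩
  add_mem' := by
    rintro a b ⟨A, hA, hA'⟩ ⟨B, hB, hB'⟩
    refine ⟨A + B, by simpa using hA.add hB, fun u => ?_⟩
    simp [hA' u, hB' u, add_mul]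
  smul_mem' := by
    rintro c a ⟨A, hA, hA'⟩
    refine ⟨c • A, by simpa using hA.const_mul (c : ℂ_[p]), fun u => ?_⟩
    have h : MvPowerSeries.coeff u (c • a) = (c : ℂ_[p]) * MvPowerSeries.coeff u a := rfl
    simp [h, hA' u, mul_assoc]

/-- Dwork's cohomology `H^m(Ω^•_{C(b)}, D)`, a vector space over `L = K(ζ_p, π)`. Here
`Ω^k_{C(b)}` consists of the `k`-forms with coefficients in `C(b)`, `N = Mb`,
`D(ξ dx_T) = (∑ᵢ Dᵢ(ξ) dxᵢ) ∧ dx_T`, and `Dᵢ` is formed with the exponent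
`ε = Mb(δ - 1) - Mδ/(p - 1)`. -/
abbrev DworkCohomology (L : IntermediateField ℚ_[p] ℂ_[p]) (γ π : ℂ_[p]) (M N δ : ℕ)
    (fhat : MvPolynomial (Fin n) 𝓞_ℂ_[p]) (m : ℤ) : Type _ :=
  Cohomology
    ((formsDiff (dworkD γ π ((N : ℤ) * ((δ : ℤ) - 1) - ((M * δ / (p - 1) : ℕ) : ℤ))
      (fhat.map (𝓞_ℂ_[p]).subtype))).restrictScalars L)
    (formsOfDegree n (dworkC n L π N)) m

end Dwork

end ExpSum

end

noncomputable section

namespace ExpSum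

/-! ### The algebra of forms -/

section FormsAlgebra

variable {n : ℕ} {R C C' : Type*} [CommRing R] [AddCommGroup C] [Module R C]

/-! Put `t = π ^ N`, of norm less than one. After the substitution `x ↦ t x`, and up to inverting a
uniformizer `lam`, the space `C(b)` consists of the series with integral coefficients tending to
zero. There `D_i` is a nonzero scalar times `κ ∂/∂x_i + h_i`, with `κ = t ^ δ / γ` and `h_i = t ^ (δ
- 1) γ⁻¹ H_i(x / t)`. The term `l = 0` of `h_i` is the `t`-homogenization of the derivative of the
lifting of `f`. The lower bound on `b` makes `lam * t ^ (e - 1)` divide `κ`, and the upper bound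
makes it divide the rest of `h_i`. Together they make it divide `p`, so Teichmüller representatives
are additive to this precision. Hence modulo `lam * t ^ (e - 1)` Dwork's complex is the complex `df
∧` homogenized by weight (`exists_dworkModel`).

The page `E_e` governs this complex to exactly that precision. If it vanishes in the degree of `ω`
and `D ω` vanishes modulo `lam * t ^ (e - 1)`, then `t ^ (e - 1) ω = D ζ + lam t ^ (e - 1) ω'`
(`exists_approx_primitive`). When `ω` is closed so is `ω'`, and iteration makes `t ^ (e - 1) ω`
exact (`exists_eq_of_step`). Since `t` is invertible in the coefficient field, the cohomology
vanishes.

If `E_e` vanishes outside degree `n`, the Koszul complex of the partial derivatives is exact below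
degree `n`. A depth argument then shows that every prime containing them is maximal, so the Jacobian
ring is finite-dimensional; over the algebraic closure it is the product of the Milnor algebras. Its
standard monomials for a degree order give top forms that generate `H^n` by the same approximation
(`exists_reduction`). In a relation between them all coefficients are divisible by every power of
`lam` (`eq_zero_of_smul_exact`), so they form a basis. -/

/-- The sign of `dxᵢ` in `dx_S`. -/
def formSign (i : Fin n) (S : Finset (Fin n)) : ℤ := (-1) ^ (S.filter (· < i)).card

theorem formsDiff_apply (D : Fin n → C →ₗ[R] C) (ω : Forms n C) (S : Finset (Fin n)) :
    formsDiff D ω S = ∑ i ∈ S, formSign i S • D i (ω (S.erase i)) := rfl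

/-- Removing the smaller index `i` lowers the count for `j` by one, while removing `j` does not
affect the count for `i`. -/
theorem formSign_swap_of_lt {S : Finset (Fin n)} {i j : Fin n} (hi : i ∈ S) (hij : i < j) :
    formSign i S * formSign j (S.erase i) = -(formSign j S * formSign i (S.erase j)) := by
  have h1 : (S.erase j).filter (· < i) = S.filter (· < i) := by
    ext x
    simp only [Finset.mem_filter, Finset.mem_erase]
    exact ⟨fun h => ⟨h.1.2, h.2⟩, fun h => ⟨⟨(h.2.trans hij).ne, h.1⟩, h.2⟩⟩
  have h2 : (S.erase i).filter (· < j) = (S.filter (· < j)).erase i := by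
    ext x
    simp only [Finset.mem_filter, Finset.mem_erase]
    tauto
  have h3 : ((S.filter (· < j)).erase i).card + 1 = (S.filter (· < j)).card :=
    Finset.card_erase_add_one (Finset.mem_filter.2 ⟨hi, hij⟩)
  simp only [formSign]
  rw [h1, h2, ← h3, pow_succ]
  ring

theorem formSign_swap {S : Finset (Fin n)} {i j : Fin n} (hi : i ∈ S) (hj : j ∈ S) (hij : i ≠ j) :
    formSign i S * formSign j (S.erase i) = -(formSign j S * formSign i (S.erase j)) := by
  rcases lt_or_gt_of_ne hij with h | h
  · exact formSign_swap_of_lt hi h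
  · rw [formSign_swap_of_lt hj h, neg_neg]

/-- The terms for `(i, j)` and `(j, i)` have the same operator and opposite signs, so swapping the
pair is a cancelling involution. -/
theorem formsDiff_formsDiff {D : Fin n → C →ₗ[R] C} (hD : ∀ i j x, D i (D j x) = D j (D i x))
    (ω : Forms n C) : formsDiff D (formsDiff D ω) = 0 := by
  funext S
  simp only [formsDiff_apply, Pi.zero_apply, map_sum, Finset.smul_sum, map_zsmul, smul_smul]
  rw [Finset.sum_sigma']
  refine Finset.sum_involution (fun x _ => ⟨x.2, x.1⟩) ?_ ?_ ?_ ?_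
  · rintro ⟨i, j⟩ h
    simp only [Finset.mem_sigma, Finset.mem_erase] at h
    rw [Finset.erase_right_comm, hD j i, formSign_swap h.1 h.2.2 (Ne.symm h.2.1), neg_smul]
    exact neg_add_cancel _
  · rintro ⟨i, j⟩ h _ h'
    simp only [Finset.mem_sigma, Finset.mem_erase] at h
    simp only [Sigma.mk.injEq, heq_eq_eq] at h'
    exact h.2.1 h'.1
  · rintro ⟨i, j⟩ h
    simp only [Finset.mem_sigma, Finset.mem_erase] at h ⊢
    exact ⟨h.2.2, Ne.symm h.2.1, h.1⟩
  · rintro ⟨i, j⟩ h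
    rfl

/-- The form `ω` is homogeneous of degree `k`. -/
def IsHomogForm {C : Type*} [Zero C] (k : ℤ) (ω : Forms n C) : Prop :=
  ∀ S : Finset (Fin n), (S.card : ℤ) ≠ k → ω S = 0

theorem mem_formsOfDegree {W : Submodule R C} {k : ℤ} {ω : Forms n C} :
    ω ∈ formsOfDegree n W k ↔ (∀ S, ω S ∈ W) ∧ IsHomogForm k ω :=
  forall_and

namespace IsHomogForm

theorem zero (k : ℤ) : IsHomogForm k (0 : Forms n C) := fun _ _ => rfl

theorem add {k : ℤ} {ω η : Forms n C} (hω : IsHomogForm k ω) (hη : IsHomogForm k η) :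
    IsHomogForm k (ω + η) := fun S h => by rw [Pi.add_apply, hω S h, hη S h, add_zero]

theorem sub {k : ℤ} {ω η : Forms n C} (hω : IsHomogForm k ω) (hη : IsHomogForm k η) :
    IsHomogForm k (ω - η) := fun S h => by rw [Pi.sub_apply, hω S h, hη S h, sub_zero]

theorem smul {k : ℤ} (c : R) {ω : Forms n C} (hω : IsHomogForm k ω) :
    IsHomogForm k (c • ω) := fun S h => by rw [Pi.smul_apply, hω S h, smul_zero]

theorem formsDiff {k : ℤ} {ω : Forms n C} (D : Fin n → C →ₗ[R] C) (hω : IsHomogForm k ω) :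
    IsHomogForm (k + 1) (formsDiff D ω) := fun S hS => by
  rw [formsDiff_apply]
  refine Finset.sum_eq_zero fun i hi => ?_
  rw [hω, map_zero, smul_zero]
  have := Finset.card_erase_add_one hi
  intro h
  apply hS
  rw [← h, ← this]
  push_cast
  ring

theorem eq_zero {k : ℤ} (hk : k < 0) {ω : Forms n C} (hω : IsHomogForm k ω) : ω = 0 :=
  funext fun S => hω S (by omega)

end IsHomogForm

theorem formsDiff_map [AddCommGroup C'] {R' : Type*} [CommRing R'] [Module R' C']
    (D : Fin n → C →ₗ[R] C) (D' : Fin n → C' →ₗ[R'] C') (g : C →+ C')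
    (h : ∀ i x, g (D i x) = D' i (g x)) (ω : Forms n C) (S : Finset (Fin n)) :
    g (formsDiff D ω S) = formsDiff D' (fun T => g (ω T)) S := by
  simp only [formsDiff_apply, map_sum, map_zsmul, h]

end FormsAlgebra

/-! ### Vanishing on a page of the weight spectral sequence -/

section Weight

variable {n : ℕ} {k : Type*} [Field k]

/-- The weight of `x^u dx_S`. -/
def formWeight (δ : ℕ) (S : Finset (Fin n)) (u : Fin n →₀ ℕ) : ℤ :=
  (u.degree : ℤ) + ((n : ℤ) - S.card) * ((δ : ℤ) - 1)

theorem formWeight_nonneg {δ : ℕ} (hδ : 1 ≤ δ) (S : Finset (Fin n)) (u : Fin n →₀ ℕ) :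
    0 ≤ formWeight δ S u := by
  have h1 : (S.card : ℤ) ≤ n := by exact_mod_cast S.card_le_univ.trans_eq (Fintype.card_fin n)
  have h2 : (1 : ℤ) ≤ δ := by exact_mod_cast hδ
  have h3 : 0 ≤ ((n : ℤ) - S.card) * ((δ : ℤ) - 1) := mul_nonneg (by linarith) (by linarith)
  have h4 : (0 : ℤ) ≤ u.degree := Int.natCast_nonneg _
  exact add_nonneg h4 h3

theorem mem_weightFiltration {δ : ℕ} {l : ℤ} {ω : Forms n (MvPolynomial (Fin n) k)} :
    ω ∈ weightFiltration n k δ l ↔ ∀ S u, l < formWeight δ S u → (ω S).coeff u = 0 := by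
  refine forall₂_congr fun S u => ?_
  rw [← not_imp_not, not_not, not_le]
  rfl

theorem weightFiltration_mono {δ : ℕ} {l m : ℤ} (h : l ≤ m) :
    weightFiltration n k δ l ≤ weightFiltration n k δ m := fun _ hω S u hu =>
  (hω S u hu).trans h

theorem eq_zero_of_mem_weightFiltration_neg {δ : ℕ} (hδ : 1 ≤ δ) {l : ℤ} (hl : l < 0)
    {ω : Forms n (MvPolynomial (Fin n) k)} (hω : ω ∈ weightFiltration n k δ l) : ω = 0 := by
  funext S
  ext u
  exact mem_weightFiltration.1 hω S u (hl.trans_le (formWeight_nonneg hδ S u))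

theorem exists_mem_weightFiltration (δ : ℕ) (ω : Forms n (MvPolynomial (Fin n) k)) :
    ∃ l : ℕ, ω ∈ weightFiltration n k δ l := by
  obtain ⟨l, hl⟩ : ∃ l : ℕ, ∀ S : Finset (Fin n), ∀ u ∈ (ω S).support,
      formWeight δ S u ≤ l := by
    refine ⟨Finset.univ.sup fun S => (ω S).support.sup fun u => (formWeight δ S u).toNat,
      fun S u hu => (Int.self_le_toNat _).trans ?_⟩
    exact_mod_cast (Finset.le_sup (f := fun u => (formWeight δ S u).toNat) hu).trans
      (Finset.le_sup (f := fun S => (ω S).support.sup fun u => (formWeight δ S u).toNat)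
        (Finset.mem_univ S))
  exact ⟨l, fun S u hu => hl S u (MvPolynomial.mem_support_iff.2 hu)⟩

theorem wedgeDf_wedgeDf (f : MvPolynomial (Fin n) k) (ω : Forms n (MvPolynomial (Fin n) k)) :
    wedgeDf f (wedgeDf f ω) = 0 :=
  formsDiff_formsDiff (fun i j x => by simp [mul_left_comm]) ω

variable {f : MvPolynomial (Fin n) k} {e : ℕ}

/-- This unfolds the vanishing of `E_e^{r,s}`: the form `ω` lies in `Z_e^{r,s}`, and `η` is taken in
`Z_{e-1}^{r+e-1,s-e}`, whence the two weight bounds on `η` and `df ∧ η`. -/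
theorem exists_primitive_of_subsingleton {r s m : ℤ} (h : Subsingleton (WeightE f e r s))
    (hm : r + s = m) {ω : Forms n (MvPolynomial (Fin n) k)} (hom : IsHomogForm m ω)
    (hω : ω ∈ weightFiltration n k f.totalDegree r)
    (hd : wedgeDf f ω ∈ weightFiltration n k f.totalDegree (r - e)) :
    ∃ η, IsHomogForm (m - 1) η ∧ η ∈ weightFiltration n k f.totalDegree (r + e - 1) ∧
      wedgeDf f η ∈ weightFiltration n k f.totalDegree r ∧
      ω - wedgeDf f η ∈ weightFiltration n k f.totalDegree (r - 1) := by
  subst hm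
  rw [Submodule.Quotient.subsingleton_iff] at h
  have h' := Submodule.comap_subtype_eq_top.1 h
  have h1 : ω ∈ ssNum (wedgeDf f) (formsOfDegree n ⊤) (weightFiltration n k f.totalDegree) e r s :=
    Submodule.mem_sup_left
      ⟨⟨mem_formsOfDegree.2 ⟨fun _ => Submodule.mem_top, hom⟩, hω⟩, hd⟩
  obtain ⟨_, ⟨η, hη, rfl⟩, ζ, hζ, hsum⟩ := Submodule.mem_sup.1 (h' h1)
  refine ⟨η, (mem_formsOfDegree.1 hη.1.1).2, ?_, ?_, ?_⟩
  · exact hη.1.2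
  · have := hη.2
    rwa [SetLike.mem_coe, Submodule.mem_comap,
      show r + (e : ℤ) - 1 - (e - 1) = r by ring] at this
  · rw [← hsum, add_sub_cancel_left]
    exact hζ.2

/-- A closed form lies in every `Z_e`, so its top weight can be removed by an exact form. Weights
are nonnegative, so the descent stops. -/
theorem exists_primitive_of_closed (hδ : 1 ≤ f.totalDegree) {m : ℤ}
    (h : ∀ r s : ℤ, r + s = m → Subsingleton (WeightE f e r s)) (l : ℕ) :
    ∀ ω : Forms n (MvPolynomial (Fin n) k), IsHomogForm m ω →
    ω ∈ weightFiltration n k f.totalDegree ((l : ℤ) - 1) → wedgeDf f ω = 0 →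
    ∃ η, IsHomogForm (m - 1) η ∧ η ∈ weightFiltration n k f.totalDegree ((l : ℤ) - 1 + e - 1) ∧
      wedgeDf f η = ω := by
  induction l with
  -- The filtration index is `l - 1`, so the induction starts at `F_{-1} = 0`.
  | zero =>
    intro ω _ hω _
    exact ⟨0, IsHomogForm.zero _, Submodule.zero_mem _, by
      rw [map_zero, eq_zero_of_mem_weightFiltration_neg hδ (by simp) hω]⟩
  | succ l ih =>
    intro ω hom hω hd
    push_cast at hω ⊢
    rw [add_sub_cancel_right] at hω ⊢
    obtain ⟨η, h1, h2, -, h4⟩ := exists_primitive_of_subsingleton (h l (m - l) (by ring))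
      (by ring) hom hω (by rw [hd]; exact Submodule.zero_mem _)
    have hom' : IsHomogForm m (wedgeDf f η) := by
      have := h1.formsDiff fun i => LinearMap.mulLeft k (MvPolynomial.pderiv i f)
      rwa [sub_add_cancel] at this
    obtain ⟨η', h1', h2', h3'⟩ := ih (ω - wedgeDf f η) (hom.sub hom') h4
      (by rw [map_sub, hd, wedgeDf_wedgeDf, sub_zero])
    exact ⟨η + η', h1.add h1', Submodule.add_mem _ h2
      (weightFiltration_mono (by linarith) h2'), by rw [map_add, h3', add_sub_cancel]⟩

/-- A primitive can be chosen with weight at most `e - 1` above that of its differential. At any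
higher weight it lies in `Z_e`, so an exact form, which does not change the differential, removes
its top weight. -/
theorem exists_same_wedgeDf_of_mem {m : ℤ}
    (h : ∀ r s : ℤ, r + s = m → Subsingleton (WeightE f e r s)) (r : ℤ) (l : ℕ) :
    ∀ η : Forms n (MvPolynomial (Fin n) k), IsHomogForm m η →
    η ∈ weightFiltration n k f.totalDegree (r + e - 1 + l) →
    wedgeDf f η ∈ weightFiltration n k f.totalDegree r →
    ∃ η', IsHomogForm m η' ∧ η' ∈ weightFiltration n k f.totalDegree (r + e - 1) ∧
      wedgeDf f η' = wedgeDf f η := by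
  induction l with
  | zero =>
    intro η hom hη _
    exact ⟨η, hom, by simpa using hη, rfl⟩
  | succ l ih =>
    intro η hom hη hd
    obtain ⟨ξ, h1, -, -, h4⟩ := exists_primitive_of_subsingleton
      (h (r + e - 1 + (l + 1 : ℕ)) (m - (r + e - 1 + (l + 1 : ℕ))) (by ring)) (by ring) hom hη
      (weightFiltration_mono (by push_cast; linarith) hd)
    have hom' : IsHomogForm m (wedgeDf f ξ) := by
      have := h1.formsDiff fun i => LinearMap.mulLeft k (MvPolynomial.pderiv i f)
      rwa [sub_add_cancel] at this
    have hd' : wedgeDf f (η - wedgeDf f ξ) = wedgeDf f η := by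
      rw [map_sub, wedgeDf_wedgeDf, sub_zero]
    obtain ⟨η', a, b, c⟩ := ih (η - wedgeDf f ξ) (hom.sub hom')
      (weightFiltration_mono (by push_cast; linarith) h4) (by rwa [hd'])
    exact ⟨η', a, b, c.trans hd'⟩

end Weight

/-! ### Null series -/

section NullSeries

variable {n : ℕ} {A : Type*} [CommRing A]

/-- The power series whose coefficients tend to `0` in the `lam`-adic topology. -/
def nullSeries (n : ℕ) (lam : A) : Submodule A (MvPowerSeries (Fin n) A) where
  carrier := {a | ∀ k : ℕ, {u | ¬ lam ^ k ∣ MvPowerSeries.coeff u a}.Finite}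
  zero_mem' k := by simp
  add_mem' {a b} ha hb k := ((ha k).union (hb k)).subset fun u hu => by
    by_contra h
    simp only [Set.mem_union, Set.mem_ofPred_eq, not_or, not_not] at h
    exact hu (by rw [map_add]; exact dvd_add h.1 h.2)
  smul_mem' c a ha k := (ha k).subset fun u hu h => hu (by
    rw [map_smul, smul_eq_mul]; exact h.mul_left c)

theorem mul_mem_nullSeries {lam : A} {a b : MvPowerSeries (Fin n) A}
    (ha : a ∈ nullSeries n lam) (hb : b ∈ nullSeries n lam) : a * b ∈ nullSeries n lam := by
  intro k
  refine ((ha k).image2 (· + ·) (hb k)).subset fun u hu => ?_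
  by_contra h
  refine hu ?_
  rw [MvPowerSeries.coeff_mul]
  refine Finset.dvd_sum fun x hx => ?_
  by_contra hx'
  exact h ⟨x.1, fun h1 => hx' (h1.mul_right _), x.2, fun h1 => hx' (h1.mul_left _),
    Finset.HasAntidiagonal.mem_antidiagonal.1 hx⟩

theorem pderiv_mem_nullSeries {lam : A} {a : MvPowerSeries (Fin n) A}
    (ha : a ∈ nullSeries n lam) (i : Fin n) :
    MvPowerSeries.pderiv A i a ∈ nullSeries n lam := by
  intro k
  refine ((ha k).preimage (f := fun u => u + Finsupp.single i 1)
    (add_left_injective _).injOn).subset fun u hu h => hu ?_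
  rw [MvPowerSeries.coeff_pderiv]
  exact h.mul_right _

theorem mem_nullSeries_of_finite {lam : A} {a : MvPowerSeries (Fin n) A} (s : Finset (Fin n →₀ ℕ))
    (h : ∀ u, u ∉ s → MvPowerSeries.coeff u a = 0) : a ∈ nullSeries n lam := fun k =>
  s.finite_toSet.subset fun u hu => by
    by_contra h'
    exact hu (by rw [h u (by simpa using h')]; exact dvd_zero _)

end NullSeries

/-! ### Differential operators on power series -/

section Operators

variable {n : ℕ} {A : Type*} [CommRing A]

/-- The operator `κ ∂/∂xᵢ + hᵢ`. -/
def twistedDeriv (kap : A) (h : Fin n → MvPowerSeries (Fin n) A) (i : Fin n) :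
    MvPowerSeries (Fin n) A →ₗ[A] MvPowerSeries (Fin n) A :=
  kap • (MvPowerSeries.pderiv A i).toLinearMap + LinearMap.mulLeft A (h i)

theorem twistedDeriv_apply (kap : A) (h : Fin n → MvPowerSeries (Fin n) A) (i : Fin n)
    (a : MvPowerSeries (Fin n) A) :
    twistedDeriv kap h i a = kap • MvPowerSeries.pderiv A i a + h i * a := rfl

theorem pderiv_comm (i j : Fin n) (a : MvPowerSeries (Fin n) A) :
    MvPowerSeries.pderiv A i (MvPowerSeries.pderiv A j a) =
      MvPowerSeries.pderiv A j (MvPowerSeries.pderiv A i a) := by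
  ext u
  simp only [MvPowerSeries.coeff_pderiv]
  by_cases hij : i = j
  · subst hij; rfl
  · rw [add_right_comm]
    simp [hij, Ne.symm hij]
    ring

/-- The commutator is multiplication by `κ (∂h_j/∂x_i - ∂h_i/∂x_j)`, so closedness of `∑ h_i dx_i`
suffices. -/
theorem twistedDeriv_comm {kap : A} {h : Fin n → MvPowerSeries (Fin n) A}
    (hh : ∀ i j, MvPowerSeries.pderiv A i (h j) = MvPowerSeries.pderiv A j (h i)) (i j : Fin n)
    (a : MvPowerSeries (Fin n) A) :
    twistedDeriv kap h i (twistedDeriv kap h j a) =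
      twistedDeriv kap h j (twistedDeriv kap h i a) := by
  simp only [twistedDeriv_apply, map_add, Derivation.leibniz, Derivation.map_smul, smul_eq_mul,
    smul_add, pderiv_comm i j, hh i j, mul_smul_comm]
  rw [mul_left_comm (h i) (h j) a, mul_comm a]
  abel

theorem twistedDeriv_mem_nullSeries {lam kap : A} {h : Fin n → MvPowerSeries (Fin n) A}
    (hh : ∀ i, h i ∈ nullSeries n lam) (i : Fin n) {a : MvPowerSeries (Fin n) A}
    (ha : a ∈ nullSeries n lam) : twistedDeriv kap h i a ∈ nullSeries n lam :=
  Submodule.add_mem _ (Submodule.smul_mem _ _ (pderiv_mem_nullSeries ha i))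
    (mul_mem_nullSeries (hh i) ha)

end Operators

/-! ### Integral models of Dwork's complex -/

/-- Operators `κ ∂/∂xᵢ + hᵢ` over a complete discrete valuation ring `A` with uniformizer `lam`,
which modulo `lam * t ^ (e - 1)` are multiplication by the `t`-homogenization of `∂f/∂xᵢ`, where
the field of coefficients of `f` is embedded into `A / (lam * t ^ (e - 1))` by `θ`. The additive
maps `φ i` read off coordinates with respect to elements `β i` which generate the residue
field. -/
structure DworkModel {n : ℕ} {F : Type*} [Field F] (f : MvPolynomial (Fin n) F) (e : ℕ)
    (A : Type*) [CommRing A] where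
  lam : A
  t : A
  kap : A
  h : Fin n → MvPowerSeries (Fin n) A
  θ : F → A
  d : ℕ
  β : Fin d → A
  φ : Fin d → A →+ F
  lam_ne_zero : lam ≠ 0
  t_ne_zero : t ≠ 0
  lam_dvd_t : lam ∣ t
  -- Divisibility is total, and strict divisibility gains a full factor `lam`: this is how `lam`
  -- acts as a uniformizer.
  dvd_total : ∀ x y : A, x ∣ y ∨ lam * y ∣ x
  separated : ∀ x : A, (∀ k : ℕ, lam ^ k ∣ x) → x = 0
  exists_sum : ∀ a : ℕ → A, ∃ s, ∀ k, lam ^ k ∣ s - ∑ j ∈ Finset.range k, lam ^ j * a j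
  dvd_kap : lam * t ^ (e - 1) ∣ kap
  curl : ∀ i j, MvPowerSeries.pderiv A i (h j) = MvPowerSeries.pderiv A j (h i)
  h_null : ∀ i, h i ∈ nullSeries n lam
  h_approx : ∀ i v, lam * t ^ (e - 1) ∣ MvPowerSeries.coeff v (h i) -
    t ^ (f.totalDegree - 1 - v.degree) * θ ((MvPolynomial.pderiv i f).coeff v)
  θ_zero : θ 0 = 0
  θ_one : θ 1 = 1
  θ_mul : ∀ x y, θ (x * y) = θ x * θ y
  θ_add : ∀ x y, lam * t ^ (e - 1) ∣ θ (x + y) - (θ x + θ y)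
  φ_θ_mul : ∀ i x a, φ i (θ x * a) = x * φ i a
  φ_eq_zero : ∀ i a, lam * t ^ (e - 1) ∣ a → φ i a = 0
  -- Since `φ i` is defined modulo `lam * t ^ (e - 1)`, the coordinates of `a` modulo `lam` are read
  -- from `t ^ (e - 1) * a`.
  φ_generates : ∀ a, lam ∣ a - ∑ i, β i * θ (φ i (t ^ (e - 1) * a))

theorem degree_le_of_coeff_pderiv_ne_zero {n : ℕ} {F : Type*} [Field F]
    {f : MvPolynomial (Fin n) F} {i : Fin n} {v : Fin n →₀ ℕ}
    (hv : (MvPolynomial.pderiv i f).coeff v ≠ 0) : v.degree + 1 ≤ f.totalDegree := by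
  rw [MvPolynomial.coeff_pderiv] at hv
  have h := MvPolynomial.le_totalDegree (MvPolynomial.mem_support_iff.2 (left_ne_zero_of_mul hv))
  have h2 : (v + Finsupp.single i 1).degree = v.degree + 1 := by simp
  rw [← h2]
  exact h

/-- A monomial `x^v` of `∂f/∂x_i` lowers the weight by `δ - 1 - |v|`, the same exponent of `t` that
multiplies it in `h_i`. Thus powers of `t` keep track of the weight. -/
theorem formWeight_erase {n δ : ℕ} (hδ : 1 ≤ δ) {S : Finset (Fin n)} {i : Fin n} (hi : i ∈ S)
    {u v w : Fin n →₀ ℕ} (huv : v + w = u) (hv : v.degree + 1 ≤ δ) :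
    formWeight δ (S.erase i) w = formWeight δ S u + (δ - 1 - v.degree : ℕ) := by
  have h1 : (S.card : ℤ) = (S.erase i).card + 1 := by
    exact_mod_cast (Finset.card_erase_add_one hi).symm
  subst huv
  simp only [formWeight, h1, map_add]
  push_cast [show v.degree ≤ δ - 1 by omega, hδ]
  ring

/-! ### Comparison of the model with `df ∧` modulo `lam * t ^ (e - 1)` -/

namespace DworkModel

variable {n : ℕ} {F : Type*} [Field F] {f : MvPolynomial (Fin n) F} {e : ℕ}
  {A : Type*} [CommRing A] (W : DworkModel f e A)

/-- The modulus up to which the operators are known. -/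
def modulus : A := W.lam * W.t ^ (e - 1)

/-- The differential of the model. -/
def diff : Forms n (MvPowerSeries (Fin n) A) →ₗ[A] Forms n (MvPowerSeries (Fin n) A) :=
  formsDiff (twistedDeriv W.kap W.h)

theorem diff_diff (ω : Forms n (MvPowerSeries (Fin n) A)) : W.diff (W.diff ω) = 0 :=
  formsDiff_formsDiff (fun i j x => twistedDeriv_comm W.curl i j x) ω

/-- The `k`-forms with null coefficients. -/
abbrev nullForms (k : ℤ) : Submodule A (Forms n (MvPowerSeries (Fin n) A)) :=
  formsOfDegree n (nullSeries n W.lam) k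

theorem diff_mem_nullForms {k : ℤ} {ω : Forms n (MvPowerSeries (Fin n) A)}
    (hω : ω ∈ W.nullForms k) : W.diff ω ∈ W.nullForms (k + 1) := by
  rw [mem_formsOfDegree] at hω ⊢
  refine ⟨fun S => ?_, hω.2.formsDiff _⟩
  rw [diff, formsDiff_apply]
  exact Submodule.sum_mem _ fun i _ => zsmul_mem
    (twistedDeriv_mem_nullSeries W.h_null i (hω.1 _)) _

theorem coeff_diff (ω : Forms n (MvPowerSeries (Fin n) A)) (S : Finset (Fin n))
    (u : Fin n →₀ ℕ) : MvPowerSeries.coeff u (W.diff ω S) =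
      ∑ i ∈ S, formSign i S • (W.kap * MvPowerSeries.coeff u (MvPowerSeries.pderiv A i
        (ω (S.erase i))) + ∑ x ∈ Finset.HasAntidiagonal.antidiagonal u, MvPowerSeries.coeff x.1 (W.h i) *
          MvPowerSeries.coeff x.2 (ω (S.erase i))) := by
  rw [diff, formsDiff_apply, map_sum]
  refine Finset.sum_congr rfl fun i _ => ?_
  rw [map_zsmul, twistedDeriv_apply, map_add, MvPowerSeries.coeff_mul, map_smul, smul_eq_mul]

theorem coeff_wedgeDf (ω : Forms n (MvPolynomial (Fin n) F)) (S : Finset (Fin n))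
    (u : Fin n →₀ ℕ) : (wedgeDf f ω S).coeff u =
      ∑ i ∈ S, formSign i S • ∑ x ∈ Finset.HasAntidiagonal.antidiagonal u,
        (MvPolynomial.pderiv i f).coeff x.1 * (ω (S.erase i)).coeff x.2 := by
  rw [wedgeDf, formsDiff_apply, MvPolynomial.coeff_sum]
  refine Finset.sum_congr rfl fun i _ => ?_
  rw [← MvPolynomial.coeffAddMonoidHom_apply, map_zsmul, MvPolynomial.coeffAddMonoidHom_apply,
    LinearMap.mulLeft_apply, MvPolynomial.coeff_mul]

theorem diff_congr_dvd {c : A} {ω : Forms n (MvPowerSeries (Fin n) A)}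
    (h : ∀ S u, c ∣ MvPowerSeries.coeff u (ω S)) (S : Finset (Fin n)) (u : Fin n →₀ ℕ) :
    c ∣ MvPowerSeries.coeff u (W.diff ω S) := by
  rw [coeff_diff]
  refine Finset.dvd_sum fun i _ => ?_
  rw [zsmul_eq_mul]
  refine Dvd.dvd.mul_left (dvd_add (Dvd.dvd.mul_left ?_ _)
    (Finset.dvd_sum fun x _ => (h _ _).mul_left _)) _
  rw [MvPowerSeries.coeff_pderiv]
  exact (h _ _).mul_right _

/-- The homogenization, with respect to the weight `s`, of the lift of a polynomial form. -/
def lift (s : ℤ) (η : Forms n (MvPolynomial (Fin n) F)) : Forms n (MvPowerSeries (Fin n) A) :=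
  fun S u => W.t ^ (s - formWeight f.totalDegree S u).toNat * W.θ ((η S).coeff u)

theorem coeff_lift (s : ℤ) (η : Forms n (MvPolynomial (Fin n) F)) (S : Finset (Fin n))
    (u : Fin n →₀ ℕ) : MvPowerSeries.coeff u (W.lift s η S) =
      W.t ^ (s - formWeight f.totalDegree S u).toNat * W.θ ((η S).coeff u) := rfl

theorem lift_mem_nullForms (s : ℤ) {k : ℤ} {η : Forms n (MvPolynomial (Fin n) F)}
    (hη : IsHomogForm k η) : W.lift s η ∈ W.nullForms k := by
  refine mem_formsOfDegree.2 ⟨fun S => mem_nullSeries_of_finite (η S).support fun u hu => ?_,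
    fun S hS => ?_⟩
  · rw [coeff_lift, MvPolynomial.notMem_support_iff.1 hu, W.θ_zero, mul_zero]
  · ext u
    rw [coeff_lift, hη S hS, MvPolynomial.coeff_zero, W.θ_zero, mul_zero, map_zero]

/-- The ring homomorphism to `A` modulo the modulus that is induced by `θ`. -/
def residual : F →+* A ⧸ Ideal.span {W.modulus} where
  toFun x := Ideal.Quotient.mk _ (W.θ x)
  map_one' := by rw [W.θ_one, map_one]
  map_mul' x y := by rw [W.θ_mul, map_mul]
  map_zero' := by rw [W.θ_zero, map_zero]
  map_add' x y := by
    rw [← map_add, Ideal.Quotient.eq, Ideal.mem_span_singleton]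
    exact W.θ_add x y

theorem mk_eq_mk_iff {x y : A} :
    Ideal.Quotient.mk (Ideal.span {W.modulus}) x = Ideal.Quotient.mk _ y ↔ W.modulus ∣ x - y := by
  rw [Ideal.Quotient.eq, Ideal.mem_span_singleton]

/-- Modulo the modulus, `D` commutes with homogenization at a fixed weight. As `df ∧ η` has weight
`e - 1` less than the bound on `η`, homogenizing it at `r + e - 1` produces the factor `t ^ (e -
1)`. -/
theorem modulus_dvd_diff_lift (he : 1 ≤ e) (hδ : 1 ≤ f.totalDegree) {r : ℤ}
    {η : Forms n (MvPolynomial (Fin n) F)}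
    (hη : η ∈ weightFiltration n F f.totalDegree (r + e - 1))
    (hd : wedgeDf f η ∈ weightFiltration n F f.totalDegree r) (S : Finset (Fin n))
    (u : Fin n →₀ ℕ) : W.modulus ∣ MvPowerSeries.coeff u (W.diff (W.lift (r + e - 1) η) S) -
      W.t ^ (e - 1) * MvPowerSeries.coeff u (W.lift r (wedgeDf f η) S) := by
  rw [← mk_eq_mk_iff, coeff_diff, coeff_lift]
  have hk : Ideal.Quotient.mk (Ideal.span {W.modulus}) W.kap = 0 := by
    rw [Ideal.Quotient.eq_zero_iff_mem, Ideal.mem_span_singleton]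
    exact W.dvd_kap
  have hh : ∀ i v, Ideal.Quotient.mk (Ideal.span {W.modulus}) (MvPowerSeries.coeff v (W.h i)) =
      Ideal.Quotient.mk _ W.t ^ (f.totalDegree - 1 - v.degree) *
        W.residual ((MvPolynomial.pderiv i f).coeff v) := fun i v => by
    rw [← map_pow]
    exact (W.mk_eq_mk_iff.2 (W.h_approx i v)).trans (map_mul _ _ _)
  have hr : ∀ x, Ideal.Quotient.mk (Ideal.span {W.modulus}) (W.θ x) = W.residual x :=
    fun _ => rfl
  -- The exponents truncated by `toNat` add up correctly only at weights at most `r`; elsewhere the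
  -- coefficient of `df ∧ η` is zero.
  have key : (Ideal.Quotient.mk (Ideal.span {W.modulus})) W.t ^
      (r + e - 1 - formWeight f.totalDegree S u).toNat * W.residual ((wedgeDf f η S).coeff u) =
      (Ideal.Quotient.mk (Ideal.span {W.modulus})) W.t ^ (e - 1) *
      ((Ideal.Quotient.mk (Ideal.span {W.modulus})) W.t ^
      (r - formWeight f.totalDegree S u).toNat * W.residual ((wedgeDf f η S).coeff u)) := by
    by_cases h0 : (wedgeDf f η S).coeff u = 0
    · rw [h0, map_zero, mul_zero, mul_zero, mul_zero]
    · have : formWeight f.totalDegree S u ≤ r := hd S u h0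
      rw [← mul_assoc, ← pow_add]
      congr 2
      omega
  simp only [map_sum, map_zsmul, map_add, map_mul, hk, zero_mul, zero_add, hh, coeff_lift, hr,
    map_pow]
  rw [← key, coeff_wedgeDf]
  simp only [map_sum, map_zsmul, map_mul, Finset.mul_sum, mul_smul_comm]
  refine Finset.sum_congr rfl fun i hi => ?_
  congr 1
  refine Finset.sum_congr rfl fun x hx => ?_
  rw [Finset.HasAntidiagonal.mem_antidiagonal] at hx
  by_cases h1 : (MvPolynomial.pderiv i f).coeff x.1 = 0
  · simp [h1]
  by_cases h2 : (η (S.erase i)).coeff x.2 = 0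
  · simp [h2]
  have h3 := degree_le_of_coeff_pderiv_ne_zero h1
  have h4 := formWeight_erase hδ hi hx h3
  have h5 : formWeight f.totalDegree (S.erase i) x.2 ≤ r + e - 1 := hη _ _ h2
  rw [show (r + e - 1 - formWeight f.totalDegree S u).toNat = (f.totalDegree - 1 - x.1.degree) +
    (r + e - 1 - formWeight f.totalDegree (S.erase i) x.2).toNat by omega, pow_add]
  ring

/-- The exponents of degree at most `m`. -/
def _root_.ExpSum.expsLE (n m : ℕ) : Finset (Fin n →₀ ℕ) :=
  (Finsupp.finite_of_degree_le (σ := Fin n) m).toFinset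

theorem _root_.ExpSum.mem_expsLE {n m : ℕ} {u : Fin n →₀ ℕ} : u ∈ expsLE n m ↔ u.degree ≤ m := by
  simp [expsLE]

open Classical in
/-- The polynomial form of weight at most `r` which the coordinate `φ i` reads off from the
parts of `ω` of weights `r, …, r - e + 1`. -/
def slice (i : Fin W.d) (r : ℤ) (ω : Forms n (MvPowerSeries (Fin n) A)) :
    Forms n (MvPolynomial (Fin n) F) := fun S =>
  ∑ u ∈ expsLE n r.toNat, MvPolynomial.monomial u
    (if r - e < formWeight f.totalDegree S u ∧ formWeight f.totalDegree S u ≤ r then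
      W.φ i (W.t ^ (e - 1 - (r - formWeight f.totalDegree S u).toNat) *
        MvPowerSeries.coeff u (ω S)) else 0)

open Classical in
theorem coeff_slice (hδ : 1 ≤ f.totalDegree) (i : Fin W.d) (r : ℤ)
    (ω : Forms n (MvPowerSeries (Fin n) A)) (S : Finset (Fin n)) (u : Fin n →₀ ℕ) :
    (W.slice i r ω S).coeff u =
    if r - e < formWeight f.totalDegree S u ∧ formWeight f.totalDegree S u ≤ r then
      W.φ i (W.t ^ (e - 1 - (r - formWeight f.totalDegree S u).toNat) *
        MvPowerSeries.coeff u (ω S)) else 0 := by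
  rw [slice, MvPolynomial.coeff_sum]
  simp only [MvPolynomial.coeff_monomial]
  rw [Finset.sum_ite_eq']
  split_ifs with h1 h2
  · rfl
  · rfl
  · rename_i h3
    exfalso
    refine h1 (mem_expsLE.2 ?_)
    have h4 : (S.card : ℤ) ≤ n := by exact_mod_cast S.card_le_univ.trans_eq (Fintype.card_fin n)
    have h5 : (1 : ℤ) ≤ f.totalDegree := by exact_mod_cast hδ
    have h6 : 0 ≤ ((n : ℤ) - S.card) * ((f.totalDegree : ℤ) - 1) :=
      mul_nonneg (by linarith) (by linarith)
    have h7 := h3.2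
    rw [formWeight] at h7
    omega
  · rfl

theorem slice_isHomogForm (hδ : 1 ≤ f.totalDegree) (i : Fin W.d) (r : ℤ) {k : ℤ}
    {ω : Forms n (MvPowerSeries (Fin n) A)} (hω : IsHomogForm k ω) :
    IsHomogForm k (W.slice i r ω) := fun S hS => by
  classical
  ext u
  rw [coeff_slice _ hδ, hω S hS, map_zero, mul_zero, map_zero, ite_self, MvPolynomial.coeff_zero]

theorem slice_mem (hδ : 1 ≤ f.totalDegree) (i : Fin W.d) (r : ℤ)
    (ω : Forms n (MvPowerSeries (Fin n) A)) :
    W.slice i r ω ∈ weightFiltration n F f.totalDegree r := by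
  classical
  refine mem_weightFiltration.2 fun S u hu => ?_
  rw [coeff_slice _ hδ, if_neg (by omega)]

-- Slicing commutes with the differentials at weights above `r - e`. The powers of `t` in the slice
-- absorb those in `h_j`, and `φ i` is linear over `F` and ignores the error terms.
open Classical in
theorem coeff_wedgeDf_slice (he : 1 ≤ e) (hδ : 1 ≤ f.totalDegree) (i : Fin W.d) (r : ℤ)
    (ω : Forms n (MvPowerSeries (Fin n) A)) (S : Finset (Fin n)) (u : Fin n →₀ ℕ)
    (hu : r - e < formWeight f.totalDegree S u) :
    (wedgeDf f (W.slice i r ω) S).coeff u = if formWeight f.totalDegree S u ≤ r then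
      W.φ i (W.t ^ (e - 1 - (r - formWeight f.totalDegree S u).toNat) *
        MvPowerSeries.coeff u (W.diff ω S)) else 0 := by
  have hte : W.modulus ∣ W.t ^ e := by
    obtain ⟨m, rfl⟩ := Nat.exists_eq_add_of_le' he
    rw [modulus, Nat.add_sub_cancel, pow_succ, mul_comm]
    exact mul_dvd_mul_left _ W.lam_dvd_t
  rw [coeff_wedgeDf]
  split_ifs with hur
  · rw [coeff_diff, Finset.mul_sum, map_sum]
    refine Finset.sum_congr rfl fun j hj => ?_
    rw [mul_smul_comm, map_zsmul, mul_add, map_add, W.φ_eq_zero i (_ * (W.kap * _))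
      (Dvd.dvd.mul_left (W.dvd_kap.mul_right _) _), zero_add, Finset.mul_sum, map_sum]
    congr 1
    refine Finset.sum_congr rfl fun x hx => ?_
    rw [Finset.HasAntidiagonal.mem_antidiagonal] at hx
    obtain ⟨c, hc⟩ := W.h_approx j x.1
    rw [sub_eq_iff_eq_add.1 hc]
    set a := e - 1 - (r - formWeight f.totalDegree S u).toNat with ha
    have h1 : W.t ^ a * ((W.lam * W.t ^ (e - 1) * c + W.t ^ (f.totalDegree - 1 - x.1.degree) *
        W.θ ((MvPolynomial.pderiv j f).coeff x.1)) *
          MvPowerSeries.coeff x.2 (ω (S.erase j))) =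
        W.lam * W.t ^ (e - 1) * (c * W.t ^ a * MvPowerSeries.coeff x.2 (ω (S.erase j))) +
        W.θ ((MvPolynomial.pderiv j f).coeff x.1) * (W.t ^ (a +
          (f.totalDegree - 1 - x.1.degree)) * MvPowerSeries.coeff x.2 (ω (S.erase j))) := by
      rw [pow_add]; ring
    rw [h1, map_add, W.φ_eq_zero i _ (Dvd.intro _ rfl), zero_add, W.φ_θ_mul]
    by_cases h2 : (MvPolynomial.pderiv j f).coeff x.1 = 0
    · rw [h2, zero_mul, zero_mul]
    have h3 := degree_le_of_coeff_pderiv_ne_zero h2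
    have h4 := formWeight_erase hδ hj hx h3
    rw [coeff_slice _ hδ]
    congr 1
    split_ifs with h5
    · congr 3
      omega
    -- A source term of weight above `r` is absent from the slice. Correspondingly its power of `t`
    -- is at least `e`, hence divisible by the modulus.
    · refine (W.φ_eq_zero i _ (Dvd.dvd.mul_right (hte.trans (pow_dvd_pow _ ?_)) _)).symm
      omega
  · refine Finset.sum_eq_zero fun j hj => ?_
    rw [Finset.sum_eq_zero, smul_zero]
    intro x hx
    rw [Finset.HasAntidiagonal.mem_antidiagonal] at hx
    by_cases h2 : (MvPolynomial.pderiv j f).coeff x.1 = 0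
    · rw [h2, zero_mul]
    have h3 := degree_le_of_coeff_pderiv_ne_zero h2
    have h4 := formWeight_erase hδ hj hx h3
    rw [coeff_slice _ hδ, if_neg (by omega), mul_zero]

end DworkModel

/-! ### Successive approximation in the integral model -/

namespace DworkModel

variable {n : ℕ} {F : Type*} [Field F] {f : MvPolynomial (Fin n) F} {e : ℕ}
  {A : Type*} [CommRing A] (W : DworkModel f e A)

/-- Otherwise totality makes every power of `lam` divide `y`, against separatedness. -/
theorem exists_dvd_pow {y : A} (hy : y ≠ 0) : ∃ J : ℕ, y ∣ W.lam ^ J := by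
  by_contra! h
  exact hy (W.separated y fun k => (Dvd.intro_left _ rfl).trans
    ((W.dvd_total y (W.lam ^ k)).resolve_left (h k)))

theorem _root_.ExpSum.exists_form_coeff_eq (g : Finset (Fin n) → (Fin n →₀ ℕ) → A) :
    ∃ ξ : Forms n (MvPowerSeries (Fin n) A), ∀ S u, MvPowerSeries.coeff u (ξ S) = g S u :=
  ⟨g, fun _ _ => rfl⟩

theorem exists_form_sum {k : ℤ} (ζ : ℕ → Forms n (MvPowerSeries (Fin n) A))
    (hζ : ∀ j, ζ j ∈ W.nullForms k) : ∃ ξ ∈ W.nullForms k, ∀ J S u,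
      W.lam ^ J ∣ MvPowerSeries.coeff u ((ξ - ∑ j ∈ Finset.range J, W.lam ^ j • ζ j) S) := by
  have h1 : ∀ (S : Finset (Fin n)) (u : Fin n →₀ ℕ), ∃ s, (∀ k, W.lam ^ k ∣
      s - ∑ j ∈ Finset.range k, W.lam ^ j * MvPowerSeries.coeff u (ζ j S)) ∧
      ((S.card : ℤ) ≠ k → s = 0) := by
    intro S u
    by_cases hS : (S.card : ℤ) = k
    · obtain ⟨s, hs⟩ := W.exists_sum fun j => MvPowerSeries.coeff u (ζ j S)
      exact ⟨s, hs, fun h => absurd hS h⟩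
    · refine ⟨0, fun k => ?_, fun _ => rfl⟩
      simp [(mem_formsOfDegree.1 (hζ _)).2 S hS]
  choose g hg hg0 using h1
  obtain ⟨ξ, hξ⟩ := exists_form_coeff_eq g
  have hcoeff : ∀ J S u, W.lam ^ J ∣ MvPowerSeries.coeff u
      ((ξ -
      ∑ j ∈ Finset.range J, W.lam ^ j • ζ j) S) := by
    intro J S u
    convert hg S u J using 1
    simp only [← hξ, Pi.sub_apply, Finset.sum_apply, Pi.smul_apply, map_sub, map_sum, map_smul,
      smul_eq_mul]
  refine ⟨ξ, mem_formsOfDegree.2 ⟨fun S J => ?_, fun S hS => ?_⟩, hcoeff⟩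
  -- To see that the limit is null modulo `lam ^ J`, compare it with its `J`-th partial sum.
  · have hsum : (∑ j ∈ Finset.range J, W.lam ^ j • ζ j) ∈ W.nullForms k :=
      Submodule.sum_mem _ fun j _ => Submodule.smul_mem _ _ (hζ j)
    refine ((mem_formsOfDegree.1 hsum).1 S J).subset fun u hu h => hu ?_
    have := dvd_add (hcoeff J S u) h
    rwa [Pi.sub_apply, map_sub, sub_add_cancel] at this
  · ext u
    rw [hξ, hg0 S u hS, map_zero]

variable [IsDomain A]

theorem modulus_ne_zero : W.modulus ≠ 0 := mul_ne_zero W.lam_ne_zero (pow_ne_zero _ W.t_ne_zero)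

/-- Coefficients still tend to zero after division by `c`, since `c` divides some `lam ^ J` and
division costs at most `J` powers. -/
theorem exists_eq_smul_of_dvd {c : A} (hc : c ≠ 0) {k : ℤ}
    {ω : Forms n (MvPowerSeries (Fin n) A)} (hω : ω ∈ W.nullForms k)
    (h : ∀ S u, c ∣ MvPowerSeries.coeff u (ω S)) : ∃ ω' ∈ W.nullForms k, ω = c • ω' := by
  choose g hg using h
  obtain ⟨ω', hω'⟩ := exists_form_coeff_eq g
  simp only [← hω'] at hg
  have heq : ω = c • ω' := by
    funext S
    ext u
    rw [hg, Pi.smul_apply, map_smul, smul_eq_mul]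
  refine ⟨ω', ?_, heq⟩
  rw [mem_formsOfDegree] at hω ⊢
  obtain ⟨J, hJ⟩ := W.exists_dvd_pow hc
  refine ⟨fun S k => (hω.1 S (k + J)).subset fun u hu h => hu ?_, fun S hS => ?_⟩
  · rw [hg, pow_add] at h
    have h' : c * W.lam ^ k ∣ c * MvPowerSeries.coeff u (ω' S) := by
      rw [mul_comm c (W.lam ^ k)]
      exact (mul_dvd_mul_left _ hJ).trans h
    exact (mul_dvd_mul_iff_left hc).1 h'
  · ext u
    have := hg S u
    rw [hω.2 S hS, map_zero, eq_comm, mul_eq_zero] at this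
    exact this.resolve_left hc

/-- If `D ω` vanishes to the known precision and the page `E_e` vanishes in the degree of `ω`,
then up to `lam` the form `t ^ (e - 1) * ω` is in the image of `D`. -/
theorem exists_approx_primitive (he : 1 ≤ e) (hδ : 1 ≤ f.totalDegree) {m : ℤ}
    (hE : ∀ r s : ℤ, r + s = m → Subsingleton (WeightE f e r s))
    {ω : Forms n (MvPowerSeries (Fin n) A)} (hω : ω ∈ W.nullForms m)
    (hd : ∀ S u, W.modulus ∣ MvPowerSeries.coeff u (W.diff ω S)) :
    ∃ ζ ∈ W.nullForms (m - 1), ∃ ω' ∈ W.nullForms m,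
      W.t ^ (e - 1) • ω = W.diff ζ + W.modulus • ω' := by
  classical
  have hom := (mem_formsOfDegree.1 hω).2
  -- Since `D ω` vanishes modulo the modulus, `df ∧` carries each slice into `F_{r-e}`, so the slice
  -- lies in `Z_e` and the vanishing page applies.
  have key : ∀ (i : Fin W.d) (r : ℕ), ∃ η, IsHomogForm (m - 1) η ∧
      η ∈ weightFiltration n F f.totalDegree (r + e - 1) ∧
      wedgeDf f η ∈ weightFiltration n F f.totalDegree r ∧
      W.slice i r ω - wedgeDf f η ∈ weightFiltration n F f.totalDegree (r - 1) := fun i r => by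
    refine exists_primitive_of_subsingleton (hE r (m - r) (by ring)) (by ring)
      (W.slice_isHomogForm hδ i r hom) (W.slice_mem hδ i r ω)
      (mem_weightFiltration.2 fun S u hu => ?_)
    rw [W.coeff_wedgeDf_slice he hδ i r ω S u hu]
    split_ifs
    · exact W.φ_eq_zero i _ ((hd S u).mul_left _)
    · rfl
  choose η h1 h2 h3 h4 using key
  -- Modulo `lam` the form `ω` is polynomial, so finitely many weights matter.
  obtain ⟨R, hR⟩ : ∃ R : ℕ, ∀ S u, (R : ℤ) < formWeight f.totalDegree S u →
      W.lam ∣ MvPowerSeries.coeff u (ω S) := by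
    have hfin := fun S => (mem_formsOfDegree.1 hω).1 S 1
    refine ⟨Finset.univ.sup fun S => (hfin S).toFinset.sup fun u =>
      (formWeight f.totalDegree S u).toNat, fun S u hu => ?_⟩
    by_contra hlam
    have hmem : u ∈ (hfin S).toFinset := by
      rw [Set.Finite.mem_toFinset, Set.mem_ofPred_eq, pow_one]
      exact hlam
    have h5 := (Finset.le_sup (f := fun u => (formWeight f.totalDegree S u).toNat) hmem).trans
      (Finset.le_sup (f := fun S => (hfin S).toFinset.sup fun u =>
        (formWeight f.totalDegree S u).toNat) (Finset.mem_univ S))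
    omega
  set ζ : Forms n (MvPowerSeries (Fin n) A) :=
    ∑ r ∈ Finset.range (R + 1), ∑ i, W.β i • W.lift (r + e - 1) (η i r) with hζdef
  have hζ : ζ ∈ W.nullForms (m - 1) := Submodule.sum_mem _ fun r _ => Submodule.sum_mem _
    fun i _ => Submodule.smul_mem _ _ (W.lift_mem_nullForms _ (h1 i r))
  have happrox : ∀ S u, W.modulus ∣ MvPowerSeries.coeff u ((W.t ^ (e - 1) • ω - W.diff ζ) S) := by
    intro S u
    have e1 : MvPowerSeries.coeff u ((W.t ^ (e - 1) • ω - W.diff ζ) S) =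
        W.t ^ (e - 1) * (MvPowerSeries.coeff u (ω S) - ∑ r ∈ Finset.range (R + 1), ∑ i,
          W.β i * MvPowerSeries.coeff u (W.lift r (wedgeDf f (η i r)) S)) -
        ∑ r ∈ Finset.range (R + 1), ∑ i, W.β i *
          (MvPowerSeries.coeff u (W.diff (W.lift (r + e - 1) (η i r)) S) -
            W.t ^ (e - 1) * MvPowerSeries.coeff u (W.lift r (wedgeDf f (η i r)) S)) := by
      simp only [hζdef, map_sum, map_smul, Pi.sub_apply, Pi.smul_apply, Finset.sum_apply, map_sub,
        smul_eq_mul, mul_sub, Finset.sum_sub_distrib, Finset.mul_sum]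
      simp only [mul_left_comm (W.t ^ (e - 1))]
      ring
    rw [e1]
    refine dvd_sub ?_ (Finset.dvd_sum fun r _ => Finset.dvd_sum fun i _ =>
      (W.modulus_dvd_diff_lift he hδ (h2 i r) (h3 i r) S u).mul_left _)
    rw [modulus, mul_comm W.lam]
    refine mul_dvd_mul_left _ ?_
    -- Modulo `lam` the homogenization at `r` retains only weight `r`: higher weights are absent and
    -- lower ones carry a positive power of `t`.
    have e2 : ∀ r ∈ Finset.range (R + 1), (r : ℤ) ≠ formWeight f.totalDegree S u →
        W.lam ∣ ∑ i, W.β i * MvPowerSeries.coeff u (W.lift r (wedgeDf f (η i r)) S) := by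
      intro r _ hr
      refine Finset.dvd_sum fun i _ => Dvd.dvd.mul_left ?_ _
      rw [coeff_lift]
      rcases lt_or_gt_of_ne hr with h | h
      · rw [mem_weightFiltration.1 (h3 i r) S u h, W.θ_zero, mul_zero]
        exact dvd_zero _
      · exact ((W.lam_dvd_t.trans (dvd_pow_self _ (by omega)))).mul_right _
    by_cases hw : formWeight f.totalDegree S u ≤ R
    · obtain ⟨w, hw'⟩ := Int.eq_ofNat_of_zero_le (formWeight_nonneg hδ S u)
      have hwR : w ∈ Finset.range (R + 1) := Finset.mem_range.2 (by omega)
      rw [← Finset.add_sum_erase _ _ hwR, ← sub_sub]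
      refine dvd_sub ?_ (Finset.dvd_sum fun r hr => e2 r (Finset.mem_of_mem_erase hr) ?_)
      -- At its top weight the slice has coefficient `φ i (t ^ (e - 1) * a)`, the `i`-th coordinate
      -- of `a` modulo `lam`, and `df ∧ η` has the same coefficient there.
      · convert W.φ_generates (MvPowerSeries.coeff u (ω S)) using 5 with i
        have h5 := mem_weightFiltration.1 (h4 i w) S u (by omega)
        rw [Pi.sub_apply, MvPolynomial.coeff_sub, sub_eq_zero, W.coeff_slice hδ,
          if_pos (by omega), hw'] at h5
        rw [coeff_lift, hw', ← h5]
        simp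
      · rw [hw']
        exact_mod_cast Finset.ne_of_mem_erase hr
    · exact dvd_sub (hR S u (by omega)) (Finset.dvd_sum fun r hr => e2 r hr (by
        have := Finset.mem_range.1 hr
        omega))
  have hdζ : W.diff ζ ∈ W.nullForms m := by
    have := W.diff_mem_nullForms hζ
    rwa [sub_add_cancel] at this
  obtain ⟨ω', hω', h5⟩ := W.exists_eq_smul_of_dvd W.modulus_ne_zero
    (Submodule.sub_mem _ (Submodule.smul_mem _ _ hω) hdζ) happrox
  exact ⟨ζ, hζ, ω', hω', by rw [← h5, add_sub_cancel]⟩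

/-- Successive approximation. -/
theorem exists_eq_of_step {k : ℤ} (K : Forms n (MvPowerSeries (Fin n) A) → Prop)
    {ι : Type*} (U : Finset ι) (b : ι → Forms n (MvPowerSeries (Fin n) A))
    (hstep : ∀ ω, K ω → ∃ ζ ∈ W.nullForms k, ∃ c : ι → A, ∃ ω', K ω' ∧
      W.t ^ (e - 1) • ω = W.diff ζ + W.t ^ (e - 1) • ∑ u ∈ U, c u • b u + W.modulus • ω')
    (ω : Forms n (MvPowerSeries (Fin n) A)) (hω : K ω) :
    ∃ ζ ∈ W.nullForms k, ∃ c : ι → A,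
      W.t ^ (e - 1) • ω = W.diff ζ + W.t ^ (e - 1) • ∑ u ∈ U, c u • b u := by
  choose! Z hZ c rest hrest heq using hstep
  let seq : ℕ → Forms n (MvPowerSeries (Fin n) A) := fun j => rest^[j] ω
  have hseq : ∀ j, K (seq j) := by
    intro j
    induction j with
    | zero => exact hω
    | succ j ih =>
      simp only [seq, Function.iterate_succ_apply'] at ih ⊢
      exact hrest _ ih
  -- Because the modulus is `lam * t ^ (e - 1)`, the remainder keeps its factor `t ^ (e - 1)` and
  -- can be fed back into the step, gaining one `lam` each time.
  have hpart : ∀ J, W.t ^ (e - 1) • ω =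
      W.diff (∑ j ∈ Finset.range J, W.lam ^ j • Z (seq j)) +
      W.t ^ (e - 1) • ∑ u ∈ U, (∑ j ∈ Finset.range J, W.lam ^ j * c (seq j) u) • b u +
      (W.lam ^ J * W.t ^ (e - 1)) • seq J := by
    intro J
    induction J with
    | zero => simp [seq]
    | succ J ih =>
      have h1 : seq (J + 1) = rest (seq J) := Function.iterate_succ_apply' _ _ _
      have h2 : (W.lam ^ J * W.t ^ (e - 1)) • seq J = W.lam ^ J • (W.diff (Z (seq J)) +
          W.t ^ (e - 1) • ∑ u ∈ U, c (seq J) u • b u + W.modulus • seq (J + 1)) := by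
        rw [mul_smul, heq _ (hseq J), h1]
      rw [ih, h2]
      simp only [Finset.sum_range_succ, add_smul, Finset.sum_add_distrib, map_add, map_smul,
        smul_add, mul_smul, ← Finset.smul_sum, modulus, pow_succ]
      rw [smul_comm (W.lam ^ J) (W.t ^ (e - 1))]
      abel
  obtain ⟨ξ, hξ, hξ'⟩ := W.exists_form_sum (fun j => Z (seq j)) fun j => hZ _ (hseq j)
  choose c' hc' using fun u => W.exists_sum fun j => c (seq j) u
  refine ⟨ξ, hξ, c', ?_⟩
  rw [← sub_eq_zero]
  funext S
  ext v
  refine W.separated _ fun J => ?_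
  have h3 : W.t ^ (e - 1) • ω - (W.diff ξ + W.t ^ (e - 1) • ∑ u ∈ U, c' u • b u) =
      (W.lam ^ J * W.t ^ (e - 1)) • seq J -
      W.diff (ξ - ∑ j ∈ Finset.range J, W.lam ^ j • Z (seq j)) -
      W.t ^ (e - 1) • ∑ u ∈ U,
        (c' u - ∑ j ∈ Finset.range J, W.lam ^ j * c (seq j) u) • b u := by
    rw [hpart J]
    simp only [map_sub, sub_smul, Finset.sum_sub_distrib, smul_sub]
    abel
  rw [h3]
  simp only [Pi.sub_apply _ _ S, Pi.smul_apply, map_sub (MvPowerSeries.coeff v), map_smul,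
    Finset.sum_apply, map_sum (MvPowerSeries.coeff v), smul_eq_mul]
  refine dvd_sub (dvd_sub (Dvd.intro _ (mul_assoc _ _ _).symm) ?_) (Dvd.dvd.mul_left
    (Finset.dvd_sum fun u _ => (hc' u J).mul_right _) _)
  exact W.diff_congr_dvd (hξ' J) S v

/-- If the page `E_e` vanishes in degree `m`, then closed `m`-forms are exact up to
`t ^ (e - 1)`. -/
theorem exists_primitive (he : 1 ≤ e) (hδ : 1 ≤ f.totalDegree) {m : ℤ}
    (hE : ∀ r s : ℤ, r + s = m → Subsingleton (WeightE f e r s))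
    {ω : Forms n (MvPowerSeries (Fin n) A)} (hω : ω ∈ W.nullForms m) (hd : W.diff ω = 0) :
    ∃ ζ ∈ W.nullForms (m - 1), W.t ^ (e - 1) • ω = W.diff ζ := by
  obtain ⟨ζ, hζ, c, h⟩ := W.exists_eq_of_step (k := m - 1)
    (fun ω => ω ∈ W.nullForms m ∧ W.diff ω = 0) (∅ : Finset Unit) 0 (fun ω hω => by
      obtain ⟨ζ, hζ, ω', hω', h⟩ := W.exists_approx_primitive he hδ hE hω.1 fun S u => by
        rw [hω.2, Pi.zero_apply, map_zero]; exact dvd_zero _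
      refine ⟨ζ, hζ, 0, ω', ⟨hω', ?_⟩, by simpa using h⟩
      -- Applying `D` to the step shows that the modulus times `D ω'` is zero, so `ω'` is closed and
      -- the iteration can continue.
      have h2 := congrArg W.diff h
      rw [map_smul, hω.2, smul_zero, map_add, W.diff_diff, zero_add, map_smul] at h2
      funext S
      ext u
      have h3 := congrArg (fun ξ => MvPowerSeries.coeff u (ξ S)) h2
      simp only [Pi.zero_apply, map_zero, Pi.smul_apply, map_smul, smul_eq_mul] at h3
      rw [Pi.zero_apply, map_zero]
      exact (mul_eq_zero.1 h3.symm).resolve_left W.modulus_ne_zero) ω ⟨hω, hd⟩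
  exact ⟨ζ, hζ, by simpa using h⟩

end DworkModel

/-! ### Adapted bases and the top cohomology of the model -/

/-- A finite set `U` of exponents whose monomials give a basis of `k[x] / (∂f/∂x₁, …)` which is
adapted to the weight filtration. -/
structure IsAdaptedBasis {n : ℕ} {k : Type*} [Field k] (f : MvPolynomial (Fin n) k)
    (U : Finset (Fin n →₀ ℕ)) : Prop where
  exists_reduction : ∀ v : Fin n →₀ ℕ, ∃ η : Forms n (MvPolynomial (Fin n) k),
    IsHomogForm ((n : ℤ) - 1) η ∧
    wedgeDf f η ∈ weightFiltration n k f.totalDegree (v.degree : ℤ) ∧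
    ∀ u, u ∉ U → (wedgeDf f η Finset.univ).coeff u = if u = v then 1 else 0
  coeff_eq_zero : ∀ (η : Forms n (MvPolynomial (Fin n) k)) (r : ℕ),
    (∀ u, r < u.degree → (wedgeDf f η Finset.univ).coeff u = 0) →
    (∀ u, u.degree = r → u ∉ U → (wedgeDf f η Finset.univ).coeff u = 0) →
    ∀ u, u.degree = r → (wedgeDf f η Finset.univ).coeff u = 0

theorem formWeight_univ {n δ : ℕ} (u : Fin n →₀ ℕ) :
    formWeight δ (Finset.univ : Finset (Fin n)) u = u.degree := by
  simp [formWeight]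

/-- The top form `x^u dx₁ ∧ ⋯ ∧ dx_n`. -/
def topForm {n : ℕ} {A : Type*} [CommRing A] (u : Fin n →₀ ℕ) :
    Forms n (MvPowerSeries (Fin n) A) :=
  Pi.single Finset.univ (MvPowerSeries.monomial u 1)

theorem isHomogForm_of_card_eq {n : ℕ} {C : Type*} [AddCommGroup C] {ω : Forms n C}
    (h : ∀ S, S ≠ Finset.univ → ω S = 0) : IsHomogForm (n : ℤ) ω := fun S hS =>
  h S (by rintro rfl; simp at hS)

theorem IsHomogForm.eq_zero_of_ne_univ {n : ℕ} {C : Type*} [AddCommGroup C] {ω : Forms n C}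
    (h : IsHomogForm (n : ℤ) ω) {S : Finset (Fin n)} (hS : S ≠ Finset.univ) : ω S = 0 :=
  h S fun h' => hS ((Finset.card_eq_iff_eq_univ S).1 (by simpa using h'))

theorem smul_form_injective {n : ℕ} {A : Type*} [CommRing A] [IsDomain A] {c : A} (hc : c ≠ 0) :
    Function.Injective fun ω : Forms n (MvPowerSeries (Fin n) A) => c • ω := by
  intro ω η h
  funext S
  ext u
  have h1 := congrArg (fun ξ => MvPowerSeries.coeff u (ξ S)) h
  exact mul_left_cancel₀ hc h1

namespace DworkModel

variable {n : ℕ} {F : Type*} [Field F] {f : MvPolynomial (Fin n) F} {e : ℕ}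
  {A : Type*} [CommRing A] (W : DworkModel f e A)

theorem coeff_topForm_univ (u v : Fin n →₀ ℕ) :
    MvPowerSeries.coeff v (topForm (A := A) u Finset.univ) = if v = u then 1 else 0 := by
  classical
  rw [topForm, Pi.single_eq_same, MvPowerSeries.coeff_monomial]

theorem topForm_mem_nullForms (u : Fin n →₀ ℕ) : topForm u ∈ W.nullForms (n : ℤ) := by
  refine mem_formsOfDegree.2 ⟨fun S => ?_, isHomogForm_of_card_eq fun S hS => ?_⟩
  · by_cases hS : S = Finset.univ
    · subst hS
      refine mem_nullSeries_of_finite {u} fun v hv => ?_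
      rw [coeff_topForm_univ, if_neg (by simpa using hv)]
    · rw [topForm, Pi.single_eq_of_ne hS]
      exact Submodule.zero_mem _
  · rw [topForm, Pi.single_eq_of_ne hS]

theorem coeff_sum_topForm (U : Finset (Fin n →₀ ℕ)) (c : (Fin n →₀ ℕ) → A) (v : Fin n →₀ ℕ)
    [Decidable (v ∈ U)] :
    MvPowerSeries.coeff v ((∑ u ∈ U, c u • topForm (A := A) u) Finset.univ) =
      if v ∈ U then c v else 0 := by
  rw [Finset.sum_apply, map_sum]
  simp only [Pi.smul_apply, map_smul, coeff_topForm_univ, smul_eq_mul, mul_ite, mul_one, mul_zero]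
  rw [Finset.sum_ite_eq]
  congr

variable {U : Finset (Fin n →₀ ℕ)}

/-- Slice `η` at weight `|u| + e - 1`. At degrees above `|u|` the extra powers of `t` kill the
coefficients of `df ∧` of the slice, and in degree `|u|` it is supported on `U`. An adapted basis
admits no nonzero such part, so all coordinates of `c u` modulo `lam` vanish. -/
theorem lam_dvd_of_exact (he : 1 ≤ e) (hδ : 1 ≤ f.totalDegree) (hU : IsAdaptedBasis f U)
    {c : (Fin n →₀ ℕ) → A} {η : Forms n (MvPowerSeries (Fin n) A)}
    (h : W.diff η = W.t ^ (e - 1) • ∑ u ∈ U, c u • topForm u) {u : Fin n →₀ ℕ}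
    (hu : u ∈ U) : W.lam ∣ c u := by
  classical
  have hcoeff : ∀ v, MvPowerSeries.coeff v (W.diff η Finset.univ) =
      W.t ^ (e - 1) * if v ∈ U then c v else 0 := fun v => by
    rw [h, Pi.smul_apply, map_smul, smul_eq_mul, coeff_sum_topForm]
  have key : ∀ i, W.φ i (W.t ^ (e - 1) * c u) = 0 := by
    intro i
    have h1 : ∀ v : Fin n →₀ ℕ, u.degree ≤ v.degree →
        (wedgeDf f (W.slice i (u.degree + e - 1) η) Finset.univ).coeff v =
        if v.degree = u.degree ∧ v ∈ U then W.φ i (W.t ^ (e - 1) * c v) else 0 := by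
      intro v hv
      rw [W.coeff_wedgeDf_slice he hδ i _ _ _ _ (by rw [formWeight_univ]; omega), hcoeff]
      simp only [formWeight_univ]
      split_ifs with h2 h3 h4 h5 h6
      · rw [show e - 1 - ((u.degree : ℤ) + e - 1 - v.degree).toNat = 0 by omega, pow_zero,
          one_mul]
      · refine W.φ_eq_zero i _ ?_
        rw [mul_left_comm, mul_comm W.lam]
        refine mul_dvd_mul_left _ (Dvd.dvd.mul_right (W.lam_dvd_t.trans (dvd_pow_self _ ?_)) _)
        have : v.degree ≠ u.degree := fun h' => h4 ⟨h', h3⟩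
        omega
      · exact absurd h5.2 h3
      · rw [mul_zero, mul_zero, map_zero]
      · omega
      · rfl
    have h2 := hU.coeff_eq_zero (W.slice i (u.degree + e - 1) η) u.degree
      (fun v hv => by rw [h1 v hv.le, if_neg (fun h => hv.ne' h.1)])
      (fun v hv hvU => by rw [h1 v hv.ge, if_neg (fun h => hvU h.2)]) u rfl
    rwa [h1 u le_rfl, if_pos ⟨rfl, hu⟩] at h2
  have := W.φ_generates (c u)
  simpa [key, W.θ_zero] using this

variable [IsDomain A]

/-- Each monomial of `ω` modulo `lam` is reduced to `U` by a polynomial primitive, which is then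
homogenized. Vanishing in degree `n - 1` serves only to bound the weight of this primitive. -/
theorem exists_approx_reduction (he : 1 ≤ e) (hδ : 1 ≤ f.totalDegree)
    (hE : ∀ r s : ℤ, r + s = (n : ℤ) - 1 → Subsingleton (WeightE f e r s))
    (hU : IsAdaptedBasis f U) {ω : Forms n (MvPowerSeries (Fin n) A)}
    (hω : ω ∈ W.nullForms n) :
    ∃ ζ ∈ W.nullForms ((n : ℤ) - 1), ∃ c : (Fin n →₀ ℕ) → A, ∃ ω' ∈ W.nullForms n,
      W.t ^ (e - 1) • ω = W.diff ζ + W.t ^ (e - 1) • ∑ u ∈ U, c u • topForm u +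
        W.modulus • ω' := by
  classical
  have h0 : ∀ v : Fin n →₀ ℕ, ∃ η : Forms n (MvPolynomial (Fin n) F),
      IsHomogForm ((n : ℤ) - 1) η ∧
      η ∈ weightFiltration n F f.totalDegree ((v.degree : ℤ) + e - 1) ∧
      wedgeDf f η ∈ weightFiltration n F f.totalDegree (v.degree : ℤ) ∧
      ∀ u, u ∉ U → (wedgeDf f η Finset.univ).coeff u = if u = v then 1 else 0 := by
    intro v
    obtain ⟨η, h1, h2, h3⟩ := hU.exists_reduction v
    obtain ⟨l, hl⟩ := exists_mem_weightFiltration f.totalDegree η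
    obtain ⟨η', h1', h2', h3'⟩ := exists_same_wedgeDf_of_mem hE v.degree l η h1
      (weightFiltration_mono (by linarith) hl) h2
    exact ⟨η', h1', h2', h3' ▸ h2, h3' ▸ h3⟩
  choose η h1 h2 h3 h4 using h0
  set V := ((mem_formsOfDegree.1 hω).1 Finset.univ 1).toFinset with hV
  have hVmem : ∀ u, u ∉ V → W.lam ∣ MvPowerSeries.coeff u (ω Finset.univ) := by
    intro u hu
    rw [hV, Set.Finite.mem_toFinset, Set.mem_ofPred_eq, pow_one, not_not] at hu
    exact hu
  set a : (Fin n →₀ ℕ) → A := fun v => MvPowerSeries.coeff v (ω Finset.univ) with ha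
  set ζ : Forms n (MvPowerSeries (Fin n) A) :=
    ∑ v ∈ V, a v • W.lift (v.degree + e - 1) (η v) with hζdef
  have hζ : ζ ∈ W.nullForms ((n : ℤ) - 1) := Submodule.sum_mem _ fun v _ =>
    Submodule.smul_mem _ _ (W.lift_mem_nullForms _ (h1 v))
  have hdζ : W.diff ζ ∈ W.nullForms n := by
    have := W.diff_mem_nullForms hζ
    rwa [sub_add_cancel] at this
  set g : (Fin n →₀ ℕ) → A := fun u => ∑ v ∈ V, a v *
    MvPowerSeries.coeff u (W.lift v.degree (wedgeDf f (η v)) Finset.univ) with hg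
  -- With this choice the error is zero on `U`. Off `U` the reduction of `x^v` has only the
  -- coefficient of `x^v` itself, so only the coefficients of `ω` divisible by `lam` remain.
  set c : (Fin n →₀ ℕ) → A := fun u => a u - g u with hc
  set ξ : Forms n (MvPowerSeries (Fin n) A) :=
    W.t ^ (e - 1) • (ω - ∑ u ∈ U, c u • topForm u) - W.diff ζ with hξdef
  have hξ : ξ ∈ W.nullForms n := Submodule.sub_mem _ (Submodule.smul_mem _ _
    (Submodule.sub_mem _ hω (Submodule.sum_mem _ fun u _ =>
      Submodule.smul_mem _ _ (W.topForm_mem_nullForms u)))) hdζ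
  have happrox : ∀ S u, W.modulus ∣ MvPowerSeries.coeff u (ξ S) := by
    intro S u
    by_cases hS : S = Finset.univ
    swap
    · rw [(mem_formsOfDegree.1 hξ).2.eq_zero_of_ne_univ hS, map_zero]
      exact dvd_zero _
    subst hS
    have e1 : MvPowerSeries.coeff u (ξ Finset.univ) =
        W.t ^ (e - 1) * (a u - (if u ∈ U then c u else 0) - g u) -
        ∑ v ∈ V, a v *
          (MvPowerSeries.coeff u (W.diff (W.lift (v.degree + e - 1) (η v)) Finset.univ) -
          W.t ^ (e - 1) * MvPowerSeries.coeff u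
            (W.lift v.degree (wedgeDf f (η v)) Finset.univ)) := by
      rw [hξdef, Pi.sub_apply, map_sub, Pi.smul_apply, map_smul, Pi.sub_apply, map_sub,
        coeff_sum_topForm, hζdef, map_sum, Finset.sum_apply, map_sum]
      simp only [mul_sub, Finset.sum_sub_distrib, hg, map_smul, Pi.smul_apply, smul_eq_mul,
        Finset.mul_sum, mul_left_comm (W.t ^ (e - 1)), ha]
      ring
    rw [e1]
    refine dvd_sub ?_ (Finset.dvd_sum fun v _ =>
      (W.modulus_dvd_diff_lift he hδ (h2 v) (h3 v) _ u).mul_left _)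
    rw [modulus, mul_comm W.lam]
    refine mul_dvd_mul_left _ ?_
    split_ifs with hu
    · simp [hc]
    · have e2 : g u = if u ∈ V then a u else 0 := by
        rw [hg, ← Finset.sum_ite_eq V u a]
        refine Finset.sum_congr rfl fun v _ => ?_
        rw [coeff_lift, h4 v u hu]
        split_ifs with huv
        · rw [huv, formWeight_univ, W.θ_one]
          simp
        · rw [W.θ_zero, mul_zero, mul_zero]
      rw [e2, sub_zero]
      split_ifs with huV
      · rw [sub_self]; exact dvd_zero _
      · rw [sub_zero]; exact hVmem u huV
  obtain ⟨ω', hω', h5⟩ := W.exists_eq_smul_of_dvd W.modulus_ne_zero hξ happrox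
  refine ⟨ζ, hζ, c, ω', hω', ?_⟩
  rw [← h5, hξdef, smul_sub]
  abel

/-- The top forms attached to an adapted basis generate the cohomology up to `t ^ (e - 1)`. -/
theorem exists_reduction (he : 1 ≤ e) (hδ : 1 ≤ f.totalDegree)
    (hE : ∀ r s : ℤ, r + s = (n : ℤ) - 1 → Subsingleton (WeightE f e r s))
    (hU : IsAdaptedBasis f U) {ω : Forms n (MvPowerSeries (Fin n) A)}
    (hω : ω ∈ W.nullForms n) :
    ∃ ζ ∈ W.nullForms ((n : ℤ) - 1), ∃ c : (Fin n →₀ ℕ) → A,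
      W.t ^ (e - 1) • ω = W.diff ζ + W.t ^ (e - 1) • ∑ u ∈ U, c u • topForm u :=
  W.exists_eq_of_step (· ∈ W.nullForms n) U topForm
    (fun _ hω => W.exists_approx_reduction he hδ hE hU hω) ω hω

/-- If `lam ^ (J + 1)` divides `t ^ (e - 1)`, a multiple of `η` reduces to `lam_dvd_of_exact`.
Otherwise the modulus divides `D η`, and approximating `η` in degree `n - 1` replaces it by `η'`
with exponent `J`. -/
theorem lam_dvd_of_pow_smul_exact (he : 1 ≤ e) (hδ : 1 ≤ f.totalDegree)
    (hE : ∀ r s : ℤ, r + s = (n : ℤ) - 1 → Subsingleton (WeightE f e r s))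
    (hU : IsAdaptedBasis f U) {c : (Fin n →₀ ℕ) → A} (J : ℕ) :
    ∀ η ∈ W.nullForms ((n : ℤ) - 1),
    W.diff η = W.lam ^ J • ∑ u ∈ U, c u • topForm u → ∀ u ∈ U, W.lam ∣ c u := by
  induction J with
  | zero =>
    intro η _ h u hu
    refine W.lam_dvd_of_exact he hδ hU (η := W.t ^ (e - 1) • η) ?_ hu
    rw [map_smul, h, pow_zero, one_smul]
  | succ J ih =>
    intro η hη h u hu
    rcases W.dvd_total (W.lam ^ (J + 1)) (W.t ^ (e - 1)) with ⟨y, hy⟩ | ⟨y, hy⟩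
    · refine W.lam_dvd_of_exact he hδ hU (η := y • η) ?_ hu
      rw [map_smul, h, smul_smul, mul_comm, ← hy]
    · obtain ⟨ζ, _, η', hη', h2⟩ := W.exists_approx_primitive he hδ hE hη fun S v => by
        rw [h, hy, mul_smul, Pi.smul_apply, map_smul]
        exact Dvd.intro _ rfl
      refine ih η' hη' ?_ u hu
      have h3 := congrArg W.diff h2
      rw [map_smul, map_add, W.diff_diff, zero_add, h, map_smul, smul_smul,
        show W.t ^ (e - 1) * W.lam ^ (J + 1) = W.modulus * W.lam ^ J by rw [modulus]; ring,
        mul_smul] at h3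
      exact (smul_form_injective W.modulus_ne_zero h3).symm

/-- The top forms attached to an adapted basis are linearly independent in cohomology. -/
theorem eq_zero_of_smul_exact (he : 1 ≤ e) (hδ : 1 ≤ f.totalDegree)
    (hE : ∀ r s : ℤ, r + s = (n : ℤ) - 1 → Subsingleton (WeightE f e r s))
    (hU : IsAdaptedBasis f U) {c : (Fin n →₀ ℕ) → A} {y : A} (hy : y ≠ 0)
    {η : Forms n (MvPowerSeries (Fin n) A)} (hη : η ∈ W.nullForms ((n : ℤ) - 1))
    (h : W.diff η = y • ∑ u ∈ U, c u • topForm u) : ∀ u ∈ U, c u = 0 := by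
  obtain ⟨J, x, hx⟩ := W.exists_dvd_pow hy
  have hJ : W.diff (x • η) = W.lam ^ J • ∑ u ∈ U, c u • topForm u := by
    rw [map_smul, h, smul_smul, hx, mul_comm]
  -- A common factor `lam ^ k` of the coefficients is moved into the exponent, to which the
  -- preceding divisibility applies again.
  have key : ∀ k, ∀ u ∈ U, W.lam ^ k ∣ c u := by
    intro k
    induction k with
    | zero => simp
    | succ k ih =>
      choose! c' hc' using ih
      have h1 : ∑ u ∈ U, c u • topForm (A := A) u =
          W.lam ^ k • ∑ u ∈ U, c' u • topForm (A := A) u := by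
        rw [Finset.smul_sum]
        exact Finset.sum_congr rfl fun u hu => by rw [hc' u hu, mul_smul]
      intro u hu
      rw [h1, smul_smul, ← pow_add] at hJ
      rw [hc' u hu, pow_succ]
      exact mul_dvd_mul_left _ (W.lam_dvd_of_pow_smul_exact he hδ hE hU (J + k) _
        (Submodule.smul_mem _ _ hη) hJ u hu)
  exact fun u hu => W.separated _ fun k => key k u hu

end DworkModel

/-! ### Koszul complexes and dimension -/

/-- The Koszul complex of `g` on `M` is exact in degrees less than `c`. -/
def KoszulExact {n : ℕ} {R : Type*} [CommRing R] (g : Fin n → R) (M : Type*) [AddCommGroup M]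
    [Module R M] (c : ℤ) : Prop :=
  ∀ k < c, ∀ ω : Forms n M, IsHomogForm k ω → formsDiff (fun i => LinearMap.lsmul R M (g i)) ω = 0 →
    ∃ η, IsHomogForm (k - 1) η ∧ formsDiff (fun i => LinearMap.lsmul R M (g i)) η = ω

section LocalRing

variable {n : ℕ} {R : Type*} [CommRing R] {g : Fin n → R}

theorem formsDiff_lsmul_smul {M : Type*} [AddCommGroup M] [Module R M] (ω : Forms n M) :
    formsDiff (fun i => LinearMap.lsmul R M (g i))
      (formsDiff (fun i => LinearMap.lsmul R M (g i)) ω) = 0 :=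
  formsDiff_formsDiff (fun i j x => smul_comm (g i) (g j) x) ω

/-- In degree zero the Koszul cocycles are the elements killed by all `g i`, and there are no
coboundaries. -/
theorem KoszulExact.eq_zero {M : Type*} [AddCommGroup M] [Module R M] {c : ℤ} (hc : 0 < c)
    (h : KoszulExact g M c) {x : M} (hx : ∀ i, g i • x = 0) : x = 0 := by
  obtain ⟨η, h1, h2⟩ := h 0 hc (Pi.single ∅ x) (fun S hS => by
      rw [Pi.single_eq_of_ne]
      rintro rfl
      exact hS (by simp)) (by
    funext S
    rw [formsDiff_apply]
    refine Finset.sum_eq_zero fun i _ => ?_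
    by_cases hS : S.erase i = ∅
    · rw [hS, Pi.single_eq_same, LinearMap.lsmul_apply, hx, smul_zero]
    · rw [Pi.single_eq_of_ne hS, map_zero, smul_zero])
  rw [h1.eq_zero (by norm_num), map_zero] at h2
  simpa using (congrFun h2 ∅).symm

/-- By prime avoidance, an ideal without a regular element lies in one associated prime, hence kills
a nonzero element of `M`. -/
theorem KoszulExact.exists_isSMulRegular [IsNoetherianRing R] {M : Type*} [AddCommGroup M]
    [Module R M] [Module.Finite R M] {c : ℤ} (hc : 0 < c) (h : KoszulExact g M c) :
    ∃ x ∈ Ideal.span (Set.range g), IsSMulRegular M x := by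
  by_contra! hreg
  have h1 : (Ideal.span (Set.range g) : Set R) ⊆ ⋃ p ∈ associatedPrimes R M, (p : Set R) := by
    rw [biUnion_associatedPrimes_eq_compl_regular]
    exact fun x hx => hreg x hx
  obtain ⟨p, hp, hle⟩ := (Ideal.subset_union_prime_finite (associatedPrimes.finite R M) ⊥ ⊥
    fun p hp _ _ => IsAssociatedPrime.isPrime hp).1 h1
  obtain ⟨hprime, x, rfl⟩ := isAssociatedPrime_iff.1 hp
  have hx : x = 0 := h.eq_zero hc fun i => by
    have := hle (Ideal.subset_span (Set.mem_range_self i))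
    simpa [Submodule.mem_colon_singleton] using this
  refine hprime.ne_top ((Ideal.eq_top_iff_one _).2 ?_)
  simp [Submodule.mem_colon_singleton, hx]

/-- This is the long exact sequence of multiplication by `x`, carried out by hand: the differential
of a lifted cocycle is `x η`, and exactness one degree higher makes `η` exact. -/
theorem KoszulExact.quotSMulTop {M : Type*} [AddCommGroup M] [Module R M] {c : ℤ} {x : R}
    (hx : IsSMulRegular M x) (h : KoszulExact g M (c + 1)) :
    KoszulExact g (QuotSMulTop x M) c := by
  intro k hk ω hω hd
  set π : M →ₗ[R] QuotSMulTop x M := Submodule.mkQ _ with hπ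
  have hπd : ∀ (ξ : Forms n M) S,
      π (formsDiff (fun i => LinearMap.lsmul R M (g i)) ξ S) =
        formsDiff (fun i => LinearMap.lsmul R (QuotSMulTop x M) (g i)) (fun T => π (ξ T)) S :=
    fun ξ S => formsDiff_map _ _ (π : M →+ QuotSMulTop x M) (fun i y => by simp) ξ S
  have hker : ∀ y, π y = 0 → ∃ z, x • z = y := by
    intro y hy
    rw [hπ, Submodule.mkQ_apply, Submodule.Quotient.mk_eq_zero] at hy
    obtain ⟨z, -, hz⟩ := (Submodule.mem_smul_pointwise_iff_exists _ _ _).1 hy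
    exact ⟨z, hz⟩
  have h1 : ∀ S, ∃ y, π y = ω S ∧ ((S.card : ℤ) ≠ k → y = 0) := by
    intro S
    by_cases hS : (S.card : ℤ) = k
    · obtain ⟨y, hy⟩ := Submodule.mkQ_surjective _ (ω S)
      exact ⟨y, hy, fun h => absurd hS h⟩
    · exact ⟨0, by rw [map_zero, hω S hS], fun _ => rfl⟩
  choose ω' hω' hω'0 using h1
  have homω' : IsHomogForm k ω' := hω'0
  have h2 : ∀ S, ∃ z, x • z = formsDiff (fun i => LinearMap.lsmul R M (g i)) ω' S := by
    intro S
    refine hker _ ?_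
    rw [hπd, funext hω', hd, Pi.zero_apply]
  choose η hη using h2
  have hη' : formsDiff (fun i => LinearMap.lsmul R M (g i)) ω' = x • η := (funext hη).symm
  have homη : IsHomogForm (k + 1) η := fun S hS => hx (by
    change x • η S = x • (0 : M)
    rw [hη, homω'.formsDiff _ S hS, smul_zero])
  have hdη : formsDiff (fun i => LinearMap.lsmul R M (g i)) η = 0 := by
    funext S
    refine hx ?_
    have := congrFun (formsDiff_lsmul_smul (g := g) ω') S
    rw [hη', map_smul] at this
    change x • _ = x • (0 : M)
    rw [smul_zero]
    exact this
  obtain ⟨ζ, homζ, hζ⟩ := h (k + 1) (by linarith) η homη hdη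
  rw [add_sub_cancel_right] at homζ
  obtain ⟨ξ, homξ, hξ⟩ := h k (by linarith) (ω' - x • ζ) (homω'.sub (homζ.smul x)) (by
    rw [map_sub, map_smul, hζ, hη', sub_self])
  refine ⟨fun S => π (ξ S), fun S hS => by simp [homξ S hS], ?_⟩
  funext S
  rw [← hπd, hξ, Pi.sub_apply, map_sub, hω', Pi.smul_apply, sub_eq_self, hπ,
    Submodule.mkQ_apply, Submodule.Quotient.mk_eq_zero]
  exact Submodule.smul_mem_pointwise_smul _ _ _ Submodule.mem_top

/-- Depth is at most dimension: each regular element of the ideal lowers the dimension by one and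
costs one degree of exactness. -/
theorem KoszulExact.le_supportDim [IsNoetherianRing R] [IsLocalRing R]
    (hg : ∀ i, g i ∈ IsLocalRing.maximalIdeal R) {c : ℕ} {M : Type*} [AddCommGroup M]
    [Module R M] [Module.Finite R M] [Nontrivial M] (h : KoszulExact g M c) :
    (c : WithBot ℕ∞) ≤ Module.supportDim R M := by
  induction c generalizing M with
  | zero =>
    rw [Nat.cast_zero]
    obtain ⟨d, hd⟩ := WithBot.ne_bot_iff_exists.1 (Module.supportDim_ne_bot_of_nontrivial R M)
    rw [← hd]
    exact_mod_cast zero_le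
  | succ c ih =>
    obtain ⟨x, hx, hreg⟩ := h.exists_isSMulRegular (by positivity)
    have hxm : x ∈ IsLocalRing.maximalIdeal R :=
      Ideal.span_le.2 (Set.range_subset_iff.2 hg) hx
    have := nontrivial_quotSMulTop_of_mem_maximalIdeal M hxm
    rw [← Module.supportDim_quotSMulTop_succ_eq_supportDim hreg hxm]
    push_cast
    gcongr
    exact ih (KoszulExact.quotSMulTop hreg (by exact_mod_cast h))

end LocalRing

/-! ### Finiteness of the Jacobian ring -/

section Localization

variable {n : ℕ} {R : Type*} [CommRing R] [IsDomain R] {g : Fin n → R}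

/-- A form has finitely many coefficients, so denominators can be cleared; over a domain the cleared
form is still closed. -/
theorem KoszulExact.localization {c : ℤ} (h : KoszulExact g R c) (P : Ideal R) [P.IsPrime] :
    KoszulExact (fun i => algebraMap R (Localization.AtPrime P) (g i))
      (Localization.AtPrime P) c := by
  set S' := Localization.AtPrime P
  intro k hk ω hω hd
  have hinj : Function.Injective (algebraMap R S') :=
    IsLocalization.injective S' P.primeCompl_le_nonZeroDivisors
  have hmap : ∀ (ξ : Forms n R) S, algebraMap R S'
      (formsDiff (fun i => LinearMap.lsmul R R (g i)) ξ S) =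
      formsDiff (fun i => LinearMap.lsmul S' S' (algebraMap R S' (g i)))
        (fun T => algebraMap R S' (ξ T)) S := fun ξ S =>
    formsDiff_map _ _ (algebraMap R S' : R →+ S') (fun i x => by simp) ξ S
  obtain ⟨b, hb⟩ := IsLocalization.exist_integer_multiples_of_finite P.primeCompl ω
  choose ω' hω' using hb
  have hω'' : (fun T => algebraMap R S' (ω' T)) = algebraMap R S' b • ω := by
    funext T
    rw [hω', Pi.smul_apply, algebraMap_smul]
  have hom : IsHomogForm k ω' := fun S hS => hinj (by
    rw [hω', hω S hS, smul_zero, map_zero])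
  obtain ⟨η, homη, hη⟩ := h k hk ω' hom (by
    funext S
    refine hinj ?_
    rw [hmap, hω'', map_smul, hd, smul_zero, Pi.zero_apply, Pi.zero_apply, map_zero])
  obtain ⟨w, hw⟩ := IsLocalization.map_units S' b
  refine ⟨(↑w⁻¹ : S') • fun T => algebraMap R S' (η T), ?_, ?_⟩
  · refine IsHomogForm.smul _ fun S hS => ?_
    change algebraMap R S' (η S) = 0
    rw [homη S hS, map_zero]
  · have h1 : formsDiff (fun i => LinearMap.lsmul S' S' (algebraMap R S' (g i)))
        (fun T => algebraMap R S' (η T)) = algebraMap R S' b • ω := by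
      funext S
      rw [← hmap, hη, ← hω'']
    rw [map_smul, h1, ← hw, smul_smul, Units.inv_mul, one_smul]

end Localization

section Jacobian

variable {n : ℕ} {k : Type*} [Field k]

/-- The ideal of the partial derivatives. -/
abbrev jacobianIdeal (f : MvPolynomial (Fin n) k) : Ideal (MvPolynomial (Fin n) k) :=
  Ideal.span (Set.range fun i => MvPolynomial.pderiv i f)

/-- The local ring at `P` has dimension at least `n`, while no prime of the polynomial ring has
height above `n`; nothing can lie strictly above `P`. -/
theorem isMaximal_of_koszulExact {g : Fin n → MvPolynomial (Fin n) k}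
    (h : KoszulExact g (MvPolynomial (Fin n) k) n) {P : Ideal (MvPolynomial (Fin n) k)}
    [hP : P.IsPrime] (hle : Ideal.span (Set.range g) ≤ P) : P.IsMaximal := by
  have h1 := (h.localization P).le_supportDim (c := n) fun i => by
    rw [IsLocalization.AtPrime.to_map_mem_maximal_iff _ P]
    exact hle (Ideal.subset_span (Set.mem_range_self i))
  rw [Module.supportDim_self_eq_ringKrullDim,
    IsLocalization.AtPrime.ringKrullDim_eq_height P (Localization.AtPrime P)] at h1
  obtain ⟨m, hm, hPm⟩ := P.exists_le_maximal hP.ne_top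
  rcases hPm.lt_or_eq with hlt | rfl
  · exfalso
    have h2 : P.height < m.height := Ideal.height_strict_mono_of_isPrime_of_isPrime hlt
    have h3 : (m.height : WithBot ℕ∞) ≤ n := by
      have := Ideal.height_le_ringKrullDim_of_ne_top hm.ne_top
      rwa [MvPolynomial.ringKrullDim_of_isNoetherianRing, ringKrullDim_eq_zero_of_field,
        zero_add, Nat.card_eq_fintype_card, Fintype.card_fin] at this
    have h4 : (m.height : WithBot ℕ∞) ≤ P.height := h3.trans h1
    exact absurd (WithBot.coe_le_coe.1 h4) (not_le.2 h2)
  · exact hm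

theorem finite_quotient_of_koszulExact {g : Fin n → MvPolynomial (Fin n) k}
    (h : KoszulExact g (MvPolynomial (Fin n) k) n) :
    Module.Finite k (MvPolynomial (Fin n) k ⧸ Ideal.span (Set.range g)) := by
  rw [Module.finite_iff_krullDimLE_zero, Ideal.krullDimLE_zero_quotient_iff_forall_minimalPrimes_isMaximal]
  exact fun P hP => have := hP.1.1; isMaximal_of_koszulExact h hP.1.2

theorem koszulExact_of_vanishing {f : MvPolynomial (Fin n) k} {e : ℕ}
    (hδ : 1 ≤ f.totalDegree)
    (h : ∀ r s : ℤ, r + s ≠ n → Subsingleton (WeightE f e r s)) :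
    KoszulExact (fun i => MvPolynomial.pderiv i f) (MvPolynomial (Fin n) k) n := by
  intro m hm ω hω hd
  obtain ⟨l, hl⟩ := exists_mem_weightFiltration f.totalDegree ω
  obtain ⟨η, h1, -, h2⟩ := exists_primitive_of_closed hδ
    (fun r s hrs => h r s (by omega)) (l + 1) ω hω
    (weightFiltration_mono (by push_cast; linarith) hl) hd
  exact ⟨η, h1, h2⟩

end Jacobian

/-! ### Standard monomials -/

section StandardMonomials

variable {n : ℕ} {k : Type*} [Field k]

/-- The exponents of the monomials which are not congruent to combinations of smaller ones
modulo `I`, in the degree-lexicographic order. -/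
def stdExps (I : Submodule k (MvPolynomial (Fin n) k)) : Set (Fin n →₀ ℕ) :=
  {u | MvPolynomial.monomial u 1 ∉
    MvPolynomial.restrictSupport k {w | toDegLex w < toDegLex u} ⊔ I}

theorem degree_le_of_toDegLex_le {u v : Fin n →₀ ℕ} (h : toDegLex u ≤ toDegLex v) :
    u.degree ≤ v.degree := Finsupp.DegLex.monotone_degree h

/-- The leading exponent of an element of `I` is never standard. As the order refines the degree,
the leading exponent lies in degree `r` once some coefficient there is nonzero. -/
theorem coeff_eq_zero_of_subset_stdExps {I : Submodule k (MvPolynomial (Fin n) k)}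
    {g : MvPolynomial (Fin n) k} (hg : g ∈ I) {r : ℕ}
    (h1 : ∀ u, r < u.degree → g.coeff u = 0)
    (h2 : ∀ u, u.degree = r → u ∉ stdExps I → g.coeff u = 0) (u : Fin n →₀ ℕ)
    (hu : u.degree = r) : g.coeff u = 0 := by
  classical
  by_contra hne
  obtain ⟨v, hv, hmax⟩ := g.support.exists_max_image toDegLex
    ⟨u, MvPolynomial.mem_support_iff.2 hne⟩
  have hv0 := MvPolynomial.mem_support_iff.1 hv
  have hvr : v.degree = r := le_antisymm (not_lt.1 fun h => hv0 (h1 v h))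
    (hu ▸ degree_le_of_toDegLex_le (hmax u (MvPolynomial.mem_support_iff.2 hne)))
  have hvU : v ∈ stdExps I := by
    by_contra h
    exact hv0 (h2 v hvr h)
  refine hvU ?_
  have h3 : MvPolynomial.monomial v 1 = (MvPolynomial.monomial v 1 - (g.coeff v)⁻¹ • g) +
      (g.coeff v)⁻¹ • g := by abel
  rw [h3]
  refine Submodule.add_mem_sup ((MvPolynomial.mem_restrictSupport_iff k).2 fun w hw => ?_)
    (I.smul_mem _ hg)
  rw [Finset.mem_coe, MvPolynomial.mem_support_iff, MvPolynomial.coeff_sub,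
    MvPolynomial.coeff_monomial, MvPolynomial.coeff_smul, smul_eq_mul] at hw
  have hwv : w ≠ v := by
    rintro rfl
    rw [if_pos rfl, inv_mul_cancel₀ hv0, sub_self] at hw
    exact hw rfl
  rw [if_neg (Ne.symm hwv), zero_sub, neg_ne_zero] at hw
  exact lt_of_le_of_ne (hmax w (MvPolynomial.mem_support_iff.2 (right_ne_zero_of_mul hw)))
    fun h => hwv (toDegLex_injective h)

theorem eq_zero_of_support_subset_stdExps {I : Submodule k (MvPolynomial (Fin n) k)}
    {g : MvPolynomial (Fin n) k} (hg : g ∈ I)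
    (h : ∀ u, u ∉ stdExps I → g.coeff u = 0) : g = 0 := by
  by_contra hne
  obtain ⟨v, hv, hmax⟩ := g.support.exists_max_image Finsupp.degree
    (MvPolynomial.support_nonempty.2 hne)
  refine MvPolynomial.mem_support_iff.1 hv (coeff_eq_zero_of_subset_stdExps hg
    (r := v.degree) (fun u hu => ?_) (fun u _ => h u) v rfl)
  by_contra hu0
  exact absurd (hmax u (MvPolynomial.mem_support_iff.2 hu0)) (not_le.2 hu)

/-- Division by well-founded induction; a degree order is needed so that reduction never raises the
degree, hence the weight. -/
theorem monomial_mem_sup_stdExps (I : Submodule k (MvPolynomial (Fin n) k)) (v : Fin n →₀ ℕ) :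
    MvPolynomial.monomial v 1 ∈ MvPolynomial.restrictSupport k
      {u | u ∈ stdExps I ∧ u.degree ≤ v.degree} ⊔ I := by
  suffices h : ∀ x : DegLex (Fin n →₀ ℕ), MvPolynomial.monomial (ofDegLex x) 1 ∈
      MvPolynomial.restrictSupport k
      {u | u ∈ stdExps I ∧ u.degree ≤ (ofDegLex x).degree} ⊔ I from h (toDegLex v)
  intro x
  induction x using WellFoundedLT.induction with
  | ind x ih =>
    by_cases hx : ofDegLex x ∈ stdExps I
    · exact Submodule.mem_sup_left ((MvPolynomial.monomial_mem_restrictSupport k).2 (Or.inl ⟨hx, le_rfl⟩))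
    · have hx' := not_not.1 hx
      refine (sup_le ?_ le_sup_right : _ ≤ MvPolynomial.restrictSupport k
        {u | u ∈ stdExps I ∧ u.degree ≤ (ofDegLex x).degree} ⊔ I) hx'
      rw [MvPolynomial.restrictSupport_eq_span, Submodule.span_le]
      rintro _ ⟨w, hw, rfl⟩
      refine sup_le_sup_right (MvPolynomial.restrictSupport_mono _ ?_) I (ih (toDegLex w) hw)
      exact fun u hu => ⟨hu.1, hu.2.trans (degree_le_of_toDegLex_le hw.le)⟩

theorem linearIndependent_stdExps (I : Submodule k (MvPolynomial (Fin n) k)) :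
    LinearIndependent k fun u : stdExps I =>
      (Submodule.mkQ I (MvPolynomial.monomial (u : Fin n →₀ ℕ) (1 : k))) := by
  classical
  rw [linearIndependent_iff']
  intro s c hc u hu
  rw [← map_zero I.mkQ] at hc
  simp only [← map_smul, ← map_sum] at hc
  rw [map_zero, Submodule.mkQ_apply, Submodule.Quotient.mk_eq_zero] at hc
  have hcoeff : ∀ v, (∑ u ∈ s, MvPolynomial.monomial (u : Fin n →₀ ℕ) (c u • (1 : k))).coeff v =
      ∑ u ∈ s, if (u : Fin n →₀ ℕ) = v then c u else 0 := fun v => by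
    rw [MvPolynomial.coeff_sum]
    refine Finset.sum_congr rfl fun u _ => ?_
    rw [MvPolynomial.coeff_monomial, smul_eq_mul, mul_one]
  have h0 := eq_zero_of_support_subset_stdExps hc fun v hv => by
    rw [hcoeff]
    refine Finset.sum_eq_zero fun u _ => if_neg ?_
    rintro rfl
    exact hv u.2
  have h1 := hcoeff u
  rw [h0, MvPolynomial.coeff_zero, Finset.sum_eq_single u, if_pos rfl] at h1
  · exact h1.symm
  · exact fun w _ hw => if_neg fun h => hw (Subtype.ext h)
  · exact fun h => absurd hu h

theorem span_stdExps (I : Submodule k (MvPolynomial (Fin n) k)) :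
    ⊤ ≤ Submodule.span k (Set.range fun u : stdExps I =>
      (Submodule.mkQ I (MvPolynomial.monomial (u : Fin n →₀ ℕ) (1 : k)))) := by
  rintro x -
  obtain ⟨p, rfl⟩ := Submodule.mkQ_surjective I x
  induction p using MvPolynomial.induction_on' with
  | add p q hp hq =>
    rw [map_add]
    exact Submodule.add_mem _ hp hq
  | monomial v a =>
    rw [← mul_one a, ← smul_eq_mul, ← MvPolynomial.smul_monomial, map_smul]
    refine Submodule.smul_mem _ _ ?_
    obtain ⟨p, hp, q, hq, hpq⟩ := Submodule.mem_sup.1 (monomial_mem_sup_stdExps I v)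
    rw [← hpq, map_add, Submodule.mkQ_apply I q, (Submodule.Quotient.mk_eq_zero I).2 hq, add_zero]
    rw [MvPolynomial.restrictSupport_eq_span] at hp
    refine (Submodule.span_le (p := Submodule.comap I.mkQ (Submodule.span k _))).2 ?_ hp
    rintro _ ⟨u, hu, rfl⟩
    exact Submodule.subset_span ⟨⟨u, hu.1⟩, rfl⟩

theorem exists_finset_stdExps (I : Submodule k (MvPolynomial (Fin n) k))
    [Module.Finite k (MvPolynomial (Fin n) k ⧸ I)] :
    ∃ U : Finset (Fin n →₀ ℕ), (U : Set (Fin n →₀ ℕ)) = stdExps I ∧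
      U.card = Module.finrank k (MvPolynomial (Fin n) k ⧸ I) := by
  let b := Module.Basis.mk (linearIndependent_stdExps I) (span_stdExps I)
  have hfin : Finite (stdExps I) := Module.Finite.finite_basis b
  refine ⟨(Set.toFinite (stdExps I)).toFinset, by simp, ?_⟩
  rw [Module.finrank_eq_nat_card_basis b, Nat.card_coe_set_eq, Set.ncard_eq_toFinset_card _]

theorem wedgeDf_univ_mem_jacobianIdeal (f : MvPolynomial (Fin n) k)
    (η : Forms n (MvPolynomial (Fin n) k)) :
    wedgeDf f η Finset.univ ∈ jacobianIdeal f := by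
  rw [wedgeDf, formsDiff_apply]
  exact Ideal.sum_mem _ fun i _ => zsmul_mem (Ideal.mul_mem_right _ _
    (Ideal.subset_span (Set.mem_range_self i))) _

theorem exists_wedgeDf_univ_eq {f g : MvPolynomial (Fin n) k} (hg : g ∈ jacobianIdeal f) :
    ∃ η, IsHomogForm ((n : ℤ) - 1) η ∧ wedgeDf f η Finset.univ = g := by
  classical
  obtain ⟨a, rfl⟩ := Ideal.mem_span_range_iff_exists_fun.1 hg
  -- Including the sign here makes it cancel the sign in the differential.
  refine ⟨fun S => ∑ i, if S = Finset.univ.erase i then formSign i Finset.univ • a i else 0,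
    fun S hS => Finset.sum_eq_zero fun i _ => if_neg ?_, ?_⟩
  · rintro rfl
    have := Finset.card_erase_add_one (Finset.mem_univ i)
    rw [Finset.card_univ, Fintype.card_fin] at this
    exact hS (by omega)
  · rw [wedgeDf, formsDiff_apply]
    refine Finset.sum_congr rfl fun i _ => ?_
    rw [Finset.sum_eq_single i, if_pos rfl, LinearMap.mulLeft_apply, mul_smul_comm, smul_smul,
      formSign, ← mul_pow]
    · simp [mul_comm]
    · intro j _ hj
      refine if_neg fun h => ?_
      have h1 : i ∉ Finset.univ.erase j := h ▸ Finset.notMem_erase i _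
      exact h1 (Finset.mem_erase.2 ⟨Ne.symm hj, Finset.mem_univ _⟩)
    · simp

theorem exists_isAdaptedBasis {f : MvPolynomial (Fin n) k}
    (hfin : Module.Finite k (MvPolynomial (Fin n) k ⧸ jacobianIdeal f)) :
    ∃ U, IsAdaptedBasis f U ∧
      U.card = Module.finrank k (MvPolynomial (Fin n) k ⧸ jacobianIdeal f) := by
  set I : Submodule k (MvPolynomial (Fin n) k) := (jacobianIdeal f).restrictScalars k with hI
  have : Module.Finite k (MvPolynomial (Fin n) k ⧸ I) := hfin
  obtain ⟨U, hU, hcard⟩ := exists_finset_stdExps I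
  have hU' : ∀ u, u ∈ U ↔ u ∈ stdExps I := fun u => by rw [← hU, Finset.mem_coe]
  refine ⟨U, ⟨fun v => ?_, fun η r h1 h2 => ?_⟩, hcard⟩
  · obtain ⟨p, hp, g, hg, hpg⟩ := Submodule.mem_sup.1 (monomial_mem_sup_stdExps I v)
    rw [MvPolynomial.mem_restrictSupport_iff] at hp
    obtain ⟨η, homη, hη⟩ := exists_wedgeDf_univ_eq (f := f) (g := g) hg
    have hcoeff : ∀ u, g.coeff u = (if v = u then 1 else 0) - p.coeff u := fun u => by
      rw [← MvPolynomial.coeff_monomial, ← MvPolynomial.coeff_sub, ← hpg, add_sub_cancel_left]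
    refine ⟨η, homη, mem_weightFiltration.2 fun S u hu => ?_, fun u hu => ?_⟩
    · by_cases hS : S = Finset.univ
      · subst hS
        rw [formWeight_univ] at hu
        rw [hη, hcoeff, if_neg (by rintro rfl; simp at hu), MvPolynomial.notMem_support_iff.1,
          sub_zero]
        exact fun h => absurd (hp h).2 (by omega)
      · have := homη.formsDiff fun i => LinearMap.mulLeft k (MvPolynomial.pderiv i f)
        rw [sub_add_cancel] at this
        rw [wedgeDf, this.eq_zero_of_ne_univ hS, MvPolynomial.coeff_zero]
    · rw [hη, hcoeff, MvPolynomial.notMem_support_iff.1 fun h => hu ((hU' u).2 (hp h).1), sub_zero]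
      simp only [eq_comm]
  · exact coeff_eq_zero_of_subset_stdExps (I := I) (wedgeDf_univ_mem_jacobianIdeal f η) h1
      fun u hu hs => h2 u hu fun h => hs ((hU' u).1 h)

end StandardMonomials

/-! ### The sum of the Milnor numbers -/

section MilnorSum

variable {n : ℕ} {K : Type*} [Field K]

theorem mem_criticalPoints_iff {g : MvPolynomial (Fin n) K} {P : Fin n → K} :
    P ∈ criticalPoints g ↔ jacobianIdeal g ≤ pointIdeal P := by
  rw [jacobianIdeal, Ideal.span_le, Set.range_subset_iff]
  rfl

theorem exists_comap_mk_eq_pointIdeal [IsAlgClosed K] {g : MvPolynomial (Fin n) K}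
    (m : MaximalSpectrum (MvPolynomial (Fin n) K ⧸ jacobianIdeal g)) :
    ∃ P : Fin n → K, m.asIdeal.comap (Ideal.Quotient.mk (jacobianIdeal g)) = pointIdeal P := by
  have hm := m.isMaximal
  obtain ⟨P, hP⟩ := MvPolynomial.eq_vanishingIdeal_singleton_of_isMaximal K
    (Ideal.comap_isMaximal_of_surjective (Ideal.Quotient.mk (jacobianIdeal g))
      Ideal.Quotient.mk_surjective (K := m.asIdeal))
  refine ⟨P, hP.trans ?_⟩
  ext p
  rw [MvPolynomial.mem_vanishingIdeal_singleton_iff, MvPolynomial.aeval_eq_eval]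
  rfl

/-- Localization commutes with quotients once the complements of the two primes are matched. -/
theorem isLocalization_milnorAlgebra {g : MvPolynomial (Fin n) K} {P : Fin n → K}
    (m : Ideal (MvPolynomial (Fin n) K ⧸ jacobianIdeal g)) [m.IsPrime]
    (h : m.comap (Ideal.Quotient.mk (jacobianIdeal g)) = pointIdeal P) :
    IsLocalization m.primeCompl (MilnorAlgebra g P) := by
  have h1 : Algebra.algebraMapSubmonoid (MvPolynomial (Fin n) K ⧸ jacobianIdeal g)
      (pointIdeal P).primeCompl = m.primeCompl := by
    ext x
    obtain ⟨y, rfl⟩ := Ideal.Quotient.mk_surjective x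
    have hy : ∀ z, z ∈ pointIdeal P ↔ Ideal.Quotient.mk (jacobianIdeal g) z ∈ m := fun z => by
      rw [← h, Ideal.mem_comap]
    constructor
    · rintro ⟨z, hz, hzy⟩
      change Ideal.Quotient.mk _ z = Ideal.Quotient.mk _ y at hzy
      rw [Ideal.mem_primeCompl_iff, ← hzy, ← hy]
      exact hz
    · intro hx
      exact ⟨y, fun h' => hx ((hy y).1 h'), rfl⟩
  rw [← h1]
  infer_instance

/-- The localization of the Jacobian ring at a maximal ideal is a Milnor algebra. -/
def localizationEquivMilnorAlgebra {g : MvPolynomial (Fin n) K} {P : Fin n → K}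
    (m : Ideal (MvPolynomial (Fin n) K ⧸ jacobianIdeal g)) [m.IsPrime]
    (h : m.comap (Ideal.Quotient.mk (jacobianIdeal g)) = pointIdeal P) :
    Localization.AtPrime m ≃ₗ[K] MilnorAlgebra g P :=
  have := isLocalization_milnorAlgebra m h
  let E := IsLocalization.algEquiv m.primeCompl (Localization.AtPrime m) (MilnorAlgebra g P)
  { E.toAddEquiv with
    map_smul' := fun c x => by
      change E (c • x) = c • E x
      have h1 : c • E x = algebraMap K (MilnorAlgebra g P) c * E x := Algebra.smul_def c (E x)
      rw [h1, Algebra.smul_def, map_mul]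
      congr 1
      exact E.commutes (algebraMap K _ c) }

/-- The Jacobian ring is Artinian, hence the product of its localizations at maximal ideals. By the
Nullstellensatz these ideals are the critical points. -/
theorem finite_criticalPoints_and_sum [IsAlgClosed K] (g : MvPolynomial (Fin n) K)
    [Module.Finite K (MvPolynomial (Fin n) K ⧸ jacobianIdeal g)] :
    (criticalPoints g).Finite ∧
    (∀ P ∈ criticalPoints g, Module.Finite K (MilnorAlgebra g P)) ∧
    ∑ᶠ P ∈ criticalPoints g, milnorNumber g P =
      Module.finrank K (MvPolynomial (Fin n) K ⧸ jacobianIdeal g) := by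
  set J := MvPolynomial (Fin n) K ⧸ jacobianIdeal g
  have : IsArtinianRing J := IsArtinianRing.of_finite K J
  choose pt hpt using exists_comap_mk_eq_pointIdeal (g := g)
  have hinj : Function.Injective pt := fun m m' h => by
    refine MaximalSpectrum.ext (Ideal.comap_injective_of_surjective
      (Ideal.Quotient.mk (jacobianIdeal g)) Ideal.Quotient.mk_surjective ?_)
    rw [hpt, hpt, h]
  have hrange : criticalPoints g = Set.range pt := by
    ext P
    rw [mem_criticalPoints_iff]
    constructor
    · intro h
      have hmax : (pointIdeal P).IsMaximal :=
        RingHom.ker_isMaximal_of_surjective _ fun x => ⟨MvPolynomial.C x, by simp⟩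
      have hcomap : ((pointIdeal P).map (Ideal.Quotient.mk (jacobianIdeal g))).comap
          (Ideal.Quotient.mk (jacobianIdeal g)) = pointIdeal P := by
        rw [Ideal.comap_map_mk h]
      have hm : ((pointIdeal P).map (Ideal.Quotient.mk (jacobianIdeal g))).IsMaximal :=
        (Ideal.map_eq_top_or_isMaximal_of_surjective _ Ideal.Quotient.mk_surjective
          hmax).resolve_left fun htop => hmax.ne_top (by rw [← hcomap, htop, Ideal.comap_top])
      refine ⟨⟨_, hm⟩, ?_⟩
      have h1 : pointIdeal (pt ⟨_, hm⟩) = pointIdeal P := by rw [← hpt, hcomap]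
      funext i
      have h2 : MvPolynomial.X i - MvPolynomial.C (P i) ∈ pointIdeal P := by
        simp [pointIdeal, RingHom.mem_ker]
      rw [← h1] at h2
      simpa [pointIdeal, RingHom.mem_ker, sub_eq_zero] using h2
    · rintro ⟨m, rfl⟩
      rw [← hpt]
      intro x hx
      rw [Ideal.mem_comap, Ideal.Quotient.eq_zero_iff_mem.2 hx]
      exact Ideal.zero_mem _
  have hprime : ∀ m : MaximalSpectrum J, m.asIdeal.IsPrime := fun m => m.isMaximal.isPrime
  have hfin : Finite (MaximalSpectrum J) := inferInstance
  have := Fintype.ofFinite (MaximalSpectrum J)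
  let E : J ≃ₗ[K] MaximalSpectrum.PiLocalization J :=
    ((MaximalSpectrum.toPiLocalizationEquiv J).restrictScalars K).toLinearEquiv
  have hloc : ∀ m : MaximalSpectrum J, Module.Finite K (Localization.AtPrime m.asIdeal) :=
    fun m => Module.Finite.of_surjective
      ((LinearMap.proj (R := K) m : MaximalSpectrum.PiLocalization J →ₗ[K]
        Localization.AtPrime m.asIdeal) ∘ₗ E.toLinearMap)
      ((Function.surjective_eval m).comp E.surjective)
  have hfree : ∀ m : MaximalSpectrum J, Module.Free K (Localization.AtPrime m.asIdeal) :=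
    fun m => Module.Free.of_divisionRing K (Localization.AtPrime m.asIdeal)
  refine ⟨hrange ▸ Set.finite_range pt, ?_, ?_⟩
  · rw [hrange]
    rintro _ ⟨m, rfl⟩
    exact Module.Finite.equiv (localizationEquivMilnorAlgebra m.asIdeal (hpt m))
  · rw [hrange, finsum_mem_range hinj, finsum_eq_sum_of_fintype, E.finrank_eq,
      Module.finrank_pi_fintype]
    exact Finset.sum_congr rfl fun m _ =>
      (localizationEquivMilnorAlgebra m.asIdeal (hpt m)).finrank_eq.symm

end MilnorSum

/-! ### Base change of the Jacobian ring -/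

section BaseChange

variable {n : ℕ} {k : Type*} [Field k]

open TensorProduct in
/-- The Jacobian ring over an extension field. -/
def jacobianBaseChange (f : MvPolynomial (Fin n) k) (K : Type*) [Field K] [Algebra k K] :
    K ⊗[k] (MvPolynomial (Fin n) k ⧸ jacobianIdeal f) ≃ₗ[K]
      MvPolynomial (Fin n) K ⧸ jacobianIdeal (f.map (algebraMap k K)) :=
  (Algebra.TensorProduct.tensorQuotientEquiv (R := k) K (MvPolynomial (Fin n) k) K
    (jacobianIdeal f)).toLinearEquiv.trans
  (Ideal.quotientEquivAlg _ _ (MvPolynomial.algebraTensorAlgEquiv k K) (by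
    simp only [jacobianIdeal, Ideal.map_span, ← Set.range_comp]
    congr 2
    funext i
    simp [MvPolynomial.pderiv_map])).toLinearEquiv

end BaseChange

/-! ### Coordinates on a finite residue field -/

/-- Through `θ` both quotients are `F`-vector spaces, and multiplication by `s` embeds `A / lam`
into `A / (lam * s)`. An `F`-linear retraction followed by coordinates in a basis of `A / lam` gives
the `φ i`. -/
theorem exists_residue_coordinates {F A : Type*} [Field F] [CommRing A] [IsDomain A]
    {lam s : A} (hs : s ≠ 0) [Finite (A ⧸ Ideal.span {lam})] {θ : F → A} (h0 : θ 0 = 0)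
    (h1 : θ 1 = 1) (hmul : ∀ x y, θ (x * y) = θ x * θ y)
    (hadd : ∀ x y, lam * s ∣ θ (x + y) - (θ x + θ y)) :
    ∃ (d : ℕ) (β : Fin d → A) (φ : Fin d → A →+ F),
      (∀ i x a, φ i (θ x * a) = x * φ i a) ∧ (∀ i a, lam * s ∣ a → φ i a = 0) ∧
        ∀ a, lam ∣ a - ∑ i, β i * θ (φ i (s * a)) := by
  let θ₁ : F →+* A ⧸ Ideal.span {lam} :=
    { toFun := fun x => Ideal.Quotient.mk _ (θ x)
      map_zero' := by simp [h0]
      map_one' := by simp [h1]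
      map_mul' := fun x y => by simp [hmul]
      map_add' := fun x y => by
        rw [← map_add, Ideal.Quotient.mk_eq_mk_iff_sub_mem, Ideal.mem_span_singleton]
        exact (dvd_mul_right _ _).trans (hadd x y) }
  let θ₂ : F →+* A ⧸ Ideal.span {lam * s} :=
    { toFun := fun x => Ideal.Quotient.mk _ (θ x)
      map_zero' := by simp [h0]
      map_one' := by simp [h1]
      map_mul' := fun x y => by simp [hmul]
      map_add' := fun x y => by
        rw [← map_add, Ideal.Quotient.mk_eq_mk_iff_sub_mem, Ideal.mem_span_singleton]
        exact hadd x y }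
  let : Module F (A ⧸ Ideal.span {lam}) := Module.compHom _ θ₁
  let : Module F (A ⧸ Ideal.span {lam * s}) := Module.compHom _ θ₂
  have hle : Ideal.span {lam} ≤
      Submodule.comap (LinearMap.mulLeft A s) (Ideal.span {lam * s} : Submodule A A) := by
    rw [Ideal.span_singleton_le_iff_mem]
    change s * lam ∈ Ideal.span {lam * s}
    rw [mul_comm]
    exact Ideal.mem_span_singleton_self _
  let m₀ := Submodule.mapQ (Ideal.span {lam}) (Ideal.span {lam * s}) (LinearMap.mulLeft A s) hle
  let m : (A ⧸ Ideal.span {lam}) →ₗ[F] (A ⧸ Ideal.span {lam * s}) :=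
    { toFun := m₀
      map_add' := m₀.map_add
      map_smul' := fun x a => m₀.map_smul (θ x) a }
  have hm : ∀ a, m (Ideal.Quotient.mk _ a) = Ideal.Quotient.mk _ (s * a) := fun a => rfl
  have hker : LinearMap.ker m = ⊥ := by
    rw [LinearMap.ker_eq_bot']
    intro a ha
    obtain ⟨a, rfl⟩ := Ideal.Quotient.mk_surjective a
    rw [hm, Ideal.Quotient.eq_zero_iff_mem, Ideal.mem_span_singleton, mul_comm lam] at ha
    rw [Ideal.Quotient.eq_zero_iff_mem, Ideal.mem_span_singleton]
    exact (mul_dvd_mul_iff_left hs).1 ha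
  obtain ⟨g, hg⟩ := m.exists_leftInverse_of_injective hker
  have : Module.Finite F (A ⧸ Ideal.span {lam}) := Module.Finite.of_finite
  let B := Module.finBasis F (A ⧸ Ideal.span {lam})
  choose β hβ using fun i => Ideal.Quotient.mk_surjective (I := Ideal.span {lam}) (B i)
  let φ : Fin (Module.finrank F (A ⧸ Ideal.span {lam})) → A →+ F := fun i =>
    ((B.coord i ∘ₗ g).toAddMonoidHom).comp
      (Ideal.Quotient.mk (Ideal.span {lam * s})).toAddMonoidHom
  have hφ : ∀ i a, φ i a = B.coord i (g (Ideal.Quotient.mk _ a)) := fun i a => rfl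
  refine ⟨_, β, φ, fun i x a => ?_, fun i a ha => ?_, fun a => ?_⟩
  · have : Ideal.Quotient.mk (Ideal.span {lam * s}) (θ x * a) =
      x • Ideal.Quotient.mk (Ideal.span {lam * s}) a := rfl
    rw [hφ, this, map_smul, map_smul, hφ, smul_eq_mul]
  · rw [hφ, Ideal.Quotient.eq_zero_iff_mem.2 (Ideal.mem_span_singleton.2 ha), map_zero, map_zero]
  · rw [← Ideal.mem_span_singleton, ← Ideal.Quotient.mk_eq_mk_iff_sub_mem]
    have h2 : ∀ i, φ i (s * a) = B.coord i (Ideal.Quotient.mk _ a) := fun i => by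
      rw [hφ, ← hm]
      exact congrArg (B.coord i) (LinearMap.congr_fun hg _)
    conv_lhs => rw [← B.sum_repr (Ideal.Quotient.mk _ a)]
    rw [map_sum]
    refine Finset.sum_congr rfl fun i _ => ?_
    rw [h2, map_mul, hβ, mul_comm]
    rfl

/-! ### Rings of integers of finite extensions of `ℚ_p` -/

section Integers

variable {p : ℕ} [Fact p.Prime] (L : IntermediateField ℚ_[p] ℂ_[p])

/-- The elements of `L` of norm at most `1`. -/
def integers : Subring ℂ_[p] where
  carrier := {x | x ∈ L ∧ ‖x‖ ≤ 1}
  mul_mem' := fun {a b} ha hb => ⟨L.mul_mem ha.1 hb.1, by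
    rw [norm_mul]; exact mul_le_one₀ ha.2 (norm_nonneg _) hb.2⟩
  one_mem' := ⟨L.one_mem, by simp⟩
  add_mem' := fun {a b} ha hb => ⟨L.add_mem ha.1 hb.1,
    (IsUltrametricDist.norm_add_le_max a b).trans (max_le ha.2 hb.2)⟩
  zero_mem' := ⟨L.zero_mem, by simp⟩
  neg_mem' := fun {a} ha => ⟨L.neg_mem ha.1, by simpa using ha.2⟩

variable {L}

theorem integers_dvd_iff {x y : integers L} : x ∣ y ↔ ‖(y : ℂ_[p])‖ ≤ ‖(x : ℂ_[p])‖ := by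
  constructor
  · rintro ⟨z, rfl⟩
    rw [Subring.coe_mul, norm_mul]
    exact mul_le_of_le_one_right (norm_nonneg _) z.2.2
  · intro h
    by_cases hx : (x : ℂ_[p]) = 0
    · rw [hx, norm_zero, norm_le_zero_iff] at h
      exact ⟨0, by simpa using Subtype.ext h⟩
    · refine ⟨⟨(y : ℂ_[p]) / x, L.div_mem y.2.1 x.2.1, ?_⟩, Subtype.ext ?_⟩
      · rw [norm_div]
        exact div_le_one_of_le₀ h (norm_nonneg _)
      · exact (mul_div_cancel₀ _ hx).symm

theorem norm_prime : ‖(p : ℂ_[p])‖ = (p : ℝ)⁻¹ := by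
  simpa using PadicComplex.norm_extends' p (p : ℚ_[p])

variable {lam : integers L}

theorem integers_dvd_total (hlam : ∀ x ∈ L, ‖x‖ < 1 → ‖x‖ ≤ ‖(lam : ℂ_[p])‖)
    (x y : integers L) : x ∣ y ∨ lam * y ∣ x := by
  rw [integers_dvd_iff, integers_dvd_iff]
  refine (le_or_gt ‖(y : ℂ_[p])‖ ‖(x : ℂ_[p])‖).imp_right fun h => ?_
  have hy : 0 < ‖(y : ℂ_[p])‖ := (norm_nonneg _).trans_lt h
  have h2 := hlam ((x : ℂ_[p]) / y) (L.div_mem x.2.1 y.2.1)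
    (by rw [norm_div]; exact (div_lt_one hy).2 h)
  rw [norm_div, div_le_iff₀ hy] at h2
  simpa using h2

theorem integers_separated (hlam : ‖(lam : ℂ_[p])‖ < 1) (x : integers L)
    (hx : ∀ k : ℕ, lam ^ k ∣ x) : x = 0 := by
  have h : ‖(x : ℂ_[p])‖ ≤ 0 := by
    refine ge_of_tendsto' (tendsto_pow_atTop_nhds_zero_of_lt_one (norm_nonneg _) hlam)
      fun k => ?_
    simpa using integers_dvd_iff.1 (hx k)
  exact Subtype.ext (norm_le_zero_iff.1 h)

variable [FiniteDimensional ℚ_[p] L]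

theorem isClosed_intermediateField : IsClosed (L : Set ℂ_[p]) :=
  Submodule.closed_of_finiteDimensional L.toSubalgebra.toSubmodule

theorem isCompact_integers_of_isClosed {s : Set ℂ_[p]} (hs : IsClosed s)
    (h1 : ∀ x ∈ s, ‖x‖ ≤ 1) : IsCompact {x : L | (x : ℂ_[p]) ∈ s} := by
  have : ProperSpace L := FiniteDimensional.proper ℚ_[p] L
  refine (isCompact_closedBall (0 : L) 1).of_isClosed_subset
    (hs.preimage continuous_subtype_val) fun x hx => ?_
  simpa using h1 x hx

-- The maximal ideal is compact, because `L` is locally compact and open balls are closed; the norm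
-- attains its maximum there.
variable (L) in
theorem exists_uniformizer : ∃ lam : integers L, lam ≠ 0 ∧ ‖(lam : ℂ_[p])‖ < 1 ∧
    ∀ x ∈ L, ‖x‖ < 1 → ‖x‖ ≤ ‖(lam : ℂ_[p])‖ := by
  have hp1 : (1 : ℝ) < p := by exact_mod_cast (Fact.out : p.Prime).one_lt
  have hp : (p : ℂ_[p]) ∈ L := by
    simp
  have hclosed : IsClosed (Metric.ball (0 : ℂ_[p]) 1) := IsUltrametricDist.isClosed_ball _ _
  have hpn : ‖(p : ℂ_[p])‖ < 1 := by
    rw [norm_prime]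
    exact inv_lt_one_of_one_lt₀ hp1
  obtain ⟨x, hx, hmax⟩ := (isCompact_integers_of_isClosed (L := L) hclosed
    fun x hx => (mem_ball_zero_iff.1 hx).le).exists_isMaxOn
    ⟨⟨p, hp⟩, mem_ball_zero_iff.2 hpn⟩ (f := fun x : L => ‖(x : ℂ_[p])‖) (by fun_prop)
  have hx1 : ‖(x : ℂ_[p])‖ < 1 := mem_ball_zero_iff.1 hx
  refine ⟨⟨x, x.2, hx1.le⟩, fun h => ?_, hx1, fun y hy hy1 => ?_⟩
  · have h2 : (x : ℂ_[p]) = 0 := congrArg Subtype.val h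
    have h3 : ‖(p : ℂ_[p])‖ ≤ ‖(x : ℂ_[p])‖ :=
      hmax (a := (⟨p, hp⟩ : L)) (mem_ball_zero_iff.2 hpn)
    rw [h2, norm_zero, norm_prime] at h3
    have : (0 : ℝ) < (p : ℝ)⁻¹ := by positivity
    linarith
  · exact hmax (a := (⟨y, hy⟩ : L)) (mem_ball_zero_iff.2 hy1)

theorem integers_exists_sum (hlam : ‖(lam : ℂ_[p])‖ < 1) (a : ℕ → integers L) :
    ∃ s, ∀ k, lam ^ k ∣ s - ∑ j ∈ Finset.range k, lam ^ j * a j := by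
  have hle : ∀ j, ‖((lam ^ j * a j : integers L) : ℂ_[p])‖ ≤ ‖(lam : ℂ_[p])‖ ^ j := fun j => by
    simpa using mul_le_of_le_one_right (pow_nonneg (norm_nonneg (lam : ℂ_[p])) j) (a j).2.2
  have hsum : Summable fun j => ((lam ^ j * a j : integers L) : ℂ_[p]) :=
    Summable.of_norm_bounded (summable_geometric_of_lt_one (norm_nonneg _) hlam) hle
  have htail : ∀ k, ‖(∑' j, ((lam ^ j * a j : integers L) : ℂ_[p])) -
      ∑ j ∈ Finset.range k, ((lam ^ j * a j : integers L) : ℂ_[p])‖ ≤ ‖(lam : ℂ_[p])‖ ^ k := by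
    intro k
    rw [← hsum.sum_add_tsum_nat_add k, add_sub_cancel_left]
    refine IsUltrametricDist.norm_tsum_le_of_forall_le_of_nonneg (by positivity) fun j => ?_
    exact (hle _).trans (pow_le_pow_of_le_one (norm_nonneg _) hlam.le (by omega))
  have hmem : (∑' j, ((lam ^ j * a j : integers L) : ℂ_[p])) ∈ L :=
    isClosed_intermediateField.mem_of_tendsto hsum.hasSum.tendsto_sum_nat
      (Filter.Eventually.of_forall fun k => L.sum_mem fun j _ => (lam ^ j * a j).2.1)
  refine ⟨⟨_, hmem, by simpa using htail 0⟩, fun k => integers_dvd_iff.2 ?_⟩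
  simpa using htail k

/-- Finitely many balls of radius `‖lam‖` cover the compact ring of integers, and each lies in one
residue class. -/
theorem finite_integers_quotient (h0 : lam ≠ 0) : Finite (integers L ⧸ Ideal.span {lam}) := by
  have hpos : 0 < ‖(lam : ℂ_[p])‖ := norm_pos_iff.2 fun h => h0 (Subtype.ext h)
  obtain ⟨T, hTs, hT, hcov⟩ := (isCompact_integers_of_isClosed (L := L)
    (Metric.isClosed_closedBall (x := (0 : ℂ_[p])) (ε := 1))
    fun x hx => by simpa using hx).finite_cover_balls hpos
  have hmem : ∀ x : T, ‖((x : L) : ℂ_[p])‖ ≤ 1 := fun x => by simpa using hTs x.2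
  have := hT.to_subtype
  refine Finite.of_surjective (fun x : T =>
    Ideal.Quotient.mk (Ideal.span {lam}) ⟨(x : L), (x : L).2, hmem x⟩) fun y => ?_
  obtain ⟨y, rfl⟩ := Ideal.Quotient.mk_surjective y
  have hy : (⟨y, y.2.1⟩ : L) ∈ {x : L | (x : ℂ_[p]) ∈ Metric.closedBall (0 : ℂ_[p]) 1} := by
    simpa using y.2.2
  obtain ⟨x, hxT, hx⟩ := Set.mem_iUnion₂.1 (hcov hy)
  refine ⟨⟨x, hxT⟩, ?_⟩
  rw [Ideal.Quotient.mk_eq_mk_iff_sub_mem, Ideal.mem_span_singleton, integers_dvd_iff]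
  have : ‖(y : ℂ_[p]) - x‖ < ‖(lam : ℂ_[p])‖ := by
    simpa [dist_eq_norm] using hx
  rw [norm_sub_rev] at this
  exact this.le

end Integers

/-! ### Teichmüller representatives -/

section Teichmuller

variable {p : ℕ} [Fact p.Prime]

theorem norm_eq_valuation (x : ℂ_[p]) : ‖x‖ = ((Valued.v x : NNReal) : ℝ) := by
  rw [PadicComplex.norm_eq_norm, Valuation.norm_def, PadicComplex.RankOne.hom_eq_embedding,
    Valuation.embedding_restrict]

theorem mem_padicComplexInt_iff {x : ℂ_[p]} : x ∈ 𝓞_ℂ_[p] ↔ ‖x‖ ≤ 1 := by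
  rw [norm_eq_valuation]
  norm_cast

theorem norm_le_one_of_padicComplexInt (x : 𝓞_ℂ_[p]) : ‖(x : ℂ_[p])‖ ≤ 1 :=
  mem_padicComplexInt_iff.1 x.2

theorem residue_eq_zero_iff_norm_lt {x : 𝓞_ℂ_[p]} :
    IsLocalRing.residue 𝓞_ℂ_[p] x = 0 ↔ ‖(x : ℂ_[p])‖ < 1 := by
  rw [IsLocalRing.residue_eq_zero_iff, IsLocalRing.mem_maximalIdeal, mem_nonunits_iff,
    ← not_le, not_iff_not]
  constructor
  · rintro ⟨u, rfl⟩
    have h : ((u : 𝓞_ℂ_[p]) : ℂ_[p]) * ((u⁻¹ : 𝓞_ℂ_[p]ˣ) : 𝓞_ℂ_[p]) = 1 :=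
      congrArg Subtype.val u.mul_inv
    have h2 := congrArg norm h
    rw [norm_mul, norm_one] at h2
    rw [← h2]
    exact mul_le_of_le_one_right (norm_nonneg _) (norm_le_one_of_padicComplexInt _)
  · intro h
    have h0 : (x : ℂ_[p]) ≠ 0 := fun h0 => by
      rw [h0, norm_zero] at h
      linarith
    refine IsUnit.of_mul_eq_one ⟨(x : ℂ_[p])⁻¹, mem_padicComplexInt_iff.2 ?_⟩
      (Subtype.ext (mul_inv_cancel₀ h0))
    rw [norm_inv]
    exact inv_le_one_of_one_le₀ h

theorem residue_eq_iff_norm_sub_lt {x y : 𝓞_ℂ_[p]} :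
    IsLocalRing.residue 𝓞_ℂ_[p] x = IsLocalRing.residue 𝓞_ℂ_[p] y ↔
      ‖(x : ℂ_[p]) - y‖ < 1 := by
  rw [← sub_eq_zero, ← map_sub, residue_eq_zero_iff_norm_lt]
  rfl

variable {F : Type*} [Field F] [Finite F] (ι : F →+* IsLocalRing.ResidueField 𝓞_ℂ_[p])

theorem exists_card_eq_pow (p : ℕ) (F : Type*) [Field F] [Finite F] [CharP F p] :
    ∃ a : ℕ, 1 ≤ a ∧ Nat.card F = p ^ a := by
  have := Fintype.ofFinite F
  obtain ⟨a, -, ha⟩ := FiniteField.card F p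
  exact ⟨a, a.2, by rw [Nat.card_eq_fintype_card, ha]⟩

theorem pow_natCard_eq (x : F) : x ^ Nat.card F = x := by
  have := Fintype.ofFinite F
  rw [Nat.card_eq_fintype_card, FiniteField.pow_card]

/-- The number `y ^ q - y` is the product of the distances vectors `y - z` over the roots `z`, so
not all factors have norm at least one. -/
theorem exists_root_near {q : ℕ} (hq : 1 < q) {y : ℂ_[p]} (hy : ‖y ^ q - y‖ < 1) :
    ∃ z, z ^ q = z ∧ ‖z - y‖ < 1 := by
  have hdeg : (Polynomial.X : Polynomial ℂ_[p]).degree < (q : WithBot ℕ) := by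
    rw [Polynomial.degree_X]
    exact_mod_cast hq
  have hmonic : (Polynomial.X ^ q - Polynomial.X : Polynomial ℂ_[p]).Monic :=
    Polynomial.monic_X_pow_sub hdeg
  have hsplit := (IsAlgClosed.splits
    (Polynomial.X ^ q - Polynomial.X : Polynomial ℂ_[p])).eq_prod_roots_of_monic hmonic
  have heval := congrArg (Polynomial.eval y) hsplit
  rw [Polynomial.eval_multiset_prod, Multiset.map_map] at heval
  by_contra! hcon
  have hge : ∀ s : Multiset ℂ_[p], (∀ z ∈ s, z ^ q = z) →
      1 ≤ ‖(s.map fun z => y - z).prod‖ := by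
    intro s
    induction s using Multiset.induction with
    | empty => simp
    | cons a s ih =>
      intro h
      rw [Multiset.map_cons, Multiset.prod_cons, norm_mul, norm_sub_rev]
      exact one_le_mul_of_one_le_of_one_le (hcon a (h a (Multiset.mem_cons_self a s)))
        (ih fun z hz => h z (Multiset.mem_cons_of_mem hz))
  have h1 := hge (Polynomial.X ^ q - Polynomial.X : Polynomial ℂ_[p]).roots fun z hz => by
    have := (Polynomial.mem_roots'.1 hz).2
    simpa [sub_eq_zero] using this
  have h2 : y ^ q - y = (((Polynomial.X ^ q - Polynomial.X : Polynomial ℂ_[p]).roots).map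
      fun z => y - z).prod := by
    simpa [Function.comp_def] using heval
  rw [← h2] at h1
  linarith

theorem exists_teichmuller (x : F) : ∃ z : 𝓞_ℂ_[p], z ^ Nat.card F = z ∧
    IsLocalRing.residue 𝓞_ℂ_[p] z = ι x := by
  obtain ⟨y, hy⟩ := IsLocalRing.residue_surjective (R := 𝓞_ℂ_[p]) (ι x)
  have h1 : ‖(y : ℂ_[p]) ^ Nat.card F - y‖ < 1 := by
    have : IsLocalRing.residue 𝓞_ℂ_[p] (y ^ Nat.card F) = IsLocalRing.residue 𝓞_ℂ_[p] y := by
      rw [map_pow, hy, ← map_pow, pow_natCard_eq]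
    simpa using residue_eq_iff_norm_sub_lt.1 this
  obtain ⟨z, hz, hzy⟩ := exists_root_near (Finite.one_lt_card (α := F)) h1
  have hz1 : ‖z‖ ≤ 1 := by
    have := IsUltrametricDist.norm_add_le_max (z - y) (y : ℂ_[p])
    rw [sub_add_cancel] at this
    exact this.trans (max_le hzy.le (norm_le_one_of_padicComplexInt y))
  refine ⟨⟨z, mem_padicComplexInt_iff.2 hz1⟩, Subtype.ext hz, ?_⟩
  rw [← hy]
  exact residue_eq_iff_norm_sub_lt.2 hzy

/-- The Teichmüller representative of `x`. -/
def teich (x : F) : 𝓞_ℂ_[p] := (exists_teichmuller ι x).choose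

theorem teich_pow (x : F) : teich ι x ^ Nat.card F = teich ι x :=
  (exists_teichmuller ι x).choose_spec.1

theorem residue_teich (x : F) : IsLocalRing.residue 𝓞_ℂ_[p] (teich ι x) = ι x :=
  (exists_teichmuller ι x).choose_spec.2

variable [CharP F p]

/-- If `z ≠ w`, dividing `z ^ q - w ^ q = z - w` by `z - w` gives a sum equal to `1` whose residue
is a multiple of `q`, hence zero. -/
theorem eq_of_residue_eq (ι : F →+* IsLocalRing.ResidueField 𝓞_ℂ_[p]) {z w : 𝓞_ℂ_[p]} (hz : z ^ Nat.card F = z) (hw : w ^ Nat.card F = w)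
    (h : IsLocalRing.residue 𝓞_ℂ_[p] z = IsLocalRing.residue 𝓞_ℂ_[p] w) : z = w := by
  have hcard : ((Nat.card F : ℕ) : IsLocalRing.ResidueField 𝓞_ℂ_[p]) = 0 := by
    obtain ⟨a, ha, hc⟩ := exists_card_eq_pow p F
    rw [← map_natCast ι, hc, Nat.cast_pow, CharP.cast_eq_zero, zero_pow (by omega), map_zero]
  by_contra hne
  have h1 := (Commute.all z w).geom_sum₂_mul (Nat.card F)
  rw [hz, hw] at h1
  have h2 : ∑ i ∈ Finset.range (Nat.card F), z ^ i * w ^ (Nat.card F - 1 - i) = 1 :=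
    mul_right_cancel₀ (sub_ne_zero.2 hne) (by rw [h1, one_mul])
  have h3 := congrArg (IsLocalRing.residue 𝓞_ℂ_[p]) h2
  rw [map_sum] at h3
  simp only [map_mul, map_pow, h, map_one] at h3
  rw [geom_sum₂_self, hcard, zero_mul] at h3
  exact zero_ne_one h3

theorem teich_eq {x : F} {z : 𝓞_ℂ_[p]} (hz : z ^ Nat.card F = z)
    (h : IsLocalRing.residue 𝓞_ℂ_[p] z = ι x) : teich ι x = z :=
  eq_of_residue_eq ι (teich_pow ι x) hz ((residue_teich ι x).trans h.symm)

theorem teich_zero : teich ι 0 = 0 :=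
  teich_eq ι (zero_pow Nat.card_pos.ne') (by simp)

theorem teich_one : teich ι 1 = 1 :=
  teich_eq ι (one_pow _) (by simp)

theorem teich_mul (x y : F) : teich ι (x * y) = teich ι x * teich ι y :=
  teich_eq ι (by rw [mul_pow, teich_pow, teich_pow])
    (by rw [map_mul, residue_teich, residue_teich, map_mul])

/-- Raising to the power `p ^ (a * k)` fixes Teichmüller elements and is additive up to multiples of
`p`. So the defect equals its own high power modulo `p`, and that power is small because the defect
has norm below one. -/
theorem norm_teich_add_le (x y : F) :
    ‖((teich ι (x + y) - (teich ι x + teich ι y) : 𝓞_ℂ_[p]) : ℂ_[p])‖ ≤ (p : ℝ)⁻¹ := by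
  have hp := (Fact.out : p.Prime)
  obtain ⟨a, ha, hc⟩ := exists_card_eq_pow p F
  have hpow : ∀ (x : F) (k : ℕ), teich ι x ^ p ^ (a * k) = teich ι x := fun x k => by
    rw [pow_mul, ← hc]
    induction k with
    | zero => simp
    | succ k ih => rw [pow_succ, pow_mul, ih, teich_pow]
  have hd : ‖((teich ι (x + y) - (teich ι x + teich ι y) : 𝓞_ℂ_[p]) : ℂ_[p])‖ < 1 := by
    rw [← residue_eq_zero_iff_norm_lt, map_sub, map_add, residue_teich, residue_teich,
      residue_teich, map_add, sub_self]
  have hppos : (0 : ℝ) < (p : ℝ)⁻¹ := inv_pos.2 (by exact_mod_cast hp.pos)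
  obtain ⟨k, hk⟩ := exists_pow_lt_of_lt_one hppos hd
  have hkle : k ≤ p ^ (a * k) :=
    (Nat.lt_pow_self hp.one_lt).le.trans (Nat.pow_le_pow_right hp.pos (Nat.le_mul_of_pos_left k ha))
  obtain ⟨r, hr⟩ := exists_add_pow_prime_pow_eq hp (teich ι x + teich ι y)
    (teich ι (x + y) - (teich ι x + teich ι y)) (a * k)
  obtain ⟨r', hr'⟩ := exists_add_pow_prime_pow_eq hp (teich ι x) (teich ι y) (a * k)
  rw [add_sub_cancel, hr', hpow, hpow, hpow] at hr
  have heq : teich ι (x + y) - (teich ι x + teich ι y) =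
      (teich ι (x + y) - (teich ι x + teich ι y)) ^ p ^ (a * k) + p * ((teich ι x + teich ι y) *
        (teich ι (x + y) - (teich ι x + teich ι y)) * r + teich ι x * teich ι y * r') := by
    linear_combination hr
  rw [heq, AddMemClass.coe_add]
  refine (IsUltrametricDist.norm_add_le_max _ _).trans (max_le ?_ ?_)
  · rw [SubmonoidClass.coe_pow, norm_pow]
    refine (pow_le_pow_of_le_one (norm_nonneg _) ?_ hkle).trans ?_
    · exact hd.le
    · exact hk.le
  · rw [MulMemClass.coe_mul, norm_mul, SubringClass.coe_natCast, norm_prime]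
    exact mul_le_of_le_one_right hppos.le (norm_le_one_of_padicComplexInt _)

theorem coeff_eq_teich {n : ℕ} {f : MvPolynomial (Fin n) F} {fhat : MvPolynomial (Fin n) 𝓞_ℂ_[p]}
    (h : IsTeichmullerLift ι f fhat) (u : Fin n →₀ ℕ) : fhat.coeff u = teich ι (f.coeff u) := by
  refine (teich_eq ι (h.1 u) ?_).symm
  rw [← MvPolynomial.coeff_map, h.2, MvPolynomial.coeff_map]

end Teichmuller

/-! ### The power series `H_i` -/

theorem pderiv_expand {σ R : Type*} [CommRing R] (i : σ) (m : ℕ)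
    (G : MvPolynomial σ R) : MvPolynomial.pderiv i (MvPolynomial.expand m G) =
      (m : MvPolynomial σ R) * (MvPolynomial.X i ^ (m - 1) *
        MvPolynomial.expand m (MvPolynomial.pderiv i G)) := by
  classical
  induction G using MvPolynomial.induction_on with
  | C a => simp
  | add G G' ih ih' => simp only [map_add, ih, ih', mul_add]
  | mul_X G j ih =>
    rw [map_mul, MvPolynomial.expand_X, MvPolynomial.pderiv_mul, ih, MvPolynomial.pderiv_mul,
      MvPolynomial.pderiv_pow, MvPolynomial.pderiv_X, map_add, map_mul, map_mul,
      MvPolynomial.expand_X]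
    by_cases h : j = i
    · subst h
      simp only [Pi.single_eq_same, map_one]
      ring
    · simp only [Pi.single_eq_of_ne h, map_zero]
      ring

section DworkSeries

variable {p : ℕ} [Fact p.Prime] {n : ℕ}

/-- The coefficient at `x^w` of `g^{τ^l}(x^{p^l})`. -/
def expandCoeff (g : MvPolynomial (Fin n) ℂ_[p]) (l : ℕ) (w : Fin n →₀ ℕ) : ℂ_[p] :=
  (MvPolynomial.expand (p ^ l) (frobTwist l g)).coeff w

theorem coeff_frobTwist (g : MvPolynomial (Fin n) ℂ_[p]) (l : ℕ) (w : Fin n →₀ ℕ) :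
    (frobTwist l g).coeff w = g.coeff w ^ p ^ l := by
  rw [frobTwist, MvPolynomial.coeff_sum]
  simp only [MvPolynomial.coeff_monomial]
  rw [Finset.sum_ite_eq']
  split_ifs with h
  · rfl
  · rw [MvPolynomial.notMem_support_iff.1 h, zero_pow (pow_pos (Fact.out : p.Prime).pos l).ne']

theorem expandCoeff_smul (g : MvPolynomial (Fin n) ℂ_[p]) (l : ℕ) (u : Fin n →₀ ℕ) :
    expandCoeff g l (p ^ l • u) = g.coeff u ^ p ^ l := by
  rw [expandCoeff, MvPolynomial.coeff_expand_smul _ (pow_pos (Fact.out : p.Prime).pos l).ne',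
    coeff_frobTwist]

theorem exists_of_expandCoeff_ne_zero {g : MvPolynomial (Fin n) ℂ_[p]} {l : ℕ}
    {w : Fin n →₀ ℕ} (h : expandCoeff g l w ≠ 0) : ∃ u ∈ g.support, p ^ l • u = w := by
  have h0 := (pow_pos (Fact.out : p.Prime).pos l).ne'
  have h1 := MvPolynomial.mem_support_iff.2 h
  rw [MvPolynomial.support_expand _ h0, Finset.mem_image] at h1
  obtain ⟨u, hu, rfl⟩ := h1
  refine ⟨u, MvPolynomial.mem_support_iff.2 fun hu0 => ?_, rfl⟩
  rw [expandCoeff_smul, hu0, zero_pow h0] at h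
  exact h rfl

theorem coeff_dworkH_eq_finsum (γ : ℂ_[p]) (g : MvPolynomial (Fin n) ℂ_[p]) (i : Fin n)
    (v : Fin n →₀ ℕ) : MvPowerSeries.coeff v (dworkH γ g i) =
      ∑ᶠ l : ℕ, gammaSum γ l * expandCoeff g l (v + Finsupp.single i 1) * (v i + 1) := by
  change (∑ᶠ l : ℕ, _) = _
  refine finsum_congr fun l => ?_
  have h := congrArg (MvPolynomial.coeff v)
    (pderiv_expand i (p ^ l) (frobTwist l g))
  rw [MvPolynomial.coeff_pderiv, ← map_natCast (MvPolynomial.C (σ := Fin n)) (p ^ l),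
    MvPolynomial.coeff_C_mul] at h
  rw [mul_assoc, mul_assoc, expandCoeff, h]
  push_cast
  rfl

/-- A nonzero coefficient requires `p ^ l` to divide `w i`, impossible for `0 < w i ≤ l < p ^ l`. -/
theorem expandCoeff_eq_zero {g : MvPolynomial (Fin n) ℂ_[p]} {l : ℕ} {w : Fin n →₀ ℕ} {i : Fin n}
    (h0 : w i ≠ 0) (hl : w i ≤ l) : expandCoeff g l w = 0 := by
  by_contra h
  obtain ⟨u, -, rfl⟩ := exists_of_expandCoeff_ne_zero h
  have h1 : p ^ l * u i ≤ l := hl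
  have h2 : u i ≠ 0 := fun h2 => h0 (by simp [h2])
  have h3 := Nat.lt_pow_self (n := l) (Fact.out : p.Prime).one_lt
  have h4 := Nat.le_mul_of_pos_right (p ^ l) (Nat.pos_of_ne_zero h2)
  omega

theorem coeff_dworkH (γ : ℂ_[p]) (g : MvPolynomial (Fin n) ℂ_[p]) (i : Fin n)
    (v : Fin n →₀ ℕ) : MvPowerSeries.coeff v (dworkH γ g i) = ∑ l ∈ Finset.range (v i + 1),
      gammaSum γ l * expandCoeff g l (v + Finsupp.single i 1) * (v i + 1) := by
  rw [coeff_dworkH_eq_finsum]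
  refine finsum_eq_sum_of_support_subset _ fun l hl => ?_
  rw [Finset.coe_range, Set.mem_Iio]
  by_contra hl2
  refine hl ?_
  dsimp only
  rw [expandCoeff_eq_zero (i := i) (by simp) (by simpa using hl2), mul_zero, zero_mul]

/-- The potential is `∑ γ_l g^{τ^l}(x^{p^l})`, by the chain rule. It is what makes the operators
`D_i` commute. -/
theorem exists_dworkH_eq_pderiv (γ : ℂ_[p]) (g : MvPolynomial (Fin n) ℂ_[p]) :
    ∃ P : MvPowerSeries (Fin n) ℂ_[p], ∀ i, dworkH γ g i = MvPowerSeries.pderiv ℂ_[p] i P := by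
  let P : MvPowerSeries (Fin n) ℂ_[p] := fun w => ∑ᶠ l : ℕ, gammaSum γ l * expandCoeff g l w
  refine ⟨P, fun i => ?_⟩
  ext v
  rw [MvPowerSeries.coeff_pderiv, coeff_dworkH_eq_finsum]
  exact (finsum_mul _ _).symm

theorem norm_natCast_le_one (m : ℕ) : ‖(m : ℂ_[p])‖ ≤ 1 := by
  simpa using norm_le_one_of_padicComplexInt (p := p) m

theorem norm_natCast_le {l m : ℕ} (h : p ^ l ∣ m) : ‖(m : ℂ_[p])‖ ≤ (p : ℝ)⁻¹ ^ l := by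
  obtain ⟨c, rfl⟩ := h
  rw [Nat.cast_mul, Nat.cast_pow, norm_mul, norm_pow, norm_prime]
  exact mul_le_of_le_one_right (by positivity) (norm_natCast_le_one c)

theorem IsDworkGamma.norm_pow {γ : ℂ_[p]} (hγ : IsDworkGamma γ) :
    ‖γ‖ ^ (p - 1) = (p : ℝ)⁻¹ := by
  have hp := (Fact.out : p.Prime)
  have h1 : ((p - 1 : ℕ) : ℝ) = (p : ℝ) - 1 := by
    rw [Nat.cast_sub hp.one_lt.le, Nat.cast_one]
  have h2 : (p : ℝ) - 1 ≠ 0 := by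
    have : (1 : ℝ) < p := by exact_mod_cast hp.one_lt
    linarith
  rw [hγ.2.2, ← Real.rpow_natCast, ← Real.rpow_mul (by positivity), h1,
    show -(1 / ((p : ℝ) - 1)) * ((p : ℝ) - 1) = -1 by field_simp, Real.rpow_neg_one]

theorem IsDworkGamma.ne_zero {γ : ℂ_[p]} (hγ : IsDworkGamma γ) : γ ≠ 0 := by
  have hp := (Fact.out : p.Prime)
  rw [← norm_pos_iff, hγ.2.2]
  exact Real.rpow_pos_of_pos (by exact_mod_cast hp.pos) _

theorem gammaTerm_norm_antitone {γ : ℂ_[p]} (hγ : IsDworkGamma γ) :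
    Antitone fun i : ℕ => ‖γ ^ p ^ i / (p : ℂ_[p]) ^ i‖ := by
  have hp := (Fact.out : p.Prime)
  have hp0 : (0 : ℝ) < p := by exact_mod_cast hp.pos
  refine antitone_nat_of_succ_le fun i => ?_
  simp only [norm_div, _root_.norm_pow, norm_prime]
  have h1 : p ^ (i + 1) = p ^ i + (p - 1) * p ^ i := by
    rw [← one_add_mul, Nat.add_sub_cancel' hp.one_lt.le, pow_succ, mul_comm]
  rw [h1, pow_add, pow_mul, hγ.norm_pow, inv_pow, inv_pow, inv_pow, div_inv_eq_mul, div_inv_eq_mul,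
    pow_succ, mul_assoc]
  refine mul_le_mul_of_nonneg_left ?_ (by positivity)
  rw [inv_mul_le_iff₀ (by positivity), mul_comm]
  refine mul_le_mul_of_nonneg_right ?_ (by positivity)
  calc (p : ℝ) = (p : ℝ) ^ 1 := (pow_one _).symm
    _ ≤ (p : ℝ) ^ p ^ i := pow_le_pow_right₀ (by exact_mod_cast hp.one_lt.le)
      (Nat.one_le_pow _ _ hp.pos)

/-- The full series vanishes, so the partial sum is minus the tail, whose terms have non-increasing
norms; the first one bounds it. -/
theorem norm_gammaSum_le {γ : ℂ_[p]} (hγ : IsDworkGamma γ) (l : ℕ) :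
    ‖gammaSum γ l‖ ≤ ‖γ‖ ^ p ^ (l + 1) * (p : ℝ) ^ (l + 1) := by
  have h1 := hγ.2.1.summable.sum_add_tsum_nat_add (l + 1)
  rw [hγ.2.1.tsum_eq] at h1
  rw [gammaSum, eq_neg_of_add_eq_zero_left h1, norm_neg]
  refine IsUltrametricDist.norm_tsum_le_of_forall_le_of_nonneg (by positivity) fun j => ?_
  refine (gammaTerm_norm_antitone hγ (Nat.le_add_left (l + 1) j)).trans ?_
  simp only [norm_div, _root_.norm_pow, norm_prime]
  rw [inv_pow, div_inv_eq_mul]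

/-- The `l`-th summand of the coefficient at `x^v` of `t^{δ-1}γ⁻¹ H_i(x/t)`. -/
def scaledTerm (γ t : ℂ_[p]) (δ : ℕ) (g : MvPolynomial (Fin n) ℂ_[p]) (i : Fin n)
    (v : Fin n →₀ ℕ) (l : ℕ) : ℂ_[p] :=
  t ^ (δ - 1) / γ * (gammaSum γ l * expandCoeff g l (v + Finsupp.single i 1) * (v i + 1)) /
    t ^ v.degree

/-- The factor `v i + 1` is divisible by `p ^ l` and leaves one surplus `p` from the bound on `γ_l`,
absorbed by `‖γ‖ ^ (p - 1) = 1 / p`. The degree bound `|v| + 1 ≤ p ^ l δ` controls the negative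
power of `t`. -/
theorem norm_scaledTerm_le {γ t : ℂ_[p]} (hγ : IsDworkGamma γ) (ht0 : t ≠ 0) (ht1 : ‖t‖ ≤ 1)
    {g : MvPolynomial (Fin n) ℂ_[p]} (hg : ∀ u, ‖g.coeff u‖ ≤ 1) {δ : ℕ} (hδ : 1 ≤ δ)
    (hdeg : g.totalDegree ≤ δ) (i : Fin n) (v : Fin n →₀ ℕ) (l : ℕ) :
    ‖scaledTerm γ t δ g i v l‖ ≤ (‖γ‖ ^ p / ‖t‖ ^ δ) ^ (p ^ l - 1) := by
  have hp := (Fact.out : p.Prime)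
  have hp0 : (0 : ℝ) < p := by exact_mod_cast hp.pos
  have hγ0 : 0 < ‖γ‖ := norm_pos_iff.2 hγ.ne_zero
  have hT : 0 < ‖t‖ := norm_pos_iff.2 ht0
  by_cases h : expandCoeff g l (v + Finsupp.single i 1) = 0
  · rw [scaledTerm, h]
    simp only [mul_zero, zero_mul, zero_div, norm_zero]
    positivity
  obtain ⟨u, hu, huv⟩ := exists_of_expandCoeff_ne_zero h
  have hpl : 1 ≤ p ^ l := Nat.one_le_pow _ _ hp.pos
  have hvi : p ^ l ∣ v i + 1 := ⟨u i, by
    have := DFunLike.congr_fun huv i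
    simpa using this.symm⟩
  have hdv : v.degree + 1 ≤ p ^ l * δ := by
    have h1 : v.degree + 1 = p ^ l * u.degree := by
      have := congrArg Finsupp.degree huv
      simpa using this.symm
    rw [h1]
    exact Nat.mul_le_mul_left _ ((MvPolynomial.le_totalDegree hu).trans hdeg)
  have hE : ‖expandCoeff g l (v + Finsupp.single i 1)‖ ≤ 1 := by
    rw [← huv, expandCoeff_smul, norm_pow]
    exact pow_le_one₀ (norm_nonneg _) (hg u)
  have hm : ‖((v i : ℂ_[p]) + 1)‖ ≤ (p : ℝ)⁻¹ ^ l := by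
    exact_mod_cast norm_natCast_le hvi
  have h1 : ‖gammaSum γ l * expandCoeff g l (v + Finsupp.single i 1) * (v i + 1)‖ ≤
      ‖γ‖ * (‖γ‖ ^ p) ^ (p ^ l - 1) := by
    rw [norm_mul, norm_mul]
    calc _ ≤ ‖γ‖ ^ p ^ (l + 1) * (p : ℝ) ^ (l + 1) * 1 * (p : ℝ)⁻¹ ^ l := by
          gcongr
          exact norm_gammaSum_le hγ l
      _ = ‖γ‖ ^ p ^ (l + 1) * p := by
          rw [inv_pow, pow_succ (p : ℝ)]
          field_simp
      _ = _ := by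
          have h2 : p ^ (l + 1) = 1 + (p - 1) + p * (p ^ l - 1) := by
            rw [Nat.add_sub_cancel' hp.one_lt.le, Nat.mul_sub_one, pow_succ']
            have := Nat.le_mul_of_pos_right p (pow_pos hp.pos l)
            omega
          rw [h2, pow_add, pow_add, hγ.norm_pow, pow_mul, pow_one]
          field_simp
  have h3 : ‖t‖ ^ (δ - 1) / ‖t‖ ^ v.degree ≤ 1 / (‖t‖ ^ δ) ^ (p ^ l - 1) := by
    rw [div_le_div_iff₀ (by positivity) (by positivity), one_mul, ← pow_mul, ← pow_add]
    refine pow_le_pow_of_le_one hT.le ht1 ?_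
    rw [Nat.mul_sub_one, mul_comm δ]
    have := Nat.le_mul_of_pos_left δ hpl
    omega
  rw [scaledTerm, norm_div, norm_mul, norm_div, norm_pow, norm_pow, div_pow]
  calc _ ≤ ‖t‖ ^ (δ - 1) / ‖γ‖ * (‖γ‖ * (‖γ‖ ^ p) ^ (p ^ l - 1)) / ‖t‖ ^ v.degree := by
        gcongr
    _ = (‖γ‖ ^ p) ^ (p ^ l - 1) * (‖t‖ ^ (δ - 1) / ‖t‖ ^ v.degree) := by
        field_simp
    _ ≤ (‖γ‖ ^ p) ^ (p ^ l - 1) * (1 / (‖t‖ ^ δ) ^ (p ^ l - 1)) := by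
        gcongr
    _ = _ := by ring

theorem degree_lt_of_scaledTerm_ne_zero {γ t : ℂ_[p]} {g : MvPolynomial (Fin n) ℂ_[p]} {δ : ℕ}
    (hdeg : g.totalDegree ≤ δ) {i : Fin n} {v : Fin n →₀ ℕ} {l : ℕ}
    (h : scaledTerm γ t δ g i v l ≠ 0) : v.degree + 1 ≤ p ^ l * δ := by
  have h0 : expandCoeff g l (v + Finsupp.single i 1) ≠ 0 := fun h0 => h (by simp [scaledTerm, h0])
  obtain ⟨u, hu, huv⟩ := exists_of_expandCoeff_ne_zero h0
  have h1 : v.degree + 1 = p ^ l * u.degree := by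
    have := congrArg Finsupp.degree huv
    simpa using this.symm
  rw [h1]
  exact Nat.mul_le_mul_left _ ((MvPolynomial.le_totalDegree hu).trans hdeg)

/-- The coefficient at `x^v` of `t^{δ-1}γ⁻¹ H_i(x/t)`. -/
def scaledCoeff (γ t : ℂ_[p]) (δ : ℕ) (g : MvPolynomial (Fin n) ℂ_[p]) (i : Fin n)
    (v : Fin n →₀ ℕ) : ℂ_[p] :=
  t ^ (δ - 1) / γ * MvPowerSeries.coeff v (dworkH γ g i) / t ^ v.degree

theorem scaledCoeff_eq_sum (γ t : ℂ_[p]) (δ : ℕ) (g : MvPolynomial (Fin n) ℂ_[p]) (i : Fin n)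
    (v : Fin n →₀ ℕ) :
    scaledCoeff γ t δ g i v = ∑ l ∈ Finset.range (v i + 1), scaledTerm γ t δ g i v l := by
  rw [scaledCoeff, coeff_dworkH, Finset.mul_sum, Finset.sum_div]
  rfl

theorem scaledTerm_zero {γ t : ℂ_[p]} (hγ : γ ≠ 0) (δ : ℕ) (g : MvPolynomial (Fin n) ℂ_[p])
    (i : Fin n) (v : Fin n →₀ ℕ) : scaledTerm γ t δ g i v 0 =
      t ^ (δ - 1) * (MvPolynomial.pderiv i g).coeff v / t ^ v.degree := by
  have h : expandCoeff g 0 (v + Finsupp.single i 1) = g.coeff (v + Finsupp.single i 1) := by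
    have := expandCoeff_smul g 0 (v + Finsupp.single i 1)
    simpa using this
  rw [scaledTerm, h, MvPolynomial.coeff_pderiv]
  simp only [gammaSum, zero_add, Finset.range_one, Finset.sum_singleton, pow_zero, pow_one, div_one]
  field_simp

/-- The bound for the remainder of `scaledCoeff` after its first term. -/
theorem norm_scaledCoeff_sub_le {γ t : ℂ_[p]} (hγ : IsDworkGamma γ) (ht0 : t ≠ 0) (ht1 : ‖t‖ ≤ 1)
    {g : MvPolynomial (Fin n) ℂ_[p]} (hg : ∀ u, ‖g.coeff u‖ ≤ 1) {δ : ℕ} (hδ : 1 ≤ δ)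
    (hdeg : g.totalDegree ≤ δ) (hρ : ‖γ‖ ^ p / ‖t‖ ^ δ ≤ 1) (i : Fin n) (v : Fin n →₀ ℕ) :
    ‖scaledCoeff γ t δ g i v - t ^ (δ - 1) * (MvPolynomial.pderiv i g).coeff v / t ^ v.degree‖ ≤
      (‖γ‖ ^ p / ‖t‖ ^ δ) ^ (p - 1) := by
  rw [scaledCoeff_eq_sum, Finset.sum_range_succ', scaledTerm_zero hγ.ne_zero, add_sub_cancel_right]
  refine IsUltrametricDist.norm_sum_le_of_forall_le_of_nonneg (by positivity) fun l _ => ?_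
  refine (norm_scaledTerm_le hγ ht0 ht1 hg hδ hdeg i v (l + 1)).trans
    (pow_le_pow_of_le_one (by positivity) hρ (Nat.sub_le_sub_right ?_ 1))
  exact Nat.le_self_pow (by omega) p

/-- High degree forces large `l`, so the coefficients of `h_i` tend to zero; with `m = 0` the bound
gives integrality. -/
theorem norm_scaledCoeff_le {γ t : ℂ_[p]} (hγ : IsDworkGamma γ) (ht0 : t ≠ 0) (ht1 : ‖t‖ ≤ 1)
    {g : MvPolynomial (Fin n) ℂ_[p]} (hg : ∀ u, ‖g.coeff u‖ ≤ 1) {δ : ℕ} (hδ : 1 ≤ δ)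
    (hdeg : g.totalDegree ≤ δ) (hρ : ‖γ‖ ^ p / ‖t‖ ^ δ ≤ 1) (i : Fin n) (v : Fin n →₀ ℕ) {m : ℕ}
    (hm : m * δ ≤ v.degree) : ‖scaledCoeff γ t δ g i v‖ ≤ (‖γ‖ ^ p / ‖t‖ ^ δ) ^ m := by
  rw [scaledCoeff_eq_sum]
  refine IsUltrametricDist.norm_sum_le_of_forall_le_of_nonneg (by positivity) fun l _ => ?_
  by_cases h : scaledTerm γ t δ g i v l = 0
  · rw [h, norm_zero]
    positivity
  refine (norm_scaledTerm_le hγ ht0 ht1 hg hδ hdeg i v l).trans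
    (pow_le_pow_of_le_one (by positivity) hρ ?_)
  have h1 := degree_lt_of_scaledTerm_ne_zero hdeg h
  have h2 : m < p ^ l := lt_of_mul_lt_mul_right (show m * δ < p ^ l * δ by omega) (zero_le)
  omega

end DworkSeries

/-! ### The integral model of Dwork's complex -/

section Model

variable {p : ℕ} [Fact p.Prime] {n : ℕ}

theorem scaledCoeff_curl (γ t : ℂ_[p]) (δ : ℕ) (g : MvPolynomial (Fin n) ℂ_[p]) (i j : Fin n)
    (v : Fin n →₀ ℕ) : scaledCoeff γ t δ g j (v + Finsupp.single i 1) * (v i + 1) =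
      scaledCoeff γ t δ g i (v + Finsupp.single j 1) * (v j + 1) := by
  obtain ⟨P, hP⟩ := exists_dworkH_eq_pderiv γ g
  have h := congrArg (MvPowerSeries.coeff v) (pderiv_comm i j P)
  rw [← hP, ← hP, MvPowerSeries.coeff_pderiv, MvPowerSeries.coeff_pderiv] at h
  simp only [scaledCoeff, map_add, Finsupp.degree_single]
  linear_combination t ^ (δ - 1) / γ / t ^ (v.degree + 1) * h

theorem gammaSum_mem {L : IntermediateField ℚ_[p] ℂ_[p]} {γ : ℂ_[p]} (hγ : γ ∈ L) (l : ℕ) :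
    gammaSum γ l ∈ L :=
  L.sum_mem fun _ _ => L.div_mem (pow_mem hγ _) (pow_mem (natCast_mem L p) _)

theorem scaledCoeff_mem {L : IntermediateField ℚ_[p] ℂ_[p]} {γ t : ℂ_[p]} (hγ : γ ∈ L)
    (ht : t ∈ L) {g : MvPolynomial (Fin n) ℂ_[p]} (hg : ∀ u, g.coeff u ∈ L) (δ : ℕ) (i : Fin n)
    (v : Fin n →₀ ℕ) : scaledCoeff γ t δ g i v ∈ L := by
  rw [scaledCoeff, coeff_dworkH]
  refine L.div_mem (L.mul_mem (L.div_mem (pow_mem ht _) hγ) (L.sum_mem fun l _ => ?_))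
    (pow_mem ht _)
  refine L.mul_mem (L.mul_mem (gammaSum_mem hγ l) ?_)
    (L.add_mem (natCast_mem L (v i)) L.one_mem)
  by_cases h : expandCoeff g l (v + Finsupp.single i 1) = 0
  · rw [h]
    exact L.zero_mem
  · obtain ⟨u, -, hu⟩ := exists_of_expandCoeff_ne_zero h
    rw [← hu, expandCoeff_smul]
    exact pow_mem (hg u) _

variable {F : Type*} [Field F] [Finite F] [CharP F p]

theorem exists_dworkModel {f : MvPolynomial (Fin n) F} (hδ : 1 ≤ f.totalDegree) {e : ℕ}
    (L : IntermediateField ℚ_[p] ℂ_[p]) [FiniteDimensional ℚ_[p] L] {γ t : ℂ_[p]}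
    (hγ : IsDworkGamma γ) (hγL : γ ∈ L) (htL : t ∈ L) (ht0 : t ≠ 0) (ht1 : ‖t‖ < 1)
    (hkap : ‖t‖ ^ f.totalDegree < ‖γ‖ * ‖t‖ ^ (e - 1))
    (hrem : (‖γ‖ ^ p) ^ (p - 1) < ‖t‖ ^ (e - 1) * (‖t‖ ^ f.totalDegree) ^ (p - 1))
    (ι : F →+* IsLocalRing.ResidueField 𝓞_ℂ_[p]) {fhat : MvPolynomial (Fin n) 𝓞_ℂ_[p]}
    (hfhat : IsTeichmullerLift ι f fhat) (hL : ∀ z : ℂ_[p], z ^ Nat.card F = z → z ∈ L) :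
    ∃ W : DworkModel f e (integers L), ‖(W.lam : ℂ_[p])‖ < 1 ∧
      (W.kap : ℂ_[p]) = t ^ f.totalDegree / γ ∧
      ∀ i v, ((MvPowerSeries.coeff v (W.h i) : integers L) : ℂ_[p]) =
        scaledCoeff γ t f.totalDegree (fhat.map (𝓞_ℂ_[p]).subtype) i v := by
  have hp := (Fact.out : p.Prime)
  have hγ0 : 0 < ‖γ‖ := norm_pos_iff.2 hγ.ne_zero
  have hT : 0 < ‖t‖ := norm_pos_iff.2 ht0
  set δ := f.totalDegree with hδdef
  set g := fhat.map (𝓞_ℂ_[p]).subtype with hg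
  have hgcoeff : ∀ u, g.coeff u = (teich ι (f.coeff u) : 𝓞_ℂ_[p]) := fun u => by
    rw [hg, MvPolynomial.coeff_map, coeff_eq_teich ι hfhat]
    rfl
  have hteichL : ∀ x, (teich ι x : ℂ_[p]) ∈ L := fun x =>
    hL _ (by exact_mod_cast congrArg Subtype.val (teich_pow ι x))
  have hgL : ∀ u, g.coeff u ∈ L := fun u => by rw [hgcoeff]; exact hteichL _
  have hg1 : ∀ u, ‖g.coeff u‖ ≤ 1 := fun u => by
    rw [hgcoeff]; exact norm_le_one_of_padicComplexInt _
  have hgdeg : g.totalDegree ≤ δ := by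
    refine Finset.sup_mono fun u hu => ?_
    rw [MvPolynomial.mem_support_iff] at hu ⊢
    exact fun h => hu (by rw [hgcoeff, h, teich_zero]; rfl)
  have hρ : ‖γ‖ ^ p / ‖t‖ ^ δ < 1 := by
    rw [div_lt_one (by positivity)]
    refine lt_of_pow_lt_pow_left₀ (p - 1) (by positivity) (hrem.trans_le ?_)
    exact mul_le_of_le_one_left (by positivity) (pow_le_one₀ hT.le ht1.le)
  have hρ2 : (‖γ‖ ^ p / ‖t‖ ^ δ) ^ (p - 1) < ‖t‖ ^ (e - 1) := by
    rwa [div_pow, div_lt_iff₀ (by positivity)]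
  -- Combining both bounds on `b` gives `‖γ‖ ^ p < ‖t‖ ^ δ < ‖γ‖ ‖t‖ ^ (e - 1)`, and `‖γ‖ ^ (p - 1)
  -- = 1 / p`.
  have hpt : (p : ℝ)⁻¹ < ‖t‖ ^ (e - 1) := by
    have h1 : ‖γ‖ ^ p < ‖γ‖ * ‖t‖ ^ (e - 1) :=
      ((div_lt_one (by positivity)).1 hρ).trans hkap
    rw [← mul_pow_sub_one hp.ne_zero, hγ.norm_pow] at h1
    exact lt_of_mul_lt_mul_left h1 hγ0.le
  obtain ⟨lam, hlam0, hlam1, hlam⟩ := exists_uniformizer L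
  have hlampos : 0 < ‖(lam : ℂ_[p])‖ := norm_pos_iff.2 fun h => hlam0 (Subtype.ext h)
  let t' : integers L := ⟨t, htL, ht1.le⟩
  -- A strict norm inequality yields the extra factor `lam`, since `lam` is a uniformizer.
  have hbig : ∀ x : integers L, ‖(x : ℂ_[p])‖ < ‖t‖ ^ (e - 1) → lam * t' ^ (e - 1) ∣ x := by
    intro x hx
    refine (integers_dvd_total hlam x (t' ^ (e - 1))).resolve_left fun h => ?_
    have h2 := integers_dvd_iff.1 h
    rw [SubmonoidClass.coe_pow, norm_pow] at h2
    exact absurd hx (not_lt.2 h2)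
  let θ : F → integers L := fun x => ⟨teich ι x, hteichL x, norm_le_one_of_padicComplexInt _⟩
  have hθ0 : θ 0 = 0 := Subtype.ext (congrArg (fun z : 𝓞_ℂ_[p] => (z : ℂ_[p])) (teich_zero ι))
  have hθ1 : θ 1 = 1 := Subtype.ext (congrArg (fun z : 𝓞_ℂ_[p] => (z : ℂ_[p])) (teich_one ι))
  have hθm : ∀ x y, θ (x * y) = θ x * θ y := fun x y =>
    Subtype.ext (congrArg (fun z : 𝓞_ℂ_[p] => (z : ℂ_[p])) (teich_mul ι x y))
  have hθa : ∀ x y, lam * t' ^ (e - 1) ∣ θ (x + y) - (θ x + θ y) := fun x y =>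
    hbig _ ((norm_teich_add_le ι x y).trans_lt hpt)
  -- Differentiation produces the integers `v i + 1`, which need not be Teichmüller but agree with
  -- their lifts to the required precision.
  have hθn : ∀ m : ℕ, lam * t' ^ (e - 1) ∣ (m : integers L) - θ m := by
    intro m
    induction m with
    | zero => simp [hθ0]
    | succ m ih =>
      have h := dvd_sub ih (hθa m 1)
      rw [hθ1] at h
      push_cast
      convert h using 1
      ring
  let kap : integers L := ⟨t ^ δ / γ, L.div_mem (pow_mem htL _) hγL, by
    rw [norm_div, norm_pow, div_le_one hγ0]
    exact hkap.le.trans (mul_le_of_le_one_right hγ0.le (pow_le_one₀ hT.le ht1.le))⟩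
  have hkapdvd : lam * t' ^ (e - 1) ∣ kap := hbig _ (by
    change ‖t ^ δ / γ‖ < _
    rw [norm_div, norm_pow, div_lt_iff₀ hγ0, mul_comm]
    exact hkap)
  let h : Fin n → MvPowerSeries (Fin n) (integers L) := fun i v =>
    ⟨scaledCoeff γ t δ g i v, scaledCoeff_mem hγL htL hgL δ i v, by
      simpa using norm_scaledCoeff_le hγ ht0 ht1.le hg1 hδ hgdeg hρ.le i v
        (m := 0) (by simp)⟩
  have hh : ∀ i v, ((MvPowerSeries.coeff v (h i) : integers L) : ℂ_[p]) =
      scaledCoeff γ t δ g i v := fun i v => rfl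
  have hcurl : ∀ i j, MvPowerSeries.pderiv (integers L) i (h j) =
      MvPowerSeries.pderiv (integers L) j (h i) := by
    intro i j
    ext v
    rw [MvPowerSeries.coeff_pderiv, MvPowerSeries.coeff_pderiv]
    simpa [hh] using scaledCoeff_curl γ t δ g i j v
  have hnull : ∀ i, h i ∈ nullSeries n lam := by
    intro i k
    obtain ⟨m, hm⟩ := exists_pow_lt_of_lt_one (pow_pos hlampos k) hρ
    refine (expsLE n (m * δ)).finite_toSet.subset fun v hv => ?_
    by_contra hv2
    refine hv (integers_dvd_iff.2 ?_)
    rw [hh, SubmonoidClass.coe_pow, norm_pow]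
    refine (norm_scaledCoeff_le hγ ht0 ht1.le hg1 hδ hgdeg hρ.le i v (m := m) ?_).trans hm.le
    rw [Finset.mem_coe, mem_expsLE, not_le] at hv2
    exact hv2.le
  have happrox : ∀ i v, lam * t' ^ (e - 1) ∣ MvPowerSeries.coeff v (h i) -
      t' ^ (δ - 1 - v.degree) * θ ((MvPolynomial.pderiv i f).coeff v) := by
    intro i v
    have h1 : ((t' ^ (δ - 1 - v.degree) * (θ (f.coeff (v + Finsupp.single i 1)) *
        ((v i + 1 : ℕ) : integers L)) : integers L) : ℂ_[p]) =
        t ^ (δ - 1) * (MvPolynomial.pderiv i g).coeff v / t ^ v.degree := by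
      rw [MvPolynomial.coeff_pderiv, hgcoeff]
      by_cases hv : v.degree ≤ δ - 1
      · have h2 : t ^ (δ - 1) = t ^ (δ - 1 - v.degree) * t ^ v.degree := by
          rw [← pow_add, Nat.sub_add_cancel hv]
        rw [h2]
        simp only [Subring.coe_mul, Subring.coe_pow, Subring.coe_natCast, Nat.cast_add,
          Nat.cast_one, θ, t', Subring.coe_add, Subring.coe_one]
        field_simp
      · have h2 : f.coeff (v + Finsupp.single i 1) = 0 := by
          refine MvPolynomial.coeff_eq_zero_of_totalDegree_lt ?_
          have h3 : (v + Finsupp.single i 1).degree = v.degree + 1 := by simp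
          change δ < (v + Finsupp.single i 1).degree
          omega
        rw [h2, hθ0, teich_zero]
        simp
    have h2 : lam * t' ^ (e - 1) ∣ MvPowerSeries.coeff v (h i) - t' ^ (δ - 1 - v.degree) *
        (θ (f.coeff (v + Finsupp.single i 1)) * ((v i + 1 : ℕ) : integers L)) := by
      refine hbig _ ?_
      rw [AddSubgroupClass.coe_sub, h1, hh]
      exact (norm_scaledCoeff_sub_le hγ ht0 ht1.le hg1 hδ hgdeg hρ.le i v).trans_lt hρ2
    have h3 := (hθn (v i + 1)).mul_left
      (t' ^ (δ - 1 - v.degree) * θ (f.coeff (v + Finsupp.single i 1)))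
    have h4 : θ ((MvPolynomial.pderiv i f).coeff v) =
        θ (f.coeff (v + Finsupp.single i 1)) * θ ((v i + 1 : ℕ) : F) := by
      rw [MvPolynomial.coeff_pderiv, ← hθm]
      push_cast
      rfl
    rw [h4]
    convert dvd_add h2 h3 using 1
    ring
  have := finite_integers_quotient hlam0
  have ht'0 : t' ≠ 0 := fun h => ht0 (congrArg Subtype.val h)
  obtain ⟨d, β, φ, hφ1, hφ2, hφ3⟩ :=
    exists_residue_coordinates (lam := lam) (pow_ne_zero (e - 1) ht'0) hθ0 hθ1 hθm hθa
  exact ⟨{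
    lam := lam
    t := t'
    kap := kap
    h := h
    θ := θ
    d := d
    β := β
    φ := φ
    lam_ne_zero := hlam0
    t_ne_zero := ht'0
    lam_dvd_t := integers_dvd_iff.2 (hlam t htL ht1)
    dvd_total := integers_dvd_total hlam
    separated := integers_separated hlam1
    exists_sum := integers_exists_sum hlam1
    dvd_kap := hkapdvd
    curl := hcurl
    h_null := hnull
    h_approx := happrox
    θ_zero := hθ0
    θ_one := hθ1
    θ_mul := hθm
    θ_add := hθa
    φ_θ_mul := hφ1
    φ_eq_zero := hφ2
    φ_generates := hφ3 }, hlam1, rfl, hh⟩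

end Model

/-! ### From the integral model to Dwork's complex -/

theorem finrank_cohomology_eq_card {K V ι : Type*} [Field K] [AddCommGroup V] [Module K V]
    [Fintype ι] {d : V →ₗ[K] V} {Ω : ℤ → Submodule K V} {k : ℤ} {E : ι → V}
    (hE : ∀ i, E i ∈ Ω k) (hEd : ∀ i, d (E i) = 0)
    (hspan : ∀ ω ∈ Ω k, d ω = 0 → ∃ c : ι → K, ∃ ζ ∈ Ω (k - 1), ω = d ζ + ∑ i, c i • E i)
    (hind : ∀ c : ι → K, ∀ ζ ∈ Ω (k - 1), d ζ = ∑ i, c i • E i → c = 0) :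
    Module.Finite K (Cohomology d Ω k) ∧
      Module.finrank K (Cohomology d Ω k) = Fintype.card ι := by
  let Q := ((Ω (k - 1)).map d).submoduleOf (Ω k ⊓ LinearMap.ker d)
  let E' : ι → ↥(Ω k ⊓ LinearMap.ker d) := fun i => ⟨E i, hE i, hEd i⟩
  let Ψ : (ι → K) →ₗ[K] Cohomology d Ω k := Q.mkQ ∘ₗ Fintype.linearCombination K E'
  have hcoe : ∀ c : ι → K, ((Fintype.linearCombination K E' c : ↥(Ω k ⊓ LinearMap.ker d)) : V) =
      ∑ i, c i • E i := fun c => by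
    rw [Fintype.linearCombination_apply, AddSubmonoidClass.coe_finsetSum]
    rfl
  have hinj : Function.Injective Ψ := by
    rw [injective_iff_map_eq_zero]
    intro c hc
    have h1 : Fintype.linearCombination K E' c ∈ Q := (Submodule.Quotient.mk_eq_zero Q).1 hc
    obtain ⟨ζ, hζ, h2⟩ : ((Fintype.linearCombination K E' c : ↥(Ω k ⊓ LinearMap.ker d)) : V) ∈
      (Ω (k - 1)).map d := h1
    exact hind c ζ hζ (h2.trans (hcoe c))
  have hsurj : Function.Surjective Ψ := by
    intro x
    obtain ⟨⟨ω, hω⟩, rfl⟩ := Q.mkQ_surjective x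
    obtain ⟨c, ζ, hζ, h⟩ := hspan ω hω.1 hω.2
    refine ⟨c, ((Submodule.Quotient.eq Q).2 ?_).symm⟩
    change ω - ((Fintype.linearCombination K E' c : ↥(Ω k ⊓ LinearMap.ker d)) : V) ∈
      (Ω (k - 1)).map d
    rw [hcoe, h, add_sub_cancel_right]
    exact Submodule.mem_map_of_mem hζ
  let eqv := LinearEquiv.ofBijective Ψ ⟨hinj, hsurj⟩
  exact ⟨Module.Finite.equiv eqv, by rw [← eqv.finrank_eq, Module.finrank_fintype_fun_eq_card]⟩

section Transfer

variable {p : ℕ} [Fact p.Prime] {n : ℕ} {L : IntermediateField ℚ_[p] ℂ_[p]}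

/-- The substitution `x ↦ t x` on power series with coefficients in the integers of `L`. -/
def rescaleSeries (n : ℕ) (L : IntermediateField ℚ_[p] ℂ_[p]) (t : ℂ_[p]) :
    MvPowerSeries (Fin n) (integers L) →+ MvPowerSeries (Fin n) ℂ_[p] where
  toFun a := fun u => ((MvPowerSeries.coeff u a : integers L) : ℂ_[p]) * t ^ u.degree
  map_zero' := by
    funext u
    rw [map_zero, ZeroMemClass.coe_zero, zero_mul]
    rfl
  map_add' a b := by
    funext u
    rw [map_add, AddMemClass.coe_add, add_mul]
    rfl

theorem coeff_rescaleSeries (t : ℂ_[p]) (a : MvPowerSeries (Fin n) (integers L))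
    (u : Fin n →₀ ℕ) : MvPowerSeries.coeff u (rescaleSeries n L t a) =
      ((MvPowerSeries.coeff u a : integers L) : ℂ_[p]) * t ^ u.degree := rfl

theorem rescaleSeries_smul (t : ℂ_[p]) (c : integers L)
    (a : MvPowerSeries (Fin n) (integers L)) :
    rescaleSeries n L t (c • a) = (c : ℂ_[p]) • rescaleSeries n L t a := by
  ext u
  rw [coeff_rescaleSeries, map_smul, map_smul, coeff_rescaleSeries, smul_eq_mul, smul_eq_mul,
    MulMemClass.coe_mul, mul_assoc]

theorem rescaleSeries_mul (t : ℂ_[p]) (a b : MvPowerSeries (Fin n) (integers L)) :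
    rescaleSeries n L t (a * b) = rescaleSeries n L t a * rescaleSeries n L t b := by
  classical
  ext u
  rw [coeff_rescaleSeries, MvPowerSeries.coeff_mul, MvPowerSeries.coeff_mul,
    AddSubmonoidClass.coe_finsetSum, Finset.sum_mul]
  refine Finset.sum_congr rfl fun x hx => ?_
  rw [coeff_rescaleSeries, coeff_rescaleSeries, MulMemClass.coe_mul,
    ← Finset.HasAntidiagonal.mem_antidiagonal.1 hx, map_add, pow_add]
  ring

theorem pderiv_rescaleSeries (t : ℂ_[p]) (a : MvPowerSeries (Fin n) (integers L)) (i : Fin n) :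
    MvPowerSeries.pderiv ℂ_[p] i (rescaleSeries n L t a) =
      t • rescaleSeries n L t (MvPowerSeries.pderiv (integers L) i a) := by
  ext u
  rw [MvPowerSeries.coeff_pderiv, coeff_rescaleSeries, map_smul, coeff_rescaleSeries,
    MvPowerSeries.coeff_pderiv, map_add, Finsupp.degree_single]
  push_cast
  rw [smul_eq_mul]
  ring

theorem rescaleSeries_injective {t : ℂ_[p]} (ht : t ≠ 0) :
    Function.Injective (rescaleSeries n L t) := by
  intro a b h
  ext u
  have h1 := congrArg (MvPowerSeries.coeff u) h
  rw [coeff_rescaleSeries, coeff_rescaleSeries] at h1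
  exact mul_right_cancel₀ (pow_ne_zero _ ht) h1

/-- The substitution `x ↦ t x` on the coefficients of forms. -/
def rescaleForm (n : ℕ) (L : IntermediateField ℚ_[p] ℂ_[p]) (t : ℂ_[p]) :
    Forms n (MvPowerSeries (Fin n) (integers L)) →+ Forms n (MvPowerSeries (Fin n) ℂ_[p]) where
  toFun ω S := rescaleSeries n L t (ω S)
  map_zero' := by
    funext S
    exact map_zero _
  map_add' a b := by
    funext S
    exact map_add _ _ _

theorem rescaleForm_apply (t : ℂ_[p]) (ω : Forms n (MvPowerSeries (Fin n) (integers L)))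
    (S : Finset (Fin n)) : rescaleForm n L t ω S = rescaleSeries n L t (ω S) := rfl

theorem rescaleForm_smul (t : ℂ_[p]) (c : integers L)
    (ω : Forms n (MvPowerSeries (Fin n) (integers L))) :
    rescaleForm n L t (c • ω) = (c : ℂ_[p]) • rescaleForm n L t ω := by
  funext S
  exact rescaleSeries_smul t c (ω S)

theorem rescaleForm_injective {t : ℂ_[p]} (ht : t ≠ 0) :
    Function.Injective (rescaleForm n L t) := by
  intro a b h
  funext S
  exact rescaleSeries_injective ht (congrFun h S)

/-- Differentiating `a(t x)` yields a factor `t`. Taking out `γ / t ^ (δ - 1)` normalizes the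
leading term of `H_i` and leaves `κ = t ^ δ / γ` before the derivative. -/
theorem dworkD_rescaleSeries {γ π t : ℂ_[p]} (hγ : γ ≠ 0) (ht : t ≠ 0) (ε : ℤ)
    (g : MvPolynomial (Fin n) ℂ_[p]) {δ : ℕ} (hδ : 1 ≤ δ) {kap : integers L}
    {h : Fin n → MvPowerSeries (Fin n) (integers L)} (hkap : (kap : ℂ_[p]) = t ^ δ / γ)
    (hh : ∀ i v, ((MvPowerSeries.coeff v (h i) : integers L) : ℂ_[p]) = scaledCoeff γ t δ g i v)
    (i : Fin n) (a : MvPowerSeries (Fin n) (integers L)) :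
    dworkD γ π ε g i (rescaleSeries n L t a) =
      (π ^ ε * (γ / t ^ (δ - 1))) • rescaleSeries n L t (twistedDeriv kap h i a) := by
  have h1 : dworkH γ g i = (γ / t ^ (δ - 1)) • rescaleSeries n L t (h i) := by
    ext v
    rw [map_smul, coeff_rescaleSeries, hh, scaledCoeff, smul_eq_mul]
    field_simp
  have h2 : t = γ / t ^ (δ - 1) * (t ^ δ / γ) := by
    have : t ^ δ = t ^ (δ - 1) * t := by rw [← pow_succ, Nat.sub_add_cancel hδ]
    rw [this]
    field_simp
  have h3 : dworkD γ π ε g i (rescaleSeries n L t a) = π ^ ε •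
      (MvPowerSeries.pderiv ℂ_[p] i (rescaleSeries n L t a) +
        dworkH γ g i * rescaleSeries n L t a) := rfl
  rw [h3, pderiv_rescaleSeries, h1, twistedDeriv_apply, map_add, rescaleSeries_smul,
    rescaleSeries_mul, hkap, mul_smul, smul_add (γ / t ^ (δ - 1)),
    smul_smul (γ / t ^ (δ - 1)), ← h2, smul_mul_assoc]

/-! #### Denominators -/

variable {lam : integers L}

theorem exists_pow_mul_le (hlam : ‖(lam : ℂ_[p])‖ < 1) (x : ℂ_[p]) :
    ∃ J : ℕ, ∀ J' ≥ J, ‖(lam : ℂ_[p]) ^ J' * x‖ ≤ 1 := by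
  by_cases hx : x = 0
  · exact ⟨0, fun J' _ => by simp [hx]⟩
  have hx0 : 0 < ‖x‖ := norm_pos_iff.2 hx
  obtain ⟨J, hJ⟩ := exists_pow_lt_of_lt_one (inv_pos.2 hx0) hlam
  refine ⟨J, fun J' hJ' => ?_⟩
  rw [norm_mul, norm_pow, ← inv_inv ‖x‖, ← div_eq_mul_inv, div_le_one (inv_pos.2 hx0)]
  exact (pow_le_pow_of_le_one (norm_nonneg _) hlam.le hJ').trans hJ.le

theorem exists_pow_mul_le_finset (hlam : ‖(lam : ℂ_[p])‖ < 1) {ι : Type*} (s : Finset ι)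
    (x : ι → ℂ_[p]) : ∃ J : ℕ, ∀ i ∈ s, ‖(lam : ℂ_[p]) ^ J * x i‖ ≤ 1 := by
  choose J hJ using fun i => exists_pow_mul_le hlam (x i)
  exact ⟨s.sup J, fun i hi => hJ i _ (Finset.le_sup (f := J) hi)⟩

variable {π t : ℂ_[p]} {N : ℕ}

theorem rescaleSeries_mem_dworkC (hlam : ‖(lam : ℂ_[p])‖ < 1) (ht : t = π ^ N)
    {a : MvPowerSeries (Fin n) (integers L)} (ha : a ∈ nullSeries n lam) :
    rescaleSeries n L t a ∈ dworkC n L π N := by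
  have hL : ∀ x : integers L, (x : ℂ_[p]) ∈ L := fun x => x.2.1
  refine ⟨fun u => ⟨(MvPowerSeries.coeff u a : integers L), hL _⟩, ?_, fun u => ?_⟩
  · rw [Metric.tendsto_nhds]
    intro ε hε
    obtain ⟨k, hk⟩ := exists_pow_lt_of_lt_one hε hlam
    refine (ha k).subset fun u hu hdvd => hu ?_
    simp only [dist_zero_right]
    refine lt_of_le_of_lt ?_ hk
    rw [← norm_pow]
    exact integers_dvd_iff.1 hdvd
  · rw [coeff_rescaleSeries, ht, pow_mul]

/-- All but finitely many `A_u` are already integral, so one power of `lam` clears every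
denominator. -/
theorem exists_rescaleSeries_eq (hlam0 : lam ≠ 0) (hlam : ‖(lam : ℂ_[p])‖ < 1) (ht : t = π ^ N)
    {ξ : MvPowerSeries (Fin n) ℂ_[p]} (hξ : ξ ∈ dworkC n L π N) :
    ∃ J : ℕ, ∃ a ∈ nullSeries n lam, (lam : ℂ_[p]) ^ J • ξ = rescaleSeries n L t a := by
  obtain ⟨B, hB, hξB⟩ := hξ
  have hlampos : 0 < ‖(lam : ℂ_[p])‖ := norm_pos_iff.2 fun h => hlam0 (Subtype.ext h)
  have hfin : ∀ ε > 0, {u | ¬ ‖(B u : ℂ_[p])‖ < ε}.Finite := fun ε hε => by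
    simpa using Metric.tendsto_nhds.1 hB ε hε
  obtain ⟨J, hJ⟩ := exists_pow_mul_le_finset hlam (hfin 1 one_pos).toFinset
    (fun u => (B u : ℂ_[p]))
  have hle : ∀ u, ‖(lam : ℂ_[p]) ^ J * B u‖ ≤ 1 := by
    intro u
    by_cases hu : ‖(B u : ℂ_[p])‖ < 1
    · rw [norm_mul, norm_pow]
      exact mul_le_one₀ (pow_le_one₀ (norm_nonneg _) hlam.le) (norm_nonneg _) hu.le
    · exact hJ u (by simpa using hu)
  let a : MvPowerSeries (Fin n) (integers L) := fun u =>
    ⟨(lam : ℂ_[p]) ^ J * B u, L.mul_mem (pow_mem lam.2.1 J) (B u).2, hle u⟩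
  have ha : ∀ u, ((MvPowerSeries.coeff u a : integers L) : ℂ_[p]) = (lam : ℂ_[p]) ^ J * B u :=
    fun u => rfl
  refine ⟨J, a, fun k => ?_, ?_⟩
  · refine (hfin _ (pow_pos hlampos k)).subset fun u hu hu2 => hu ?_
    rw [integers_dvd_iff, ha, norm_mul, norm_pow, SubmonoidClass.coe_pow, norm_pow]
    exact (mul_le_of_le_one_left (norm_nonneg _) (pow_le_one₀ (norm_nonneg _) hlam.le)).trans
      hu2.le
  · ext u
    rw [map_smul, coeff_rescaleSeries, ha, hξB, ht, pow_mul, smul_eq_mul, mul_assoc]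

theorem rescaleForm_mem (hlam : ‖(lam : ℂ_[p])‖ < 1) (ht : t = π ^ N) {k : ℤ}
    {ω : Forms n (MvPowerSeries (Fin n) (integers L))}
    (hω : ω ∈ formsOfDegree n (nullSeries n lam) k) :
    rescaleForm n L t ω ∈ formsOfDegree n (dworkC n L π N) k := by
  rw [mem_formsOfDegree] at hω ⊢
  refine ⟨fun S => rescaleSeries_mem_dworkC hlam ht (hω.1 S), fun S hS => ?_⟩
  rw [rescaleForm_apply, hω.2 S hS, map_zero]

theorem exists_rescaleForm_eq (hlam0 : lam ≠ 0) (hlam : ‖(lam : ℂ_[p])‖ < 1) (ht : t = π ^ N)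
    (ht0 : t ≠ 0) {k : ℤ} {ω : Forms n (MvPowerSeries (Fin n) ℂ_[p])}
    (hω : ω ∈ formsOfDegree n (dworkC n L π N) k) :
    ∃ J : ℕ, ∃ η ∈ formsOfDegree n (nullSeries n lam) k,
      (lam : ℂ_[p]) ^ J • ω = rescaleForm n L t η := by
  rw [mem_formsOfDegree] at hω
  choose J a ha h using fun S => exists_rescaleSeries_eq hlam0 hlam ht (hω.1 S)
  let η : Forms n (MvPowerSeries (Fin n) (integers L)) := fun S =>
    lam ^ (Finset.univ.sup J - J S) • a S
  have hη : (lam : ℂ_[p]) ^ Finset.univ.sup J • ω = rescaleForm n L t η := by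
    funext S
    rw [rescaleForm_apply, rescaleSeries_smul, ← h, smul_smul, SubmonoidClass.coe_pow, ← pow_add,
      Nat.sub_add_cancel (Finset.le_sup (Finset.mem_univ S))]
    rfl
  refine ⟨Finset.univ.sup J, η, mem_formsOfDegree.2
    ⟨fun S => Submodule.smul_mem _ _ (ha S), fun S hS => ?_⟩, hη⟩
  refine rescaleSeries_injective ht0 ?_
  rw [← rescaleForm_apply, ← hη, map_zero, Pi.smul_apply, hω.2 S hS, smul_zero]

/-! #### Cohomology -/

variable {F : Type*} [Field F] {f : MvPolynomial (Fin n) F} {e : ℕ}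
  (W : DworkModel f e (integers L))
  {D : Fin n → MvPowerSeries (Fin n) ℂ_[p] →ₗ[ℂ_[p]] MvPowerSeries (Fin n) ℂ_[p]} {u₀ : ℂ_[p]}

theorem formsDiff_rescaleForm
    (hD : ∀ i a, D i (rescaleSeries n L t a) =
      u₀ • rescaleSeries n L t (twistedDeriv W.kap W.h i a))
    (ω : Forms n (MvPowerSeries (Fin n) (integers L))) :
    formsDiff D (rescaleForm n L t ω) = u₀ • rescaleForm n L t (W.diff ω) := by
  funext S
  rw [Pi.smul_apply, rescaleForm_apply, DworkModel.diff, formsDiff_apply, formsDiff_apply, map_sum,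
    Finset.smul_sum]
  refine Finset.sum_congr rfl fun i _ => ?_
  rw [map_zsmul, rescaleForm_apply, hD, smul_comm]

theorem smul_mem_formsOfDegree {c : ℂ_[p]} (hc : c ∈ L) {k : ℤ}
    {ω : Forms n (MvPowerSeries (Fin n) ℂ_[p])} (hω : ω ∈ formsOfDegree n (dworkC n L π N) k) :
    c • ω ∈ formsOfDegree n (dworkC n L π N) k :=
  Submodule.smul_mem _ (⟨c, hc⟩ : L) hω

variable {W}

theorem subsingleton_cohomology (hlam : ‖(W.lam : ℂ_[p])‖ < 1) (ht : t = π ^ N) (ht0 : t ≠ 0)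
    (hu₀ : u₀ ≠ 0) (hu₀L : u₀ ∈ L)
    (hD : ∀ i a, D i (rescaleSeries n L t a) =
      u₀ • rescaleSeries n L t (twistedDeriv W.kap W.h i a))
    (he : 1 ≤ e) (hδ : 1 ≤ f.totalDegree) {m : ℤ}
    (hE : ∀ r s : ℤ, r + s = m → Subsingleton (WeightE f e r s)) :
    Subsingleton (Cohomology ((formsDiff D).restrictScalars L)
      (formsOfDegree n (dworkC n L π N)) m) := by
  rw [Submodule.Quotient.subsingleton_iff, eq_top_iff]
  rintro ⟨ω, hω, hωD⟩ -
  change ω ∈ Submodule.map _ _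
  have hωD' : formsDiff D ω = 0 := hωD
  have hlam0 : (W.lam : ℂ_[p]) ≠ 0 := fun h => W.lam_ne_zero (Subtype.ext h)
  have hWt0 : (W.t : ℂ_[p]) ≠ 0 := fun h => W.t_ne_zero (Subtype.ext h)
  obtain ⟨J, η, hη, hωη⟩ := exists_rescaleForm_eq W.lam_ne_zero hlam ht ht0 hω
  have hd : W.diff η = 0 := by
    refine rescaleForm_injective ht0 ?_
    have h1 := formsDiff_rescaleForm W hD η
    rw [← hωη, map_smul, hωD', smul_zero] at h1
    rw [map_zero]
    exact (smul_eq_zero.1 h1.symm).resolve_left hu₀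
  obtain ⟨ζ, hζ, hζη⟩ := W.exists_primitive he hδ hE hη hd
  have h2 := congrArg (rescaleForm n L t) hζη
  rw [rescaleForm_smul, ← hωη] at h2
  have h3 := formsDiff_rescaleForm W hD ζ
  rw [← h2, smul_smul, smul_smul] at h3
  -- This scalar collects the operator normalization, the loss `t ^ (e - 1)` and the cleared
  -- denominators; all are invertible in `L`.
  have hc : u₀ * (W.t ^ (e - 1) : integers L) * (W.lam : ℂ_[p]) ^ J ≠ 0 := by
    rw [SubmonoidClass.coe_pow]
    exact mul_ne_zero (mul_ne_zero hu₀ (pow_ne_zero _ hWt0)) (pow_ne_zero _ hlam0)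
  refine ⟨(u₀ * (W.t ^ (e - 1) : integers L) * (W.lam : ℂ_[p]) ^ J)⁻¹ • rescaleForm n L t ζ,
    smul_mem_formsOfDegree (L.inv_mem (L.mul_mem (L.mul_mem hu₀L (W.t ^ (e - 1)).2.1)
      (pow_mem W.lam.2.1 J))) (rescaleForm_mem hlam ht hζ), ?_⟩
  change formsDiff D (_ • _) = ω
  rw [map_smul, h3, smul_smul, inv_mul_cancel₀ hc, one_smul]

theorem formsDiff_eq_zero_of_top {ω : Forms n (MvPowerSeries (Fin n) ℂ_[p])}
    (hω : IsHomogForm (n : ℤ) ω) : formsDiff D ω = 0 := by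
  funext S
  refine hω.formsDiff D S fun h => ?_
  have := Finset.card_le_univ S
  rw [Fintype.card_fin] at this
  omega

theorem finrank_cohomology (hlam : ‖(W.lam : ℂ_[p])‖ < 1) (ht : t = π ^ N) (ht0 : t ≠ 0)
    (hu₀ : u₀ ≠ 0) (hu₀L : u₀ ∈ L)
    (hD : ∀ i a, D i (rescaleSeries n L t a) =
      u₀ • rescaleSeries n L t (twistedDeriv W.kap W.h i a))
    (he : 1 ≤ e) (hδ : 1 ≤ f.totalDegree)
    (hE : ∀ r s : ℤ, r + s = (n : ℤ) - 1 → Subsingleton (WeightE f e r s))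
    {U : Finset (Fin n →₀ ℕ)} (hU : IsAdaptedBasis f U) :
    Module.Finite L (Cohomology ((formsDiff D).restrictScalars L)
      (formsOfDegree n (dworkC n L π N)) n) ∧
    Module.finrank L (Cohomology ((formsDiff D).restrictScalars L)
      (formsOfDegree n (dworkC n L π N)) n) = U.card := by
  have hlam0 : (W.lam : ℂ_[p]) ≠ 0 := fun h => W.lam_ne_zero (Subtype.ext h)
  have hWt0 : (W.t : ℂ_[p]) ≠ 0 := fun h => W.t_ne_zero (Subtype.ext h)
  have hmem := fun u => rescaleForm_mem (L := L) hlam ht (W.topForm_mem_nullForms u)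
  have hsum : ∀ c : (Fin n →₀ ℕ) → integers L, rescaleForm n L t (∑ u ∈ U, c u • topForm u) =
      ∑ u : U, (c u : ℂ_[p]) • rescaleForm n L t (topForm (u : Fin n →₀ ℕ)) := fun c => by
    rw [map_sum, ← Finset.sum_coe_sort]
    simp only [rescaleForm_smul]
  rw [← Fintype.card_coe U]
  refine finrank_cohomology_eq_card
    (E := fun u : U => rescaleForm n L t (topForm (u : Fin n →₀ ℕ))) (fun u => hmem u)
    (fun u => formsDiff_eq_zero_of_top (mem_formsOfDegree.1 (hmem u)).2)
    (fun ω hω _ => ?_) (fun c ω hω hωc => ?_)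
  · obtain ⟨J, η, hη, hωη⟩ := exists_rescaleForm_eq W.lam_ne_zero hlam ht ht0 hω
    obtain ⟨ζ, hζ, c, hc⟩ := W.exists_reduction he hδ hE hU hη
    have h1 := congrArg (rescaleForm n L t) hc
    rw [map_add, rescaleForm_smul, rescaleForm_smul, ← hωη, hsum] at h1
    have h2 := formsDiff_rescaleForm W hD ζ
    have hlamJ : (W.lam : ℂ_[p]) ^ J ≠ 0 := pow_ne_zero _ hlam0
    have hT : ((W.t ^ (e - 1) : integers L) : ℂ_[p]) ≠ 0 := by
      rw [SubmonoidClass.coe_pow]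
      exact pow_ne_zero _ hWt0
    have hTL : ((W.t ^ (e - 1) : integers L) : ℂ_[p]) ∈ L := (W.t ^ (e - 1)).2.1
    have hlamL : (W.lam : ℂ_[p]) ^ J ∈ L := pow_mem W.lam.2.1 J
    generalize ((W.t ^ (e - 1) : integers L) : ℂ_[p]) = T at h1 hT hTL
    generalize (W.lam : ℂ_[p]) ^ J = l at h1 hlamJ hlamL
    have h4 : ∑ u : U, (⟨l⁻¹ * c u, L.mul_mem (L.inv_mem hlamL) (c u).2.1⟩ : L) •
        rescaleForm n L t (topForm (u : Fin n →₀ ℕ)) =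
        l⁻¹ • ∑ u : U, (c u : ℂ_[p]) • rescaleForm n L t (topForm (u : Fin n →₀ ℕ)) := by
      rw [Finset.smul_sum]
      exact Finset.sum_congr rfl fun u _ => mul_smul l⁻¹ (c u : ℂ_[p]) _
    refine ⟨fun u => ⟨l⁻¹ * c u, L.mul_mem (L.inv_mem hlamL) (c u).2.1⟩,
      (u₀ * T * l)⁻¹ • rescaleForm n L t ζ,
      smul_mem_formsOfDegree (L.inv_mem (L.mul_mem (L.mul_mem hu₀L hTL) hlamL))
        (rescaleForm_mem hlam ht hζ), ?_⟩
    rw [h4, LinearMap.restrictScalars_apply, map_smul, h2, smul_smul,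
      ← inv_smul_smul₀ (mul_ne_zero hT hlamJ) ω, mul_smul T, h1, smul_add, smul_smul (T * l)⁻¹]
    congr 2 <;> field_simp
  · obtain ⟨J, η, hη, hωη⟩ := exists_rescaleForm_eq W.lam_ne_zero hlam ht ht0 hω
    obtain ⟨J₁, hJ₁⟩ := exists_pow_mul_le_finset hlam Finset.univ
      (fun u : U => (c u : ℂ_[p]))
    obtain ⟨J₂, hJ₂⟩ := exists_pow_mul_le hlam u₀⁻¹
    have hωc' : formsDiff D ω =
      ∑ u : U, (c u : ℂ_[p]) • rescaleForm n L t (topForm (u : Fin n →₀ ℕ)) := hωc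
    classical
    let c' : (Fin n →₀ ℕ) → integers L := fun u => if h : u ∈ U then
      ⟨(W.lam : ℂ_[p]) ^ J₁ * c ⟨u, h⟩, L.mul_mem (pow_mem W.lam.2.1 _) (c ⟨u, h⟩).2,
        hJ₁ ⟨u, h⟩ (Finset.mem_univ _)⟩ else 0
    have hc' : ∀ u : U, ((c' u : integers L) : ℂ_[p]) = (W.lam : ℂ_[p]) ^ J₁ * c u := fun u => by
      simp only [c', dif_pos u.2]
    -- Independence in the model allows any nonzero integral factor, so `u₀⁻¹` and the coefficients
    -- are made integral separately.
    let y : integers L := ⟨(W.lam : ℂ_[p]) ^ J₂ * u₀⁻¹,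
      L.mul_mem (pow_mem W.lam.2.1 _) (L.inv_mem hu₀L), hJ₂ J₂ le_rfl⟩
    have hy : y * W.lam ^ J ≠ 0 := by
      refine mul_ne_zero (fun h => ?_) (pow_ne_zero _ W.lam_ne_zero)
      exact mul_ne_zero (pow_ne_zero J₂ hlam0) (inv_ne_zero hu₀) (congrArg Subtype.val h)
    have key : W.diff (W.lam ^ (J₁ + J₂) • η) = (y * W.lam ^ J) • ∑ u ∈ U, c' u • topForm u := by
      refine rescaleForm_injective ht0 ?_
      have h1 := formsDiff_rescaleForm W hD η
      rw [← hωη, map_smul, hωc'] at h1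
      rw [map_smul, rescaleForm_smul, rescaleForm_smul, hsum]
      simp only [hc', mul_smul]
      rw [← Finset.smul_sum, ← inv_smul_smul₀ hu₀ (rescaleForm n L t (W.diff η)), ← h1, smul_smul,
        smul_smul, smul_smul]
      congr 1
      simp only [MulMemClass.coe_mul, SubmonoidClass.coe_pow, y]
      ring
    funext u
    have h0 := W.eq_zero_of_smul_exact he hδ hE hU hy (Submodule.smul_mem _ _ hη) key u u.2
    have h1 := hc' u
    rw [h0] at h1
    exact Subtype.ext ((mul_eq_zero.1 h1.symm).resolve_left (pow_ne_zero _ hlam0))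

end Transfer

/-! ### Finiteness of the coefficient field over `ℚ_p` -/

section Fields

variable {p : ℕ} [Fact p.Prime]

theorem finiteDimensional_adjoin_of_aeval_eq_zero {P : Polynomial ℚ_[p]} (hP : P.Monic)
    {S : Set ℂ_[p]} (hS : ∀ x ∈ S, Polynomial.aeval x P = 0) :
    FiniteDimensional ℚ_[p] (IntermediateField.adjoin ℚ_[p] S) := by
  have : Finite S := ((P.rootSet ℂ_[p]).toFinite.subset fun x hx =>
    (Polynomial.mem_rootSet_of_ne hP.ne_zero).2 (hS x hx)).to_subtype
  exact IntermediateField.finiteDimensional_adjoin fun x hx => ⟨P, hP, hS x hx⟩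

theorem finiteDimensional_omega1 : FiniteDimensional ℚ_[p] (Omega1 p) :=
  finiteDimensional_adjoin_of_aeval_eq_zero
    (Polynomial.monic_X_pow_sub_C (1 : ℚ_[p]) (Fact.out : p.Prime).ne_zero) fun x hx => by
      have hx' : x ^ p = 1 := hx
      simp [hx']

theorem finiteDimensional_unramified {q : ℕ} (hq : 1 < q) :
    FiniteDimensional ℚ_[p] (unramified p q) := by
  have hdeg : (Polynomial.X : Polynomial ℚ_[p]).degree < (q : WithBot ℕ) := by
    rw [Polynomial.degree_X]
    exact_mod_cast hq
  refine finiteDimensional_adjoin_of_aeval_eq_zero (Polynomial.monic_X_pow_sub hdeg) fun x hx => ?_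
  have hx' : x ^ q = x := hx
  simp [hx']

theorem finiteDimensional_omegaTilde0 {q : ℕ} (hq : 1 < q) {π : ℂ_[p]} {m : ℕ} (hm : m ≠ 0)
    (hπ : π ^ m = p) : FiniteDimensional ℚ_[p] (OmegaTilde0 p q π) := by
  have := finiteDimensional_omega1 (p := p)
  have := finiteDimensional_unramified (p := p) hq
  have : FiniteDimensional ℚ_[p] (IntermediateField.adjoin ℚ_[p] {π}) :=
    IntermediateField.adjoin.finiteDimensional
      ⟨_, Polynomial.monic_X_pow_sub_C (p : ℚ_[p]) hm, by simp [hπ]⟩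
  rw [OmegaTilde0]
  infer_instance

end Fields

theorem finite_jacobian_of_vanishing {n : ℕ} {k : Type*} [Field k] {f : MvPolynomial (Fin n) k}
    {e : ℕ} (hδ : 1 ≤ f.totalDegree)
    (h : ∀ r s : ℤ, r + s ≠ n → Subsingleton (WeightE f e r s)) :
    Module.Finite k (MvPolynomial (Fin n) k ⧸ jacobianIdeal f) :=
  finite_quotient_of_koszulExact (koszulExact_of_vanishing hδ h)

/-- Base change preserves dimension, so the decomposition over the algebraic closure computes the
dimension over `k`. -/
theorem milnor_of_finite_jacobian {n : ℕ} {k : Type*} [Field k] (f : MvPolynomial (Fin n) k)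
    [Module.Finite k (MvPolynomial (Fin n) k ⧸ jacobianIdeal f)] :
    (criticalPoints (geom f)).Finite ∧
    (∀ P ∈ criticalPoints (geom f),
      Module.Finite (AlgebraicClosure k) (MilnorAlgebra (geom f) P)) ∧
    sumMilnorNumbers f = Module.finrank k (MvPolynomial (Fin n) k ⧸ jacobianIdeal f) := by
  let eqv := jacobianBaseChange f (AlgebraicClosure k)
  have : Module.Finite (AlgebraicClosure k)
      (MvPolynomial (Fin n) (AlgebraicClosure k) ⧸ jacobianIdeal (geom f)) :=
    Module.Finite.equiv eqv
  obtain ⟨h1, h2, h3⟩ := finite_criticalPoints_and_sum (geom f)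
  refine ⟨h1, h2, ?_⟩
  rw [sumMilnorNumbers, h3]
  exact eqv.finrank_eq.symm.trans Module.finrank_baseChange

/-! ### The bounds on `b` as inequalities of norms -/

section Parameters

variable {p : ℕ} [Fact p.Prime]

theorem parameter_bounds {δ e M N : ℕ} {b : ℚ} (he₁ : 1 ≤ e) (he₂ : e ≤ δ)
    (hb₁ : (δ : ℚ) / (((p : ℚ) - 1) * ((δ : ℚ) - e + 1)) < b)
    (hb₂ : b < (p : ℚ) * δ / (((p : ℚ) - 1) * δ + e - 1)) (hM : 0 < M)
    (hN : (N : ℚ) = M * b) (hMδ : p * (p - 1) ∣ M * δ) {π γ : ℂ_[p]} (hπ : π ^ (M * δ) = p)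
    (hγ : IsDworkGamma γ) :
    ‖π ^ N‖ < 1 ∧ ‖π ^ N‖ ^ δ < ‖γ‖ * ‖π ^ N‖ ^ (e - 1) ∧
      (‖γ‖ ^ p) ^ (p - 1) < ‖π ^ N‖ ^ (e - 1) * (‖π ^ N‖ ^ δ) ^ (p - 1) := by
  have hp := (Fact.out : p.Prime)
  have hp1 : (1 : ℚ) < p := by exact_mod_cast hp.one_lt
  have hδ0 : (0 : ℚ) < δ := by exact_mod_cast (he₁.trans he₂)
  have he₁' : (1 : ℚ) ≤ e := by exact_mod_cast he₁
  have he₂' : (e : ℚ) ≤ δ := by exact_mod_cast he₂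
  have hM' : (0 : ℚ) < M := by exact_mod_cast hM
  have hp1' : (0 : ℚ) < (p : ℚ) - 1 := by linarith
  have hd1 : (0 : ℚ) < ((p : ℚ) - 1) * ((δ : ℚ) - e + 1) := mul_pos hp1' (by linarith)
  have hd2 : (0 : ℚ) < ((p : ℚ) - 1) * δ + e - 1 := by
    have := mul_pos hp1' hδ0
    linarith
  have hb0 : 0 < b := (div_pos hδ0 hd1).trans hb₁
  have hN0 : 0 < N := by
    have : (0 : ℚ) < N := hN ▸ mul_pos hM' hb0
    exact_mod_cast this
  rw [div_lt_iff₀ hd1] at hb₁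
  rw [lt_div_iff₀ hd2] at hb₂
  -- With `m = M δ / (p - 1)`, the norms of `γ` and `t` are `‖π‖ ^ m` and `‖π‖ ^ N`, so both
  -- conditions become inequalities between integer exponents.
  obtain ⟨m, hm⟩ := (dvd_mul_left (p - 1) p).trans hMδ
  have hmQ : (M : ℚ) * δ = ((p : ℚ) - 1) * m := by
    have := congrArg (Nat.cast : ℕ → ℚ) hm
    rwa [Nat.cast_mul, Nat.cast_mul, Nat.cast_sub hp.one_lt.le, Nat.cast_one] at this
  -- The lower bound on `b`, multiplied by `M`.
  have h1 : m + N * (e - 1) < N * δ := by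
    have h2 : (m : ℚ) + N * ((e : ℚ) - 1) < N * δ := by
      refine lt_of_mul_lt_mul_left ?_ hp1'.le
      have := mul_lt_mul_of_pos_left hb₁ hM'
      rw [hN]
      linarith
    have h3 : ((m + N * (e - 1) : ℕ) : ℚ) < ((N * δ : ℕ) : ℚ) := by
      push_cast [he₁]
      exact h2
    exact_mod_cast h3
  -- The upper bound on `b`, multiplied by `M`, with `M δ = (p - 1) m`.
  have h2 : N * (e - 1) + N * δ * (p - 1) < m * p * (p - 1) := by
    have h2 : (N : ℚ) * ((e : ℚ) - 1) + N * δ * ((p : ℚ) - 1) < m * p * ((p : ℚ) - 1) := by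
      have := mul_lt_mul_of_pos_left hb₂ hM'
      rw [hN]
      have h4 : (m : ℚ) * p * ((p : ℚ) - 1) = M * (p * δ) := by linear_combination (-(p : ℚ)) * hmQ
      rw [h4]
      linarith
    have h3 : ((N * (e - 1) + N * δ * (p - 1) : ℕ) : ℚ) < ((m * p * (p - 1) : ℕ) : ℚ) := by
      push_cast [he₁, hp.one_lt.le]
      exact h2
    exact_mod_cast h3
  have hpR : (1 : ℝ) < p := by exact_mod_cast hp.one_lt
  have hr : ‖π‖ ^ (M * δ) = (p : ℝ)⁻¹ := by rw [← norm_pow, hπ, norm_prime]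
  have hMδ0 : M * δ ≠ 0 := (Nat.mul_pos hM (he₁.trans he₂)).ne'
  have hr0 : 0 < ‖π‖ := by
    refine (norm_nonneg π).lt_of_ne fun h => ?_
    rw [← h, zero_pow hMδ0] at hr
    have : (0 : ℝ) < (p : ℝ)⁻¹ := by positivity
    linarith
  have hr1 : ‖π‖ < 1 := by
    by_contra! h
    have := one_le_pow₀ h (n := M * δ)
    rw [hr] at this
    exact absurd (inv_lt_one_of_one_lt₀ hpR) (not_lt.2 this)
  have hg : ‖γ‖ = ‖π‖ ^ m := by
    refine (pow_left_inj₀ (norm_nonneg γ) (by positivity) (Nat.sub_pos_of_lt hp.one_lt).ne').1 ?_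
    rw [hγ.norm_pow, ← hr, hm, ← pow_mul, mul_comm m]
  rw [norm_pow, hg]
  refine ⟨pow_lt_one₀ hr0.le hr1 hN0.ne', ?_, ?_⟩
  · rw [← pow_mul, ← pow_mul, ← pow_add]
    exact pow_lt_pow_right_of_lt_one₀ hr0 hr1 h1
  · simp only [← pow_mul, ← pow_add]
    exact pow_lt_pow_right_of_lt_one₀ hr0 hr1 h2

end Parameters

end ExpSum

end

/-! ### The main theorem -/

theorem theorem1p13 (p : ℕ) [Fact p.Prime] {F : Type*} [Field F] [Finite F] [CharP F p]
    (n : ℕ) (f : MvPolynomial (Fin n) F) (hδ : 1 ≤ f.totalDegree)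
    -- the page of the spectral sequence and the parameter `b`
    (e : ℕ) (he₁ : 1 ≤ e) (he₂ : e ≤ f.totalDegree) (b : ℚ)
    (hb₁ : (f.totalDegree : ℚ) / (((p : ℚ) - 1) * ((f.totalDegree : ℚ) - e + 1)) < b)
    (hb₂ : b < (p : ℚ) * f.totalDegree / (((p : ℚ) - 1) * f.totalDegree + e - 1))
    -- the choices in the construction of Dwork's complex: `N = M * b`
    (M N : ℕ) (hM : 0 < M) (hN : (N : ℚ) = M * b) (hpN : p ∣ N)
    (hMδ : p * (p - 1) ∣ M * f.totalDegree)
    (π : ℂ_[p]) (hπ : π ^ (M * f.totalDegree) = p)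
    (γ : ℂ_[p]) (hγ : ExpSum.IsDworkGamma γ)
    (ι : F →+* IsLocalRing.ResidueField 𝓞_ℂ_[p])
    (fhat : MvPolynomial (Fin n) 𝓞_ℂ_[p]) (hfhat : ExpSum.IsTeichmullerLift ι f fhat) :
    (∀ m : ℤ, (∀ r s : ℤ, r + s = m → Subsingleton (ExpSum.WeightE f e r s)) →
      Subsingleton (ExpSum.DworkCohomology (ExpSum.OmegaTilde0 p (Nat.card F) π)
        γ π M N f.totalDegree fhat m)) ∧
    ((∀ r s : ℤ, r + s ≠ n → Subsingleton (ExpSum.WeightE f e r s)) →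
      (ExpSum.criticalPoints (ExpSum.geom f)).Finite ∧
      (∀ P ∈ ExpSum.criticalPoints (ExpSum.geom f),
        Module.Finite (AlgebraicClosure F) (ExpSum.MilnorAlgebra (ExpSum.geom f) P)) ∧
      Module.Finite (ExpSum.OmegaTilde0 p (Nat.card F) π)
        (ExpSum.DworkCohomology (ExpSum.OmegaTilde0 p (Nat.card F) π)
          γ π M N f.totalDegree fhat n) ∧
      Module.finrank (ExpSum.OmegaTilde0 p (Nat.card F) π)
        (ExpSum.DworkCohomology (ExpSum.OmegaTilde0 p (Nat.card F) π)
          γ π M N f.totalDegree fhat n) = ExpSum.sumMilnorNumbers f) := by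
  have hp := (Fact.out : p.Prime)
  set L := ExpSum.OmegaTilde0 p (Nat.card F) π with hL
  set t := π ^ N with ht
  have hMδ0 : M * f.totalDegree ≠ 0 := (Nat.mul_pos hM hδ).ne'
  have hfinL : FiniteDimensional ℚ_[p] L :=
    ExpSum.finiteDimensional_omegaTilde0 (Finite.one_lt_card (α := F)) hMδ0 hπ
  have hπ0 : π ≠ 0 := fun h => by
    rw [h, zero_pow hMδ0] at hπ
    exact hp.ne_zero (by exact_mod_cast hπ.symm)
  have ht0 : t ≠ 0 := pow_ne_zero _ hπ0
  have hπL : π ∈ L :=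
    (le_sup_right : _ ≤ L) (IntermediateField.subset_adjoin _ _ (Set.mem_singleton π))
  have htL : t ∈ L := pow_mem hπL N
  have hγL : γ ∈ L := (le_sup_left.trans' le_sup_right : ExpSum.Omega1 p ≤ L) hγ.1
  have hzL : ∀ z : ℂ_[p], z ^ Nat.card F = z → z ∈ L := fun z hz =>
    (le_sup_left.trans' le_sup_left : ExpSum.unramified p (Nat.card F) ≤ L)
      (IntermediateField.subset_adjoin _ _ hz)
  obtain ⟨ht1, hkap, hrem⟩ := ExpSum.parameter_bounds he₁ he₂ hb₁ hb₂ hM hN hMδ hπ hγ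
  obtain ⟨W, hlam, hWkap, hWh⟩ := ExpSum.exists_dworkModel hδ (e := e) L hγ hγL htL ht0 ht1 hkap
    hrem ι hfhat hzL
  have hD := ExpSum.dworkD_rescaleSeries (π := π) hγ.ne_zero ht0
    ((N : ℤ) * ((f.totalDegree : ℤ) - 1) - ((M * f.totalDegree / (p - 1) : ℕ) : ℤ)) _ hδ hWkap hWh
  have hu₀ : π ^ ((N : ℤ) * ((f.totalDegree : ℤ) - 1) -
      ((M * f.totalDegree / (p - 1) : ℕ) : ℤ)) * (γ / t ^ (f.totalDegree - 1)) ≠ 0 :=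
    mul_ne_zero (zpow_ne_zero _ hπ0) (div_ne_zero hγ.ne_zero (pow_ne_zero _ ht0))
  have hu₀L : π ^ ((N : ℤ) * ((f.totalDegree : ℤ) - 1) -
      ((M * f.totalDegree / (p - 1) : ℕ) : ℤ)) * (γ / t ^ (f.totalDegree - 1)) ∈ L :=
    L.mul_mem (zpow_mem hπL _) (L.div_mem hγL (pow_mem htL _))
  refine ⟨fun m hE => ExpSum.subsingleton_cohomology hlam ht ht0 hu₀ hu₀L hD he₁ hδ hE,
    fun hE => ?_⟩
  have hJ := ExpSum.finite_jacobian_of_vanishing hδ hE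
  obtain ⟨U, hU, hUcard⟩ := ExpSum.exists_isAdaptedBasis hJ
  obtain ⟨h1, h2, h3⟩ := ExpSum.milnor_of_finite_jacobian f
  obtain ⟨h4, h5⟩ := ExpSum.finrank_cohomology hlam ht ht0 hu₀ hu₀L hD he₁ hδ
    (fun r s hrs => hE r s (by omega)) hU
  exact ⟨h1, h2, h4, by rw [h3, ← hUcard]; exact h5⟩
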